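/- Fix $k,l\ge 0$, control variables $X=\{x_1,\dots,x_k\}$, data variables $Y=\{y_1,\dots,y_l\}$ and a further symbol $\mathit{cur}$. A register automaton over the rationals ($\mathrm{RA}_{\mathbb Q}$) over $(X,Y)$ is a tuple $\mathcal A=\langle Q,q_0,F,u_0,\delta,\zeta\rangle$, where $Q$ is a finite set of states, $q_0\in Q$, $F\subseteq Q$, $u_0\in\mathbb Q^{k+l}$ is the initial contents of the variables, $\delta$ is a finite set of transitions $(p,\varphi)\to(q,A,B,b)$, and $\zeta$ maps each final state $q\in F$ to an expression $\zeta(q)(x,y)=a\cdot x+a'\cdot y+c$ with rational coefficients. Here $p,q\in Q$; the guard $\varphi$ is a Boolean combination of atoms $z\le z'$ with $z,z'\in X\cup\{\mathit{cur}\}$; $A$ is a $k\times(k+1)$ 0-1 matrix with exactly one $1$ in each row (it assigns to each control variable a control variable or $\mathit{cur}$); $B\in\mathbb Q^{l\times(k+l+1)}$ and $b\in\mathbb Q^l$. Reading $d\in\mathbb Q$ in state $p$ with contents $(u,v)\in\mathbb Q^k\times\mathbb Q^l$ of the variables, $\mathcal A$ can take this transition if $\varphi(u,d)$ holds; it then enters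 $q$ with contents $\bigl(A\binom{u}{d},\,B(u,v,d)^{t}+b\bigr)$. For a word $w\in\mathbb Q^*$, $\mathcal A(w)$ is the set of the values $\zeta(q)(u)$ over all runs on $w$ from $(q_0,u_0)$ that end in a configuration $(q,u)$ with $q\in F$; $\mathcal A^q\subseteq\mathbb Q^{k+l}$ is the set of all $u$ such that $(q,u)$ is reachable from $(q_0,u_0)$ by reading some word. $\mathcal A$ is deterministic if the guards of any two distinct transitions that start in the same state are jointly unsatisfiable. Consider the following decision problems, whose inputs are deterministic $\mathrm{RA}_{\mathbb Q}$ (with numbers written in binary). 1. Equivalence: given $\mathcal A$ and $\mathcal A'$ (possibly over different variables), is $\mathcal A(w)=\mathcal A'(w)$ for all $w\in\mathbb Q^*$? 2. Commutativity: given $\mathcal A$, is $\mathcal A(w)=\mathcal A(w')$ for all words $w$ and all permutations $w'$ of $w$? 3. Non-zero: given $\mathcal A$, is there a word $w$ with $\mathcal A(w)\not\subseteq\{0\}$? 4. Invariant: given $\mathcal A$, a state $q$ and an affine space $\mathbb H\subseteq\mathbb Q^{k+l}$, is $\mathcal A^q\not\subseteq\mathbb H$? Here $\mathbb H$ is given either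 by a point $a$ and a basis of the vector space $\mathbb V$ with $\mathbb H=a+\mathbb V$, or by a finite non-empty family of vectors whose set of affine combinations is $\mathbb H$; these are two versions of the problem. Theorem. Each of these problems (the invariant problem in either version) is reducible to each other one by a polynomial-time Turing (Cook) reduction: it can be decided in polynomial time in the bit size of its input by a deterministic algorithm with an oracle for the other problem, all of whose queries are legal inputs of that problem. -/

import Mathlib

namespace RegAut

/-! ## Register automata over the rationals -/

/-- Contents of the `k` control and `l` data variables: a vector of `ℚ^(k+l)`,
whose coordinates `Sum.inl i` are the control variables `x_i` and
`Sum.inr j` the data variables `y_j`. -/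
abbrev Vec (k l : ℕ) : Type := Fin k ⊕ Fin l → ℚ

/-- Extends an assignment of the variables in `ι` by the value `d` of the special
variable `cur`, which is written `none`. -/
def ext {ι : Type} (u : ι → ℚ) (d : ℚ) : Option ι → ℚ
  | none => d
  | some i => u i

/-- Linear constraints over the control variables and `cur`: Boolean combinations of atoms
`z ≤ z'`, where `none` stands for `cur` and `some i` for the control variable `x_i`. -/
inductive Guard (k : ℕ) : Type
  | le (z z' : Option (Fin k)) : Guard k
  | neg (φ : Guard k) : Guard k
  | conj (φ ψ : Guard k) : Guard k
  | disj (φ ψ : Guard k) : Guard k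

/-- Truth of a guard under an assignment of the control variables and `cur`. -/
def Guard.Sat {k : ℕ} (s : Option (Fin k) → ℚ) : Guard k → Prop
  | .le z z' => s z ≤ s z'
  | .neg φ => ¬ φ.Sat s
  | .conj φ ψ => φ.Sat s ∧ ψ.Sat s
  | .disj φ ψ => φ.Sat s ∨ ψ.Sat s

/-- A transition `(src, guard) → (tgt, A, B, b)` of an automaton with states `Fin n`. The 0-1
matrix `A` with a single `1` in each row is given as the map that it denotes, from control
variables to control variables and `cur` (written `none`). The columns of `B` are indexed by
the control variables, the data variables and `cur`. -/
structure Transition (k l n : ℕ) : Type where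
  src : Fin n
  guard : Guard k
  tgt : Fin n
  A : Fin k → Option (Fin k)
  B : Matrix (Fin l) (Option (Fin k ⊕ Fin l)) ℚ
  b : Fin l → ℚ

/-- A linear expression `coeff · u + const` over all the variables. -/
structure LinExpr (k l : ℕ) : Type where
  coeff : Vec k l
  const : ℚ

/-- The value of a linear expression. -/
def LinExpr.value {k l : ℕ} (g : LinExpr k l) (u : Vec k l) : ℚ :=
  g.coeff ⬝ᵥ u + g.const

/-- A register automaton over the rationals with `k` control variables, `l` data variables and
the set of states `Fin n`. The finite set of transitions is given by a list that enumerates it.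
The output map is a partial map on the states; the final states are those
on which it is defined. -/
structure RAQ : Type where
  k : ℕ
  l : ℕ
  n : ℕ
  q₀ : Fin n
  u₀ : Vec k l
  δ : List (Transition k l n)
  ζ : Fin n → Option (LinExpr k l)

namespace RAQ

variable (A : RAQ)

/-- A configuration: a state and the contents of the variables. -/
abbrev Config : Type := Fin A.n × Vec A.k A.l

/-- The relation between configurations that a transition `t` and an input value `d` entail. -/
def Step (t : Transition A.k A.l A.n) (d : ℚ) (c c' : A.Config) : Prop :=
  c.1 = t.src ∧ c'.1 = t.tgt ∧
  t.guard.Sat (ext (fun i => c.2 (Sum.inl i)) d) ∧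
  (∀ i, c'.2 (Sum.inl i) = ext (fun i => c.2 (Sum.inl i)) d (t.A i)) ∧
  (∀ j, c'.2 (Sum.inr j) = (t.B.mulVec (ext c.2 d) + t.b) j)

/-- `A.Run c w c'`: reading the word `w`, the automaton can go from `c` to `c'`
through transitions of `A`. -/
inductive Run : A.Config → List ℚ → A.Config → Prop
  | nil (c : A.Config) : Run c [] c
  | cons {c c' c'' : A.Config} {d : ℚ} {w : List ℚ} (t : Transition A.k A.l A.n)
      (ht : t ∈ A.δ) (h : A.Step t d c c') (hr : Run c' w c'') : Run c (d :: w) c''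

/-- The initial configuration. -/
def initial : A.Config := (A.q₀, A.u₀)

/-- The set of all outputs of the automaton on the word `w`. -/
def outputs (w : List ℚ) : Set ℚ :=
  {r | ∃ c : A.Config, A.Run A.initial w c ∧ ∃ g, A.ζ c.1 = some g ∧ r = g.value c.2}

/-- The set of the contents of the variables with which the state `q` can be reached. -/
def reach (q : Fin A.n) : Set (Vec A.k A.l) :=
  {v | ∃ w : List ℚ, A.Run A.initial w (q, v)}

/-- The guards of any two distinct transitions that start in the same state are jointly
unsatisfiable. -/
def Deterministic : Prop :=
  ∀ t ∈ A.δ, ∀ t' ∈ A.δ, t ≠ t' → t.src = t'.src →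
    ¬ ∃ s : Option (Fin A.k) → ℚ, t.guard.Sat s ∧ t'.guard.Sat s

end RAQ

/-! ## Data and their bit size -/

/-- Binary trees with integer leaves: the inputs and outputs of programs. -/
inductive Data : Type
  | num (z : ℤ) : Data
  | pair (x y : Data) : Data

namespace Data

/-- The bit size: integers are written in binary. -/
def size : Data → ℕ
  | num z => 1 + z.natAbs.size
  | pair x y => 1 + x.size + y.size

def fst : Data → Data
  | num _ => num 0
  | pair x _ => x

def snd : Data → Data
  | num _ => num 0
  | pair _ y => y

def toInt : Data → ℤ
  | num z => z
  | pair _ _ => 0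

def ofBool (b : Bool) : Data := num (if b then 1 else 0)

def isPair : Data → Bool
  | num _ => false
  | pair _ _ => true

/-- A list is written as nested pairs that end in `num 0`. -/
def ofList : List Data → Data
  | [] => num 0
  | x :: xs => pair x (ofList xs)

theorem ofList_injective : Function.Injective ofList := by
  intro a
  induction a with
  | nil => intro b h; cases b <;> simp_all [ofList]
  | cons x xs ih =>
    intro b h
    cases b with
    | nil => simp [ofList] at h
    | cons y ys =>
      simp only [ofList, pair.injEq] at h
      rw [h.1, ih h.2]

theorem ofBool_injective : Function.Injective ofBool := by
  intro a b h
  cases a <;> cases b <;> simp_all [ofBool]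

end Data

/-! ## Oracle programs with a bit-cost time measure -/

/-- Elementary operations. Arithmetic is on pairs of integers; `div` is integer division. -/
inductive Op : Type
  | id | fst | snd | isPair | add | sub | mul | div | le
  | const (c : Data)

def Op.eval : Op → Data → Data
  | .id, d => d
  | .fst, d => d.fst
  | .snd, d => d.snd
  | .isPair, d => .ofBool d.isPair
  | .add, d => .num (d.fst.toInt + d.snd.toInt)
  | .sub, d => .num (d.fst.toInt - d.snd.toInt)
  | .mul, d => .num (d.fst.toInt * d.snd.toInt)
  | .div, d => .num (d.fst.toInt / d.snd.toInt)
  | .le, d => .ofBool (decide (d.fst.toInt ≤ d.snd.toInt))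
  | .const c, _ => c

/-- While programs with oracle queries. A program transforms one datum into another. -/
inductive Prog : Type
  | op (o : Op) : Prog
  /-- replace the datum, the question, by the answer of the oracle -/
  | query : Prog
  /-- run `f`, then run `g` on the result -/
  | seq (f g : Prog) : Prog
  /-- run `f` and `g` on copies of the datum and pair their results -/
  | pair (f g : Prog) : Prog
  /-- run the test `c` on a copy of the datum, then `f` if its result is not `0`, else `g` -/
  | ite (c f g : Prog) : Prog
  /-- as long as the test `c` on a copy of the datum does not give `0`, transform it by `f` -/
  | while (c f : Prog) : Prog

/-- `Runs O p d r t`: on the input `d`, the program `p` with the oracle `O` halts with the result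
`r` after time `t`. Here `O d b` means that the oracle answers `b` to the question `d`; a question
that has no answer blocks the program. Every elementary step (an operation, a query, a copy, a
test, an iteration) is charged with the number of bits that it reads and writes, so that
time is polynomially related to the number of steps of a multitape oracle Turing machine. -/
inductive Runs (O : Data → Bool → Prop) : Prog → Data → Data → ℕ → Prop
  | op (o : Op) (d : Data) :
      Runs O (.op o) d (o.eval d) (1 + d.size + (o.eval d).size)
  | query {d : Data} {b : Bool} (h : O d b) :
      Runs O .query d (.ofBool b) (1 + d.size + (Data.ofBool b).size)
  | seq {f g : Prog} {d x y : Data} {s t : ℕ} (hf : Runs O f d x s) (hg : Runs O g x y t) :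
      Runs O (.seq f g) d y (1 + s + t)
  | pair {f g : Prog} {d x y : Data} {s t : ℕ} (hf : Runs O f d x s) (hg : Runs O g d y t) :
      Runs O (.pair f g) d (.pair x y) (1 + d.size + (Data.pair x y).size + s + t)
  | ite_true {c f g : Prog} {d b x : Data} {s t : ℕ} (hc : Runs O c d b s) (hb : b ≠ .num 0)
      (hf : Runs O f d x t) : Runs O (.ite c f g) d x (1 + d.size + s + t)
  | ite_false {c f g : Prog} {d x : Data} {s t : ℕ} (hc : Runs O c d (.num 0) s)
      (hg : Runs O g d x t) : Runs O (.ite c f g) d x (1 + d.size + s + t)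
  | while_stop {c f : Prog} {d : Data} {s : ℕ} (hc : Runs O c d (.num 0) s) :
      Runs O (.while c f) d d (1 + d.size + s)
  | while_step {c f : Prog} {d b x y : Data} {s t r : ℕ} (hc : Runs O c d b s)
      (hb : b ≠ .num 0) (hf : Runs O f d x t) (hw : Runs O (.while c f) x y r) :
      Runs O (.while c f) d y (1 + d.size + s + t + r)

/-- Programs are deterministic: result and time are unique. -/
theorem Runs.unique {O : Data → Bool → Prop} (hO : ∀ d b b', O d b → O d b' → b = b')
    {p : Prog} {d r : Data} {t : ℕ} (h : Runs O p d r t) :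
    ∀ {r' : Data} {t' : ℕ}, Runs O p d r' t' → r = r' ∧ t = t' := by
  induction h with
  | op o d => intro r' t' h'; cases h'; exact ⟨rfl, rfl⟩
  | query h =>
    intro r' t' h'
    cases h' with
    | query h'' => rw [hO _ _ _ h h'']; exact ⟨rfl, rfl⟩
  | seq _ _ ihf ihg =>
    intro r' t' h'
    cases h' with
    | seq hf hg =>
      obtain ⟨rfl, rfl⟩ := ihf hf
      obtain ⟨rfl, rfl⟩ := ihg hg
      exact ⟨rfl, rfl⟩
  | pair _ _ ihf ihg =>
    intro r' t' h'
    cases h' with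
    | pair hf hg =>
      obtain ⟨rfl, rfl⟩ := ihf hf
      obtain ⟨rfl, rfl⟩ := ihg hg
      exact ⟨rfl, rfl⟩
  | ite_true _ hb _ ihc ihf =>
    intro r' t' h'
    cases h' with
    | ite_true hc _ hf =>
      obtain ⟨rfl, rfl⟩ := ihc hc
      obtain ⟨rfl, rfl⟩ := ihf hf
      exact ⟨rfl, rfl⟩
    | ite_false hc _ => exact absurd (ihc hc).1 hb
  | ite_false _ _ ihc ihg =>
    intro r' t' h'
    cases h' with
    | ite_true hc hb _ => exact absurd (ihc hc).1.symm hb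
    | ite_false hc hg =>
      obtain ⟨_, rfl⟩ := ihc hc
      obtain ⟨rfl, rfl⟩ := ihg hg
      exact ⟨rfl, rfl⟩
  | while_stop _ ihc =>
    intro r' t' h'
    cases h' with
    | while_stop hc => obtain ⟨_, rfl⟩ := ihc hc; exact ⟨rfl, rfl⟩
    | while_step hc hb _ _ => exact absurd (ihc hc).1.symm hb
  | while_step _ hb _ _ ihc ihf ihw =>
    intro r' t' h'
    cases h' with
    | while_stop hc => exact absurd (ihc hc).1 hb
    | while_step hc _ hf hw =>
      obtain ⟨rfl, rfl⟩ := ihc hc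
      obtain ⟨rfl, rfl⟩ := ihf hf
      obtain ⟨rfl, rfl⟩ := ihw hw
      exact ⟨rfl, rfl⟩

/-- The time is at least the bit size of the result. -/
theorem Runs.size_le {O : Data → Bool → Prop} {p : Prog} {d r : Data} {t : ℕ}
    (h : Runs O p d r t) : r.size ≤ t := by
  induction h <;> (try simp only [Data.size] at *) <;> omega

/-! ## Decision problems and Cook reductions -/

/-- A decision problem: instances, their encoding as data, and the yes-instances. -/
structure Problem : Type 1 where
  Instance : Type
  encode : Instance → Data
  encode_injective : Function.Injective encode
  Holds : Instance → Prop

/-- The oracle for `P`: it answers `b` to the encoding of an instance if `b` is the truth value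
of `P` there, and it does not answer anything else. -/
def Problem.oracle (P : Problem) (d : Data) (b : Bool) : Prop :=
  ∃ a : P.Instance, P.encode a = d ∧ (b = true ↔ P.Holds a)

/-- Polynomial-time Turing (Cook) reducibility: some program with an oracle for `Q` decides `P`
in time bounded by a polynomial in the bit size of the instance. All its queries
are instances of `Q`. -/
def CookReducible (P Q : Problem) : Prop :=
  ∃ (p : Prog) (f : Polynomial ℕ), ∀ a : P.Instance, ∃ (b : Bool) (t : ℕ),
    Runs Q.oracle p (P.encode a) (.ofBool b) t ∧ (b = true ↔ P.Holds a) ∧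
      t ≤ f.eval (P.encode a).size

/-! ## Encodings -/

def encFin {n : ℕ} (i : Fin n) : Data := .num (i : ℕ)

def encRat (r : ℚ) : Data := .pair (.num r.num) (.num (r.den : ℕ))

def encOption {α : Type} (e : α → Data) : Option α → Data
  | none => .num 0
  | some a => .pair (.num 1) (e a)

/-- A finite family is written as the list of its members. -/
def encFun {α : Type} (e : α → Data) {n : ℕ} (f : Fin n → α) : Data :=
  .ofList (List.ofFn fun i => e (f i))

def encVec {k l : ℕ} (u : Vec k l) : Data :=
  .pair (encFun encRat fun i => u (Sum.inl i)) (encFun encRat fun j => u (Sum.inr j))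

/-- A row of a matrix `B`. -/
def encRow {k l : ℕ} (u : Option (Fin k ⊕ Fin l) → ℚ) : Data :=
  .pair (encVec fun i => u (some i)) (encRat (u none))

def encGuard {k : ℕ} : Guard k → Data
  | .le z z' => .pair (.num 0) (.pair (encOption encFin z) (encOption encFin z'))
  | .neg φ => .pair (.num 1) (encGuard φ)
  | .conj φ ψ => .pair (.num 2) (.pair (encGuard φ) (encGuard ψ))
  | .disj φ ψ => .pair (.num 3) (.pair (encGuard φ) (encGuard ψ))

def encTransition {k l n : ℕ} (t : Transition k l n) : Data :=
  .ofList [encFin t.src, encGuard t.guard, encFin t.tgt, encFun (encOption encFin) t.A,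
    encFun encRow t.B, encFun encRat t.b]

def encLinExpr {k l : ℕ} (g : LinExpr k l) : Data :=
  .pair (encVec g.coeff) (encRat g.const)

def encRAQ (A : RAQ) : Data :=
  .ofList [.num (A.k : ℕ), .num (A.l : ℕ), .num (A.n : ℕ), encFin A.q₀, encVec A.u₀,
    .ofList (A.δ.map encTransition), encFun (encOption encLinExpr) A.ζ]

theorem encFin_injective {n : ℕ} : Function.Injective (encFin (n := n)) := by
  intro a b h
  simp only [encFin, Data.num.injEq, Nat.cast_inj] at h
  exact Fin.ext h

theorem encRat_injective : Function.Injective encRat := by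
  intro a b h
  simp only [encRat, Data.pair.injEq, Data.num.injEq, Nat.cast_inj] at h
  exact Rat.ext h.1 h.2

theorem encOption_injective {α : Type} {e : α → Data} (he : Function.Injective e) :
    Function.Injective (encOption e) := by
  intro a b h
  cases a <;> cases b <;> simp only [encOption, Data.pair.injEq, reduceCtorEq] at h
  · rfl
  · rw [he h.2]

theorem encFun_injective {α : Type} {e : α → Data} (he : Function.Injective e) {n : ℕ} :
    Function.Injective (encFun e (n := n)) := by
  intro f g h
  have h' := List.ofFn_injective (Data.ofList_injective h)
  funext i
  exact he (congrFun h' i)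

theorem encVec_injective {k l : ℕ} : Function.Injective (encVec (k := k) (l := l)) := by
  intro u v h
  simp only [encVec, Data.pair.injEq] at h
  have h₁ := encFun_injective encRat_injective h.1
  have h₂ := encFun_injective encRat_injective h.2
  funext i
  cases i with
  | inl i => exact congrFun h₁ i
  | inr j => exact congrFun h₂ j

theorem encRow_injective {k l : ℕ} : Function.Injective (encRow (k := k) (l := l)) := by
  intro u v h
  simp only [encRow, Data.pair.injEq] at h
  have h₁ := encVec_injective h.1
  funext i
  cases i with
  | none => exact encRat_injective h.2
  | some i => exact congrFun h₁ i

theorem encGuard_injective {k : ℕ} : Function.Injective (encGuard (k := k)) := by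
  intro a
  induction a with
  | le z z' =>
    intro b h
    cases b <;> simp [encGuard] at h
    rw [encOption_injective encFin_injective h.1, encOption_injective encFin_injective h.2]
  | neg φ ih =>
    intro b h
    cases b <;> simp [encGuard] at h
    rw [ih h]
  | conj φ ψ ih₁ ih₂ =>
    intro b h
    cases b <;> simp [encGuard] at h
    rw [ih₁ h.1, ih₂ h.2]
  | disj φ ψ ih₁ ih₂ =>
    intro b h
    cases b <;> simp [encGuard] at h
    rw [ih₁ h.1, ih₂ h.2]

theorem encTransition_injective {k l n : ℕ} :
    Function.Injective (encTransition (k := k) (l := l) (n := n)) := by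
  rintro ⟨s, φ, q, A, B, b⟩ ⟨s', φ', q', A', B', b'⟩ h
  have h' := Data.ofList_injective h
  simp only [List.cons.injEq, and_true] at h'
  obtain ⟨h₁, h₂, h₃, h₄, h₅, h₆⟩ := h'
  obtain rfl := encFin_injective h₁
  obtain rfl := encGuard_injective h₂
  obtain rfl := encFin_injective h₃
  obtain rfl := encFun_injective (encOption_injective encFin_injective) h₄
  obtain rfl := encFun_injective encRow_injective h₅
  obtain rfl := encFun_injective encRat_injective h₆
  rfl

theorem encLinExpr_injective {k l : ℕ} : Function.Injective (encLinExpr (k := k) (l := l)) := by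
  rintro ⟨a, c⟩ ⟨a', c'⟩ h
  simp only [encLinExpr, Data.pair.injEq] at h
  obtain rfl := encVec_injective h.1
  obtain rfl := encRat_injective h.2
  rfl

theorem encRAQ_injective : Function.Injective encRAQ := by
  rintro ⟨k, l, n, q, u, δ, ζ⟩ ⟨k', l', n', q', u', δ', ζ'⟩ h
  have h' := Data.ofList_injective h
  simp only [List.cons.injEq, and_true, Data.num.injEq, Nat.cast_inj] at h'
  obtain ⟨rfl, rfl, rfl, h₁, h₂, h₃, h₄⟩ := h'
  obtain rfl := encFin_injective h₁
  obtain rfl := encVec_injective h₂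
  obtain rfl := List.map_injective_iff.2 encTransition_injective (Data.ofList_injective h₃)
  obtain rfl := encFun_injective (encOption_injective encLinExpr_injective) h₄
  rfl

/-! ## The problems -/

/-- Deterministic register automata over the rationals. -/
abbrev DetRAQ : Type := {A : RAQ // A.Deterministic}

/-- Given two automata, is `A(w) = A'(w)` for all words `w`? -/
def equivalence : Problem where
  Instance := DetRAQ × DetRAQ
  encode a := .pair (encRAQ a.1) (encRAQ a.2)
  encode_injective := by
    rintro ⟨a, b⟩ ⟨a', b'⟩ h
    simp only [Data.pair.injEq] at h
    rw [Subtype.ext (encRAQ_injective h.1), Subtype.ext (encRAQ_injective h.2)]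
  Holds a := ∀ w : List ℚ, a.1.1.outputs w = a.2.1.outputs w

/-- Given an automaton, is `A(w) = A(w')` for all permutations `w'` of any word `w`? -/
def commutativity : Problem where
  Instance := DetRAQ
  encode a := encRAQ a
  encode_injective _ _ h := Subtype.ext (encRAQ_injective h)
  Holds a := ∀ w w' : List ℚ, w'.Perm w → a.1.outputs w = a.1.outputs w'

/-- Given an automaton, does it output a non-zero value on some word? -/
def nonZero : Problem where
  Instance := DetRAQ
  encode a := encRAQ a
  encode_injective _ _ h := Subtype.ext (encRAQ_injective h)
  Holds a := ∃ w : List ℚ, ¬ a.1.outputs w ⊆ {0}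

/-- An instance of the invariant problem whose affine space is given by a point `p` and a
basis `v` of the vector space of its directions. -/
structure BasisInstance : Type where
  aut : DetRAQ
  q : Fin aut.1.n
  p : Vec aut.1.k aut.1.l
  m : ℕ
  v : Fin m → Vec aut.1.k aut.1.l
  indep : LinearIndependent ℚ v

/-- Given an automaton, a state `q` and an affine space `H` (as a point and a basis),
is the set of the vectors reachable at `q` not contained in `H`? -/
def invariantBasis : Problem where
  Instance := BasisInstance
  encode a := .ofList [encRAQ a.aut, encFin a.q, encVec a.p, .num (a.m : ℕ), encFun encVec a.v]
  encode_injective := by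
    rintro ⟨A, q, p, m, v, hv⟩ ⟨A', q', p', m', v', hv'⟩ h
    have h' := Data.ofList_injective h
    simp only [List.cons.injEq, and_true, Data.num.injEq, Nat.cast_inj] at h'
    obtain ⟨h₁, h₂, h₃, rfl, h₅⟩ := h'
    obtain rfl := Subtype.ext (encRAQ_injective h₁)
    obtain rfl := encFin_injective h₂
    obtain rfl := encVec_injective h₃
    obtain rfl := encFun_injective encVec_injective h₅
    rfl
  Holds a := ¬ a.aut.1.reach a.q ⊆
    (AffineSubspace.mk' a.p (Submodule.span ℚ (Set.range a.v)) : Set (Vec a.aut.1.k a.aut.1.l))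

/-- An instance of the invariant problem whose affine space is given as the set of the affine
combinations of finitely many, but at least one, vectors. -/
structure SpanInstance : Type where
  aut : DetRAQ
  q : Fin aut.1.n
  m : ℕ
  v : Fin (m + 1) → Vec aut.1.k aut.1.l

/-- Given an automaton, a state `q` and an affine space `H` (as the affine span of vectors),
is the set of the vectors reachable at `q` not contained in `H`? -/
def invariantSpan : Problem where
  Instance := SpanInstance
  encode a := .ofList [encRAQ a.aut, encFin a.q, .num (a.m : ℕ), encFun encVec a.v]
  encode_injective := by
    rintro ⟨A, q, m, v⟩ ⟨A', q', m', v'⟩ h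
    have h' := Data.ofList_injective h
    simp only [List.cons.injEq, and_true, Data.num.injEq, Nat.cast_inj] at h'
    obtain ⟨h₁, h₂, rfl, h₄⟩ := h'
    obtain rfl := Subtype.ext (encRAQ_injective h₁)
    obtain rfl := encFin_injective h₂
    obtain rfl := encFun_injective encVec_injective h₄
    rfl
  Holds a := ¬ a.aut.1.reach a.q ⊆
    (affineSpan ℚ (Set.range a.v) : Set (Vec a.aut.1.k a.aut.1.l))

end RegAut

namespace RegAut

open Data

/-! ## Polynomial-time computability -/

/-! Cook reducibility is transitive, so it suffices to reduce every problem to the non-zero problem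
and the non-zero problem to every other one. There is a cycle equivalence → non-zero → commutativity
→ equivalence, and there are reductions in both directions between non-zero and either version of
the invariant problem.

The basic device is `record`. A sink makes the automaton total, and two new data variables hold the
output before the last letter: a flag that tells whether there is one, and its value. Blocked runs
and non-final states then need no special care, at the price of a delay by one letter.

Equivalence to non-zero (`equivalence_holds_iff`): a synchronized product of two recording automata
outputs the difference of the flags, or of the values. The automata are equivalent iff neither
product ever outputs a non-zero number.

Commutativity to equivalence (`commutativity_holds_iff`): permutations are generated by
transpositions of neighbours. The controller can only forward the letter that is being read, so a
letter that is to be delayed occurs twice in the input. On blocks `d d` and `d d' d`, one automaton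
forwards the first letter at once and the other one at the end of the block. They are equivalent iff
swaps of distinct neighbours do not matter.

Non-zero to commutativity (`nonZero_holds_iff_selected`): two additional leading letters are
compared. If they increase, the recording automaton runs on the rest; otherwise it stays in its
initial configuration, where the output is 0.

Non-zero to invariant: at each state of the recording automaton, ask whether the hyperplane on which
the recorded value vanishes is ever left.

Invariant to non-zero: an affine space is the common zero set of affine forms, each of which in turn
becomes the output at `q`. The forms are the rows of a multiple of the orthogonal projection whose
kernel is spanned by the generators in homogeneous coordinates. Fraction-free elimination computes
it: the denominator is a Gram determinant, so all divisions are exact, and it is at most the product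
of the numbers `1 + v ⬝ᵥ v`, so bit sizes stay polynomial (`ElimInv.elimStep`).

The remaining work is to show that these constructions run in polynomial time in the program model.
`PolyTime` is closed under composition, pairing, tests and loops with bounded length and bounded
data; list operations, arithmetic and the constructions on encoded automata are assembled from
these. -/

theorem Polynomial.eval_nat_mono (g : Polynomial ℕ) {x y : ℕ} (h : x ≤ y) :
    g.eval x ≤ g.eval y := by
  simp only [Polynomial.eval_eq_sum_range]
  gcongr

theorem Runs.while_zero {O : Data → Bool → Prop} {c f : Prog} {d : Data} {s : ℕ}
    (hc : Runs O c d (.num 0) s) : Runs O (.while c f) d d (1 + d.size + s) := by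
  constructor
  exact hc

/-- `o a` can be computed from `i a` in time polynomial in the size of `i a`, by a program that
may query the oracle `O`. -/
def PolyTime (O : Data → Bool → Prop) {α : Type} (i o : α → Data) : Prop :=
  ∃ (p : Prog) (g : Polynomial ℕ), ∀ a, ∃ t, Runs O p (i a) (o a) t ∧ t ≤ g.eval (i a).size

/-- `f` is bounded by a polynomial in the size of the input. -/
def PolyBdd {α : Type} (i : α → Data) (f : α → ℕ) : Prop :=
  ∃ g : Polynomial ℕ, ∀ a, f a ≤ g.eval (i a).size

namespace PolyBdd

variable {α β : Type} {i m : α → Data} {f f' : α → ℕ}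

theorem mono (h : PolyBdd i f) (h' : ∀ a, f' a ≤ f a) : PolyBdd i f' := by
  obtain ⟨g, hg⟩ := h
  exact ⟨g, fun a => (h' a).trans (hg a)⟩

theorem add (h : PolyBdd i f) (h' : PolyBdd i f') : PolyBdd i fun a => f a + f' a := by
  obtain ⟨g, hg⟩ := h
  obtain ⟨g', hg'⟩ := h'
  exact ⟨g + g', fun a => by rw [Polynomial.eval_add]; exact add_le_add (hg a) (hg' a)⟩

theorem mul (h : PolyBdd i f) (h' : PolyBdd i f') : PolyBdd i fun a => f a * f' a := by
  obtain ⟨g, hg⟩ := h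
  obtain ⟨g', hg'⟩ := h'
  exact ⟨g * g', fun a => by rw [Polynomial.eval_mul]; exact Nat.mul_le_mul (hg a) (hg' a)⟩

theorem const (i : α → Data) (c : ℕ) : PolyBdd i fun _ => c :=
  ⟨Polynomial.C c, fun a => by simp⟩

theorem size (i : α → Data) : PolyBdd i fun a => (i a).size :=
  ⟨Polynomial.X, fun a => by simp⟩

theorem comap (φ : β → α) (h : PolyBdd i f) : PolyBdd (fun b => i (φ b)) fun b => f (φ b) := by
  obtain ⟨g, hg⟩ := h
  exact ⟨g, fun a => hg _⟩

theorem trans (h : PolyBdd i fun a => (m a).size) (h' : PolyBdd m f) : PolyBdd i f := by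
  obtain ⟨g, hg⟩ := h
  obtain ⟨g', hg'⟩ := h'
  exact ⟨g'.comp g, fun a => (hg' a).trans <| by
    rw [Polynomial.eval_comp]; exact Polynomial.eval_nat_mono _ (hg a)⟩

end PolyBdd

theorem Data.size_pos (d : Data) : 0 < d.size := by
  cases d <;> simp only [Data.size] <;> omega

theorem Data.size_fst (d : Data) : d.fst.size ≤ d.size := by
  cases d with
  | num z => simp [Data.size, Data.fst]
  | pair x y => simp only [Data.size, Data.fst]; omega

theorem Data.size_snd (d : Data) : d.snd.size ≤ d.size := by
  cases d <;> simp [Data.size, Data.snd]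

theorem Data.size_toInt (d : Data) : d.toInt.natAbs.size + 1 ≤ d.size := by
  cases d with
  | num z => simp only [Data.size, Data.toInt]; omega
  | pair x y => simp only [Data.size, Data.toInt, Int.natAbs_zero, Nat.size_zero]; omega

theorem Data.size_ofBool (b : Bool) : (Data.ofBool b).size ≤ 2 := by
  cases b <;> simp [Data.ofBool, Data.size]

theorem Nat.size_add_le (a b : ℕ) : (a + b).size ≤ a.size + b.size + 1 := by
  rw [Nat.size_le]
  have ha := Nat.lt_size_self a
  have hb := Nat.lt_size_self b
  have h1 : 2 ^ a.size ≤ 2 ^ (a.size + b.size) := Nat.pow_le_pow_right (by norm_num) (by omega)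
  have h2 : 2 ^ b.size ≤ 2 ^ (a.size + b.size) := Nat.pow_le_pow_right (by norm_num) (by omega)
  rw [pow_succ]
  omega

theorem Nat.size_mul_le (a b : ℕ) : (a * b).size ≤ a.size + b.size := by
  rw [Nat.size_le, pow_add]
  exact Nat.mul_lt_mul'' (Nat.lt_size_self a) (Nat.lt_size_self b)

/-- The bits of a sum, product or quotient are bounded by those of the arguments, so a single
operation has polynomial cost. The size may double, which is why iteration requires a separate bound
on the data in `loop`. -/
theorem Op.size_eval (o : Op) : ∃ K, ∀ d, (o.eval d).size ≤ 2 * d.size + K := by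
  have key (d : Data) : d.fst.toInt.natAbs.size + d.snd.toInt.natAbs.size ≤ 2 * d.size := by
    have := Data.size_toInt d.fst
    have := Data.size_toInt d.snd
    have := Data.size_fst d
    have := Data.size_snd d
    omega
  cases o with
  | id => exact ⟨0, fun d => by simp only [Op.eval]; omega⟩
  | fst => exact ⟨0, fun d => by have := Data.size_fst d; simp only [Op.eval]; omega⟩
  | snd => exact ⟨0, fun d => by have := Data.size_snd d; simp only [Op.eval]; omega⟩
  | isPair => exact ⟨2, fun d => by have := Data.size_ofBool d.isPair; simp only [Op.eval]; omega⟩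
  | le =>
    exact ⟨2, fun d => by
      have := Data.size_ofBool (decide (d.fst.toInt ≤ d.snd.toInt)); simp only [Op.eval]; omega⟩
  | const c => exact ⟨c.size, fun d => by simp only [Op.eval]; omega⟩
  | add =>
    refine ⟨2, fun d => ?_⟩
    have h1 := Nat.size_le_size (Int.natAbs_add_le d.fst.toInt d.snd.toInt)
    have := Nat.size_add_le d.fst.toInt.natAbs d.snd.toInt.natAbs
    have := key d
    simp only [Op.eval, Data.size]; omega
  | sub =>
    refine ⟨2, fun d => ?_⟩
    have h1 := Nat.size_le_size (Int.natAbs_sub_le d.fst.toInt d.snd.toInt)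
    have := Nat.size_add_le d.fst.toInt.natAbs d.snd.toInt.natAbs
    have := key d
    simp only [Op.eval, Data.size]; omega
  | mul =>
    refine ⟨2, fun d => ?_⟩
    have := Nat.size_mul_le d.fst.toInt.natAbs d.snd.toInt.natAbs
    have := key d
    simp only [Op.eval, Data.size, Int.natAbs_mul]; omega
  | div =>
    refine ⟨2, fun d => ?_⟩
    have h1 := Nat.size_le_size (Int.natAbs_ediv_le_natAbs d.fst.toInt d.snd.toInt)
    have := key d
    simp only [Op.eval, Data.size]; omega

namespace PolyTime

variable {O : Data → Bool → Prop} {α β : Type} {i m o x y z : α → Data}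

theorem size_le (h : PolyTime O i o) : PolyBdd i fun a => (o a).size := by
  obtain ⟨p, g, h⟩ := h
  refine ⟨g, fun a => ?_⟩
  obtain ⟨t, ht, hle⟩ := h a
  exact ht.size_le.trans hle

theorem of_runs (p : Prog) {f : α → ℕ} (h : ∀ a, ∃ t, Runs O p (i a) (o a) t ∧ t ≤ f a)
    (hf : PolyBdd i f) : PolyTime O i o := by
  obtain ⟨g, hg⟩ := hf
  exact ⟨p, g, fun a => let ⟨t, ht, hle⟩ := h a; ⟨t, ht, hle.trans (hg a)⟩⟩

theorem exists_runs (h : PolyTime O i o) :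
    ∃ (p : Prog) (f : α → ℕ), (∀ a, ∃ t, Runs O p (i a) (o a) t ∧ t ≤ f a) ∧ PolyBdd i f := by
  obtain ⟨p, g, h⟩ := h
  exact ⟨p, _, h, g, fun a => le_rfl⟩

theorem comap (φ : β → α) (h : PolyTime O i o) :
    PolyTime O (fun b => i (φ b)) fun b => o (φ b) := by
  obtain ⟨p, g, h⟩ := h
  exact ⟨p, g, fun a => h _⟩

theorem congr (h : PolyTime O i o) (h' : ∀ a, o a = x a) : PolyTime O i x := by
  rwa [← funext h']

theorem op (o : Op) : PolyTime O i fun a => o.eval (i a) := by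
  obtain ⟨K, hK⟩ := o.size_eval
  exact of_runs (.op o) (fun a => ⟨_, .op o _, Nat.add_le_add_left (hK _) _⟩)
    (((PolyBdd.const i 1).add (.size i)).add (((PolyBdd.const i 2).mul (.size i)).add (.const i K)))

theorem refl : PolyTime O i i := op .id

/-- Time bounds the size of the result, so the intermediate datum has polynomial size and the second
time bound is polynomial in the size of the first input. -/
theorem trans (h : PolyTime O i m) (h' : PolyTime O m o) : PolyTime O i o := by
  have hs := h.size_le
  obtain ⟨p, f, h, hf⟩ := h.exists_runs
  obtain ⟨q, g, h', hg⟩ := h'.exists_runs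
  refine of_runs (.seq p q) (f := fun a => 1 + f a + g a) (fun a => ?_)
    (((PolyBdd.const i 1).add hf).add (hs.trans hg))
  obtain ⟨t, ht, hle⟩ := h a
  obtain ⟨t', ht', hle'⟩ := h' a
  exact ⟨_, .seq ht ht', by omega⟩

theorem const (c : Data) : PolyTime O i fun _ => c := op (.const c)

theorem pair (h : PolyTime O i x) (h' : PolyTime O i y) :
    PolyTime O i fun a => .pair (x a) (y a) := by
  have hs := h.size_le
  have hs' := h'.size_le
  obtain ⟨p, f, h, hf⟩ := h.exists_runs
  obtain ⟨q, g, h', hg⟩ := h'.exists_runs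
  refine of_runs (.pair p q)
    (f := fun a => 1 + (i a).size + (1 + (x a).size + (y a).size) + f a + g a) (fun a => ?_)
    (((((PolyBdd.const i 1).add (.size i)).add (((PolyBdd.const i 1).add hs).add hs')).add hf).add
      hg)
  obtain ⟨t, ht, hle⟩ := h a
  obtain ⟨t', ht', hle'⟩ := h' a
  exact ⟨_, .pair ht ht', by simp only [Data.size]; omega⟩

theorem fst (h : PolyTime O i x) : PolyTime O i fun a => (x a).fst := h.trans (op .fst)

theorem snd (h : PolyTime O i x) : PolyTime O i fun a => (x a).snd := h.trans (op .snd)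

theorem of_fst (h : PolyTime O i fun a => .pair (x a) (y a)) : PolyTime O i x := h.fst

theorem of_snd (h : PolyTime O i fun a => .pair (x a) (y a)) : PolyTime O i y := h.snd

theorem isPair (h : PolyTime O i x) : PolyTime O i fun a => .ofBool (x a).isPair :=
  h.trans (op .isPair)

/-- Each branch has to be computed only on the inputs that take it. Elsewhere it may make no sense,
as with the content of an option. -/
theorem cases {b : α → Bool} (hb : PolyTime O i fun a => .ofBool (b a))
    (h : PolyTime O (fun a : {a // b a = true} => i a) fun a => o a)
    (h' : PolyTime O (fun a : {a // b a = false} => i a) fun a => o a) : PolyTime O i o := by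
  obtain ⟨c, gc, hc⟩ := hb
  obtain ⟨p, gp, hp⟩ := h
  obtain ⟨q, gq, hq⟩ := h'
  refine ⟨.ite c p q, 1 + .X + gc + gp + gq, fun a => ?_⟩
  simp only [Polynomial.eval_add, Polynomial.eval_one, Polynomial.eval_X]
  obtain ⟨s, hs, hs'⟩ := hc a
  cases e : b a with
  | true =>
    obtain ⟨t, ht, ht'⟩ := hp ⟨a, e⟩
    simp only [e] at hs
    refine ⟨_, .ite_true hs (by simp [Data.ofBool]) ht, ?_⟩
    simp only at ht'; omega
  | false =>
    obtain ⟨t, ht, ht'⟩ := hq ⟨a, e⟩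
    simp only [e] at hs
    refine ⟨_, .ite_false hs ht, ?_⟩
    simp only at ht'; omega

theorem ite {p : α → Prop} [DecidablePred p] (hp : PolyTime O i fun a => .ofBool (decide (p a)))
    (hx : PolyTime O i x) (hy : PolyTime O i y) :
    PolyTime O i fun a => if p a then x a else y a := by
  refine cases hp ((hx.comap Subtype.val).congr fun a => ?_)
    ((hy.comap Subtype.val).congr fun a => ?_)
  · rw [if_pos (of_decide_eq_true a.2)]
  · rw [if_neg (of_decide_eq_false a.2)]

section Arithmetic

variable {u v : α → ℤ}

theorem add (hu : PolyTime O i fun a => num (u a)) (hv : PolyTime O i fun a => num (v a)) :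
    PolyTime O i fun a => num (u a + v a) := (hu.pair hv).trans (op .add)

theorem sub (hu : PolyTime O i fun a => num (u a)) (hv : PolyTime O i fun a => num (v a)) :
    PolyTime O i fun a => num (u a - v a) := (hu.pair hv).trans (op .sub)

theorem mul (hu : PolyTime O i fun a => num (u a)) (hv : PolyTime O i fun a => num (v a)) :
    PolyTime O i fun a => num (u a * v a) := (hu.pair hv).trans (op .mul)

theorem div (hu : PolyTime O i fun a => num (u a)) (hv : PolyTime O i fun a => num (v a)) :
    PolyTime O i fun a => num (u a / v a) := (hu.pair hv).trans (op .div)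

theorem le (hu : PolyTime O i fun a => num (u a)) (hv : PolyTime O i fun a => num (v a)) :
    PolyTime O i fun a => .ofBool (decide (u a ≤ v a)) := (hu.pair hv).trans (op .le)

theorem eq (hu : PolyTime O i fun a => num (u a)) (hv : PolyTime O i fun a => num (v a)) :
    PolyTime O i fun a => .ofBool (decide (u a = v a)) := by
  refine ((hu.le hv).ite (hv.le hu) (const (.ofBool false))).congr fun a => ?_
  split_ifs with h
  · simp [le_antisymm_iff, h]
  · simp [le_antisymm_iff, h]

theorem not {p : α → Prop} [DecidablePred p] (hp : PolyTime O i fun a => .ofBool (decide (p a))) :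
    PolyTime O i fun a => .ofBool (decide (¬ p a)) := by
  refine (hp.ite (const (.ofBool false)) (const (.ofBool true))).congr fun a => ?_
  split_ifs with h <;> simp [h]

end Arithmetic

/-! ### Loops -/

/-- A polynomial-time body may square the size of its datum, so polynomially many iterations alone
would not suffice. The states are therefore given in closed form, with a common polynomial bound on
their sizes, and the body is required to work only on states that occur. -/
theorem loop {s : α → ℕ → Data} {N : α → ℕ} (hN : PolyBdd (fun a => s a 0) N)
    {b : α → ℕ} (hs : ∀ a, ∀ j ≤ N a, (s a j).size ≤ b a) (hb : PolyBdd (fun a => s a 0) b)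
    (hc : PolyTime O (fun p : {p : α × ℕ // p.2 ≤ N p.1} => s p.1.1 p.1.2)
      fun p => .ofBool (decide (p.1.2 < N p.1.1)))
    (hf : PolyTime O (fun p : {p : α × ℕ // p.2 < N p.1} => s p.1.1 p.1.2)
      fun p => s p.1.1 (p.1.2 + 1)) :
    PolyTime O (fun a => s a 0) fun a => s a (N a) := by
  obtain ⟨c, gc, hc⟩ := hc
  obtain ⟨p, gp, hp⟩ := hf
  let C (a : α) : ℕ := 1 + b a + gc.eval (b a) + gp.eval (b a)
  refine of_runs (.while c p) (f := fun a => (N a + 1) * C a) (fun a => ?_) ?_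
  -- Here `j` counts the iterations that are still to come; each of them, and the final test, costs
  -- at most `C a`.
  · suffices h : ∀ j ≤ N a, ∃ t, Runs O (.while c p) (s a (N a - j)) (s a (N a)) t ∧
        t ≤ (j + 1) * C a by
      simpa using h (N a) le_rfl
    intro j
    induction j with
    | zero =>
      intro _
      obtain ⟨t, ht, ht'⟩ := hc ⟨(a, N a), le_rfl⟩
      simp only [lt_irrefl, decide_false] at ht
      refine ⟨_, .while_zero ht, ?_⟩
      have h1 := hs a (N a) le_rfl
      have h2 := Polynomial.eval_nat_mono gc h1
      simp only [C, Nat.sub_zero] at ht' ⊢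
      omega
    | succ j ih =>
      intro hj
      obtain ⟨r, hr, hr'⟩ := ih (by omega)
      have hlt : N a - (j + 1) < N a := by omega
      obtain ⟨t, ht, ht'⟩ := hc ⟨(a, N a - (j + 1)), hlt.le⟩
      obtain ⟨t₂, ht₂, ht₂'⟩ := hp ⟨(a, N a - (j + 1)), hlt⟩
      simp only [hlt, decide_true] at ht
      have e : N a - (j + 1) + 1 = N a - j := by omega
      simp only [e] at ht₂
      refine ⟨_, .while_step ht (by simp [Data.ofBool]) ht₂ hr, ?_⟩
      have h1 := hs a (N a - (j + 1)) hlt.le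
      have h2 := Polynomial.eval_nat_mono gc h1
      have h3 := Polynomial.eval_nat_mono gp h1
      rw [add_mul (j + 1), one_mul]
      simp only [C] at ht' ht₂' ⊢ hr'
      omega
  · obtain ⟨g, hg⟩ := hb
    have e (q : Polynomial ℕ) : PolyBdd (fun a => s a 0) fun a => q.eval (b a) :=
      ⟨q.comp g, fun a => by rw [Polynomial.eval_comp]; exact Polynomial.eval_nat_mono _ (hg a)⟩
    exact (hN.add (.const _ 1)).mul ((((PolyBdd.const _ 1).add ⟨g, hg⟩).add (e gc)).add (e gp))

end PolyTime

/-! ### Lists -/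

theorem Data.size_ofList (L : List Data) : (ofList L).size = 1 + (L.map fun d => 1 + d.size).sum := by
  induction L with
  | nil => simp [ofList, size]
  | cons x L ih => simp only [ofList, size, ih, List.map_cons, List.sum_cons]; omega

theorem Data.length_le_size_ofList (L : List Data) : L.length ≤ (ofList L).size := by
  induction L with
  | nil => simp
  | cons x L ih => simp only [ofList, size, List.length_cons]; omega

theorem Data.size_ofList_drop (L : List Data) (j : ℕ) :
    (ofList (L.drop j)).size ≤ (ofList L).size := by
  induction L generalizing j with
  | nil => simp
  | cons x L ih =>
    cases j with
    | zero => simp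
    | succ j => have := ih j; simp only [ofList, size, List.drop_succ_cons]; omega

theorem Data.size_le_of_mem {L : List Data} {d : Data} (h : d ∈ L) : d.size ≤ (ofList L).size := by
  induction L with
  | nil => simp at h
  | cons x L ih =>
    rcases List.mem_cons.1 h with rfl | h
    · simp only [ofList, size]; omega
    · have := ih h; simp only [ofList, size]; omega

theorem Data.size_ofList_append (L L' : List Data) :
    (ofList (L ++ L')).size + 1 = (ofList L).size + (ofList L').size := by
  simp only [size_ofList, List.map_append, List.sum_append]; omega

theorem Data.size_ofList_le {L : List Data} {c : ℕ} (h : ∀ d ∈ L, d.size ≤ c) :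
    (ofList L).size ≤ 1 + L.length * (1 + c) := by
  induction L with
  | nil => simp [ofList, size]
  | cons x L ih =>
    have := ih fun d hd => h d (List.mem_cons_of_mem _ hd)
    have := h x List.mem_cons_self
    simp only [ofList, size, List.length_cons, add_mul, one_mul] at *
    omega

namespace PolyTime

variable {O : Data → Bool → Prop} {α β : Type} {i m o x y z : α → Data}

/-- The loop state consists of the input, the unread rest of the list and the accumulator. The loop
ends when the rest is no longer a pair. The accumulator is given in closed form after each number of
elements, because its size must be bounded independently of the body. -/
theorem fold {L : α → List Data} {acc : α → ℕ → Data} (hL : PolyTime O i fun a => ofList (L a))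
    (h0 : PolyTime O i fun a => acc a 0) {b : α → ℕ} (hb : PolyBdd i b)
    (hs : ∀ a, ∀ j ≤ (L a).length, (acc a j).size ≤ b a)
    (hf : PolyTime O
      (fun p : (a : α) × Fin (L a).length => .pair (i p.1) (.pair (L p.1)[p.2] (acc p.1 p.2)))
      fun p => acc p.1 (p.2 + 1)) :
    PolyTime O i fun a => acc a (L a).length := by
  let s (a : α) (j : ℕ) : Data := .pair (i a) (.pair (ofList ((L a).drop j)) (acc a j))
  have h1 : PolyTime O i fun a => s a 0 := refl.pair ((hL.congr fun a => rfl).pair h0)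
  have h1' : PolyBdd (fun a => s a 0) fun a => (i a).size :=
    PolyTime.size_le (O := O) (refl (i := fun a => s a 0)).fst
  refine h1.trans ((loop (s := s) (N := fun a => (L a).length)
    (b := fun a => 2 + (i a).size + (ofList (L a)).size + b a) ?_ ?_ ?_ ?_ ?_).snd.snd)
  · exact h1'.trans (hL.size_le.mono fun a => length_le_size_ofList _)
  · intro a j hj
    have := hs a j hj
    have := size_ofList_drop (L a) j
    simp only [s, size]; omega
  · exact h1'.trans ((((PolyBdd.const _ 2).add (.size _)).add hL.size_le).add hb)
  · refine (refl (i := fun p : {p : α × ℕ // p.2 ≤ (L p.1).length} =>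
      s p.1.1 p.1.2)).snd.fst.isPair.congr ?_
    rintro ⟨⟨a, j⟩, hj⟩
    simp only [s, Data.snd, Data.fst]
    by_cases h : j < (L a).length
    · rw [List.drop_eq_getElem_cons h]; simp [ofList, Data.isPair, h]
    · rw [List.drop_eq_nil_of_le (by omega)]; simp [ofList, Data.isPair, h]
  · let φ (p : {p : α × ℕ // p.2 < (L p.1).length}) : (a : α) × Fin (L a).length :=
      ⟨p.1.1, p.1.2, p.2⟩
    have r := refl (O := O) (i := fun p : {p : α × ℕ // p.2 < (L p.1).length} => s p.1.1 p.1.2)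
    have hx (p : {p : α × ℕ // p.2 < (L p.1).length}) :
        (L p.1.1).drop p.1.2 = (L p.1.1)[p.1.2]'p.2 :: (L p.1.1).drop (p.1.2 + 1) :=
      List.drop_eq_getElem_cons p.2
    have h3 := r.snd.fst.snd.congr (x := fun p => ofList ((L p.1.1).drop (p.1.2 + 1))) fun p => by
      simp only [s, Data.snd, Data.fst, hx p, ofList]
    have h4 := r.snd.fst.fst.congr (x := fun p => (L (φ p).1)[(φ p).2]) fun p => by
      simp only [s, Data.snd, Data.fst, hx p, ofList]; rfl
    have h5 := (r.fst.pair (h4.pair r.snd.snd)).trans (hf.comap φ)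
    exact r.fst.pair (h3.pair h5)

end PolyTime
end RegAut

/-! ### Polynomial-time operations on lists and families -/

namespace RegAut

open Data

theorem encRat_intCast (z : ℤ) : encRat z = .pair (num z) (num 1) := by
  simp [encRat]

theorem Data.size_flatten_drop (LL : List (List Data)) (j : ℕ) :
    (ofList (LL.drop j).flatten).size ≤ (ofList (LL.map ofList)).size := by
  induction LL generalizing j with
  | nil => simp [ofList]
  | cons L LL ih =>
    have h0 := ih 0
    cases j with
    | zero =>
      have := Data.size_ofList_append L LL.flatten
      simp only [List.drop_zero, List.flatten_cons, List.map_cons, ofList, size] at *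
      omega
    | succ j =>
      have := ih j
      simp only [List.drop_succ_cons, List.map_cons, ofList, size]
      omega

namespace PolyTime

variable {O : Data → Bool → Prop} {α : Type} {i o x y z : α → Data}

/-- The body of an iteration receives the outer input paired with a local datum; whatever can be
computed from the outer input alone is still available there. -/
theorem ext {β : α → Type} {y : (p : (a : α) × β a) → Data} (h : PolyTime O i o) :
    PolyTime O (fun p : (a : α) × β a => .pair (i p.1) (y p)) fun p => o p.1 :=
  (refl.of_fst).trans (h.comap Sigma.fst)

theorem cons {L : α → List Data} (hx : PolyTime O i x) (hL : PolyTime O i fun a => ofList (L a)) :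
    PolyTime O i fun a => ofList (x a :: L a) := hx.pair hL

theorem nil : PolyTime O i fun _ => ofList [] := const _

/-- A list that is read from the front and written at the front comes out reversed; `append` and
`map_getElem` compensate by a further reversal. -/
theorem reverse_append {L L' : α → List Data} (hL : PolyTime O i fun a => ofList (L a))
    (hL' : PolyTime O i fun a => ofList (L' a)) :
    PolyTime O i fun a => ofList ((L a).reverse ++ L' a) := by
  refine (hL.fold (acc := fun a j => ofList (((L a).take j).reverse ++ L' a))
    (b := fun a => (ofList (L a)).size + (ofList (L' a)).size) ?_ ?_ ?_ ?_).congr fun a => ?_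
  · exact hL'.congr fun a => by simp
  · exact hL.size_le.add hL'.size_le
  · intro a j hj
    have h1 := size_ofList_append ((L a).take j).reverse (L' a)
    have h2 : (ofList ((L a).take j).reverse).size ≤ (ofList (L a)).size := by
      have h3 := size_ofList_append ((L a).take j) ((L a).drop j)
      rw [List.take_append_drop] at h3
      have := (ofList ((L a).drop j)).size_pos
      have : (ofList ((L a).take j).reverse).size = (ofList ((L a).take j)).size := by
        simp [size_ofList, List.map_reverse, List.sum_reverse]
      omega
    omega
  · refine (refl.of_snd.of_fst.pair refl.of_snd.of_snd).congr fun p => ?_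
    obtain ⟨a, j, hj⟩ := p
    simp only [List.take_succ_eq_append_getElem hj, List.reverse_append]
    rfl
  · simp

theorem reverse {L : α → List Data} (hL : PolyTime O i fun a => ofList (L a)) :
    PolyTime O i fun a => ofList (L a).reverse :=
  (hL.reverse_append nil).congr fun a => by simp

theorem append {L L' : α → List Data} (hL : PolyTime O i fun a => ofList (L a))
    (hL' : PolyTime O i fun a => ofList (L' a)) :
    PolyTime O i fun a => ofList (L a ++ L' a) :=
  (hL.reverse.reverse_append hL').congr fun a => by simp

theorem map_getElem {L : α → List Data} {f : ∀ a, Fin (L a).length → Data}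
    (hL : PolyTime O i fun a => ofList (L a))
    (hf : PolyTime O (fun p : (a : α) × Fin (L a).length => .pair (i p.1) (L p.1)[p.2])
      fun p => f p.1 p.2) :
    PolyTime O i fun a => ofList (List.ofFn (f a)) := by
  obtain ⟨g, hg⟩ := hf.size_le
  suffices h : PolyTime O i fun a => ofList ((List.ofFn (f a)).take (L a).length).reverse by
    exact h.reverse.congr fun a => by rw [List.reverse_reverse, List.take_of_length_le (by simp)]
  refine hL.fold (acc := fun a j => ofList ((List.ofFn (f a)).take j).reverse)
    (b := fun a => 1 + (ofList (L a)).size *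
      (1 + g.eval (1 + (i a).size + (ofList (L a)).size))) ?_ ?_ ?_ ?_
  · exact nil.congr fun a => by simp
  · have h1 : PolyBdd i fun a => g.eval (1 + (i a).size + (ofList (L a)).size) := by
      obtain ⟨q, hq⟩ := ((PolyBdd.const i 1).add (.size i)).add hL.size_le
      exact ⟨g.comp q, fun a => by
        rw [Polynomial.eval_comp]; exact Polynomial.eval_nat_mono _ (hq a)⟩
    exact (PolyBdd.const _ 1).add (hL.size_le.mul ((PolyBdd.const _ 1).add h1))
  · intro a j hj
    refine (size_ofList_le (c := g.eval (1 + (i a).size + (ofList (L a)).size)) ?_).trans ?_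
    · intro d hd
      obtain ⟨n, rfl⟩ := (List.mem_ofFn' _ _).1 (List.mem_of_mem_take (List.mem_reverse.1 hd))
      refine (hg ⟨a, n⟩).trans (Polynomial.eval_nat_mono _ ?_)
      have := size_le_of_mem (List.getElem_mem n.2 (l := L a))
      simp only [size, Fin.getElem_fin]; omega
    · have := length_le_size_ofList (L a)
      gcongr
      simp; omega
  · have h1 := (refl (O := O) (i := fun p : (a : α) × Fin (L a).length => .pair (i p.1)
      (.pair (L p.1)[p.2] (ofList ((List.ofFn (f p.1)).take p.2).reverse))))
    refine (((h1.of_fst.pair h1.of_snd.of_fst).trans hf).pair h1.of_snd.of_snd).congr fun p => ?_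
    obtain ⟨a, j, hj⟩ := p
    simp [List.take_succ_eq_append_getElem (l := List.ofFn (f a)) (i := j) (by simpa using hj),
      ofList]

theorem map {β : α → Type} {L : ∀ a, List (β a)} {e f : ∀ a, β a → Data}
    (hL : PolyTime O i fun a => ofList ((L a).map (e a)))
    (hf : PolyTime O (fun p : (a : α) × β a => .pair (i p.1) (e p.1 p.2)) fun p => f p.1 p.2) :
    PolyTime O i fun a => ofList ((L a).map (f a)) := by
  let φ (p : (a : α) × Fin ((L a).map (e a)).length) : (a : α) × β a :=
    ⟨p.1, (L p.1)[p.2.1]'(by simpa using p.2.2)⟩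
  have h := hL.map_getElem (f := fun a j => f a ((L a)[j.1]'(by simpa using j.2))) <|
    (refl.congr fun p => by simp [φ]).trans (hf.comap φ)
  refine h.congr fun a => congrArg _ ?_
  apply List.ext_getElem <;> simp

/-- Reading the reversed list, the accumulator is always the concatenation of a suffix, which is
never larger than the whole input. -/
theorem flatten {LL : α → List (List Data)}
    (h : PolyTime O i fun a => ofList ((LL a).map ofList)) :
    PolyTime O i fun a => ofList (LL a).flatten := by
  have h' := h.reverse.fold (b := fun a => (ofList ((LL a).map ofList)).size)
    (acc := fun a j => ofList ((LL a).drop ((LL a).length - j)).flatten) ?_ h.size_le ?_ ?_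
  · exact h'.congr fun a => by simp
  · exact nil.congr fun a => by simp
  · exact fun a j _ => size_flatten_drop _ _
  · have hj (p : (a : α) × Fin ((LL a).map ofList).reverse.length) :
        p.2.1 < (LL p.1).length := by simpa using p.2.2
    have h1 := refl (O := O) (i := fun p : (a : α) × Fin ((LL a).map ofList).reverse.length =>
      .pair (i p.1) (.pair ((LL p.1).map ofList).reverse[p.2]
        (ofList ((LL p.1).drop ((LL p.1).length - p.2)).flatten)))
    have h2 := h1.of_snd.of_fst.congr
      (x := fun p : (a : α) × Fin ((LL a).map ofList).reverse.length =>
        ofList ((LL p.1)[(LL p.1).length - 1 - p.2]'(by have := hj p; omega)))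
      fun p => by simp
    refine (h2.append h1.of_snd.of_snd).congr fun p => ?_
    have := hj p
    rw [← List.flatten_cons]
    congr 2
    have e : (LL p.1).length - (p.2 + 1) = (LL p.1).length - 1 - p.2 := by omega
    have e' : (LL p.1).length - 1 - p.2 + 1 = (LL p.1).length - p.2 := by omega
    rw [e, List.drop_eq_getElem_cons (i := (LL p.1).length - 1 - p.2) (by omega), e']

theorem flatMap {β : α → Type} {L : ∀ a, List (β a)} {e : ∀ a, β a → Data}
    {f : ∀ a, β a → List Data} (hL : PolyTime O i fun a => ofList ((L a).map (e a)))
    (hf : PolyTime O (fun p : (a : α) × β a => .pair (i p.1) (e p.1 p.2))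
      fun p => ofList (f p.1 p.2)) :
    PolyTime O i fun a => ofList ((L a).flatMap (f a)) := by
  have h := hL.map (f := fun a b => ofList (f a b)) hf
  exact (flatten (LL := fun a => (L a).map (f a)) (h.congr fun a => by
    rw [List.map_map]; rfl)).congr fun a => by
    rw [List.flatMap_def]

/-- The result has `n` members, so `n` itself, and not only its bit size, must be polynomially
bounded. Counting down from `n` yields the members in increasing order. -/
theorem range {n : α → ℕ} (hn : PolyBdd i n) (h : PolyTime O i fun a => num (n a)) :
    PolyTime O i fun a => ofList ((List.range (n a)).map fun j => num (j : ℕ)) := by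
  let s (a : α) (j : ℕ) : Data :=
    .pair (i a) (.pair (num ((n a - j : ℕ) : ℤ))
      (ofList ((List.range' (n a - j) j).map fun j => num (j : ℕ))))
  have h0 : PolyTime O i fun a => s a 0 := refl.pair ((h.pair nil).congr fun a => by simp)
  have h0' : PolyBdd (fun a => s a 0) fun a => (i a).size :=
    PolyTime.size_le (O := O) refl.of_fst
  refine (h0.trans ((loop (s := s) (N := n)
    (b := fun a => 4 + (i a).size + n a + n a * (2 + n a)) (h0'.trans hn) ?_ ?_ ?_ ?_).of_snd.of_snd)).congr
    fun a => ?_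
  · intro a j hj
    have h1 (m : ℕ) (hm : m ≤ n a) : (num (m : ℤ)).size ≤ 1 + n a := by
      simp only [size, Int.natAbs_natCast]
      have : m.size ≤ m := Nat.size_le.2 Nat.lt_two_pow_self
      omega
    have h2 := h1 (n a - j) (by omega)
    have h3 := size_ofList_le (L := (List.range' (n a - j) j).map fun j => num (j : ℕ))
      (c := 1 + n a) (by
        intro d hd
        obtain ⟨m, hm, rfl⟩ := List.mem_map.1 hd
        rw [List.mem_range'_1] at hm
        exact h1 m (by omega))
    simp only [s, size, List.length_map, List.length_range'] at *
    have : j * (1 + (1 + n a)) ≤ n a * (2 + n a) := Nat.mul_le_mul hj (by omega)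
    omega
  · exact h0'.trans ((((PolyBdd.const _ 4).add (.size _)).add hn).add
      (hn.mul ((PolyBdd.const _ 2).add hn)))
  · refine ((const (num 1)).le refl.of_snd.of_fst).congr fun p => ?_
    congr 2
    have := p.2
    simp only [eq_iff_iff]
    omega
  · have r := refl (O := O) (i := fun p : {p : α × ℕ // p.2 < n p.1} => s p.1.1 p.1.2)
    have r1 := r.of_snd.of_fst.sub (v := fun _ => 1) (const _)
    refine (r.of_fst.pair (r1.pair (r1.pair r.of_snd.of_snd))).congr fun p => ?_
    obtain ⟨⟨a, j⟩, hj⟩ := p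
    simp only at hj
    have e : ((n a - j : ℕ) : ℤ) - 1 = ((n a - (j + 1) : ℕ) : ℤ) := by omega
    have e' : n a - (j + 1) + 1 = n a - j := by omega
    simp only [s, e, List.range'_succ, List.map_cons, ofList, e']
  · simp [List.range_eq_range']

theorem ofFn {n : α → ℕ} {f : ∀ a, Fin (n a) → Data} (hn : PolyBdd i n)
    (h : PolyTime O i fun a => num (n a))
    (hf : PolyTime O (fun p : (a : α) × Fin (n a) => .pair (i p.1) (encFin p.2))
      fun p => f p.1 p.2) :
    PolyTime O i fun a => ofList (List.ofFn (f a)) := by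
  have h1 := (range hn h).congr (x := fun a => ofList ((List.finRange (n a)).map encFin))
    fun a => by
      congr 1
      apply List.ext_getElem <;> simp [encFin]
  exact (h1.map (L := fun a => List.finRange (n a)) (f := f) hf).congr fun a => by
    rw [List.ofFn_eq_map]

/-- Dimensions are written in binary, but a family of that length is written out as well, so their
values are bounded by the input size. -/
theorem bdd_of_ofFn {n : α → ℕ} {f : ∀ a, Fin (n a) → Data}
    (h : PolyTime O i fun a => ofList (List.ofFn (f a))) : PolyBdd i n :=
  h.size_le.mono fun a => by simpa using length_le_size_ofList (List.ofFn (f a))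

/-- Removing the head as many times as the index says leaves the wanted member in front; the loop is
driven by a list whose length is the index. -/
theorem lookup {n : α → ℕ} {f : ∀ a, Fin (n a) → Data} {j : ∀ a, Fin (n a)}
    (h : PolyTime O i fun a => ofList (List.ofFn (f a)))
    (hj : PolyTime O i fun a => encFin (j a)) : PolyTime O i fun a => f a (j a) := by
  have h1 := range (n := fun a => j a) (h.bdd_of_ofFn.mono fun a => (j a).2.le) hj
  have h2 := h1.fold (acc := fun a m => ofList ((List.ofFn (f a)).drop m)) (h.congr fun a => rfl)
    h.size_le (fun a m _ => size_ofList_drop _ _) ?_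
  · refine h2.fst.congr fun a => ?_
    simp only [List.length_map, List.length_range]
    rw [List.drop_eq_getElem_cons (by simp)]
    simp [ofList, Data.fst]
  · refine refl.of_snd.of_snd.snd.congr fun p => ?_
    obtain ⟨a, m, hm⟩ := p
    have : m < (List.ofFn (f a)).length := by
      simp only [List.length_map, List.length_range] at hm
      simp only [List.length_ofFn]
      exact hm.trans (j a).2
    simp only
    rw [List.drop_eq_getElem_cons this]
    simp [ofList, Data.snd]

theorem encFun_append {β : α → Type} {n n' : α → ℕ} {e : ∀ a, β a → Data}
    {f : ∀ a, Fin (n a) → β a} {f' : ∀ a, Fin (n' a) → β a}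
    (h : PolyTime O i fun a => encFun (e a) (f a))
    (h' : PolyTime O i fun a => encFun (e a) (f' a)) :
    PolyTime O i fun a => encFun (e a) (Fin.append (f a) (f' a)) := by
  refine (append (L := fun a => List.ofFn fun j => e a (f a j))
    (L' := fun a => List.ofFn fun j => e a (f' a j)) h h').congr fun a => ?_
  rw [encFun, ← List.ofFn_fin_append]
  congr 2
  funext j
  refine Fin.addCases (fun j => ?_) (fun j => ?_) j <;> simp

/-- An addition creates at most one carry bit, which is paid for by the list cell of the summand.
Hence every partial sum is no longer than the list of the summands. -/
theorem sum_int {n : α → ℕ} {f : ∀ a, Fin (n a) → ℤ} (hn : PolyBdd i n)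
    (h : PolyTime O i fun a => num (n a))
    (hf : PolyTime O (fun p : (a : α) × Fin (n a) => .pair (i p.1) (encFin p.2))
      fun p => num (f p.1 p.2)) :
    PolyTime O i fun a => num (∑ j, f a j) := by
  have hl := ofFn (f := fun a j => num (f a j)) hn h hf
  have h1 (L : List ℤ) : L.sum.natAbs.size ≤ (ofList (L.map num)).size := by
    induction L with
    | nil => simp
    | cons x L ih =>
      have h1 := Nat.size_le_size (Int.natAbs_add_le x L.sum)
      have h2 := Nat.size_add_le x.natAbs L.sum.natAbs
      simp only [List.sum_cons, List.map_cons, ofList, size] at *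
      omega
  refine (hl.fold (acc := fun a j => num ((List.ofFn (f a)).take j).sum)
    (b := fun a => 1 + (ofList (List.ofFn fun j => num (f a j))).size) ?_ ?_ ?_ ?_).congr
      fun a => ?_
  · exact (const (num 0)).congr fun a => by simp
  · exact (PolyBdd.const _ 1).add hl.size_le
  · intro a j hj
    have h2 := h1 ((List.ofFn (f a)).take j)
    have h3 := size_ofList_append ((List.ofFn fun j => num (f a j)).take j)
      ((List.ofFn fun j => num (f a j)).drop j)
    rw [List.take_append_drop] at h3
    have := (ofList ((List.ofFn fun j => num (f a j)).drop j)).size_pos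
    have e : ((List.ofFn (f a)).take j).map num = (List.ofFn fun j => num (f a j)).take j := by
      rw [List.map_take, List.map_ofFn]; rfl
    rw [e] at h2
    simp only [size]
    omega
  · refine (refl.of_snd.of_snd.add
      (v := fun p : (a : α) × Fin (List.ofFn fun j => num (f a j)).length =>
        f p.1 ⟨p.2.1, by simpa using p.2.2⟩)
      (refl.of_snd.of_fst.congr fun p => by simp)).congr fun p => ?_
    obtain ⟨a, j, hj⟩ := p
    have hj' : j < (List.ofFn (f a)).length := by simpa using hj
    simp only
    rw [List.take_succ_eq_append_getElem hj', List.sum_append]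
    simp
  · rw [List.take_of_length_le (by simp), List.sum_ofFn]

/-- The bit sizes of factors add up, so partial products are bounded by the size of the list. -/
theorem prod_int {n : α → ℕ} {f : ∀ a, Fin (n a) → ℤ} (hn : PolyBdd i n)
    (h : PolyTime O i fun a => num (n a))
    (hf : PolyTime O (fun p : (a : α) × Fin (n a) => .pair (i p.1) (encFin p.2))
      fun p => num (f p.1 p.2)) :
    PolyTime O i fun a => num (∏ j, f a j) := by
  have hl := ofFn (f := fun a j => num (f a j)) hn h hf
  have h1 (L : List ℤ) : L.prod.natAbs.size ≤ (ofList (L.map num)).size := by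
    induction L with
    | nil => simp [ofList, size]
    | cons x L ih =>
      have h2 := Nat.size_mul_le x.natAbs L.prod.natAbs
      simp only [List.prod_cons, List.map_cons, ofList, size, Int.natAbs_mul] at *
      omega
  refine (hl.fold (acc := fun a j => num ((List.ofFn (f a)).take j).prod)
    (b := fun a => 1 + (ofList (List.ofFn fun j => num (f a j))).size) ?_ ?_ ?_ ?_).congr
      fun a => ?_
  · exact (const (num 1)).congr fun a => by simp
  · exact (PolyBdd.const _ 1).add hl.size_le
  · intro a j hj
    have h2 := h1 ((List.ofFn (f a)).take j)
    have h3 := size_ofList_append ((List.ofFn fun j => num (f a j)).take j)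
      ((List.ofFn fun j => num (f a j)).drop j)
    rw [List.take_append_drop] at h3
    have := (ofList ((List.ofFn fun j => num (f a j)).drop j)).size_pos
    have e : ((List.ofFn (f a)).take j).map num = (List.ofFn fun j => num (f a j)).take j := by
      rw [List.map_take, List.map_ofFn]; rfl
    rw [e] at h2
    simp only [size]
    omega
  · refine (refl.of_snd.of_snd.mul
      (v := fun p : (a : α) × Fin (List.ofFn fun j => num (f a j)).length =>
        f p.1 ⟨p.2.1, by simpa using p.2.2⟩)
      (refl.of_snd.of_fst.congr fun p => by simp)).congr fun p => ?_
    obtain ⟨a, j, hj⟩ := p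
    have hj' : j < (List.ofFn (f a)).length := by simpa using hj
    simp only
    rw [List.take_succ_eq_append_getElem hj', List.prod_append]
    simp
  · rw [List.take_of_length_le (by simp), List.prod_ofFn]

end PolyTime
end RegAut

namespace RegAut

open Data

/-! ## Cook reductions -/

/-- Replaces all queries of a program by calls of the program `q`. -/
def Prog.subst (p q : Prog) : Prog :=
  match p with
  | .op o => .op o
  | .query => q
  | .seq f g => .seq (f.subst q) (g.subst q)
  | .pair f g => .pair (f.subst q) (g.subst q)
  | .ite c f g => .ite (c.subst q) (f.subst q) (g.subst q)
  | .while c f => .while (c.subst q) (f.subst q)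

/-- A run of time at most `T` can only ask questions of size at most `T`, so each query is replaced
by a computation of at most `g.eval T` steps. The bound `T` for the whole run is kept fixed in the
induction, which makes this factor uniform over all subruns. -/
theorem Runs.subst {O O' : Data → Bool → Prop} {q : Prog} {g : Polynomial ℕ}
    (hq : ∀ d b, O d b → ∃ t, Runs O' q d (.ofBool b) t ∧ t ≤ g.eval d.size)
    {p : Prog} {d r : Data} {t : ℕ} (h : Runs O p d r t) :
    ∀ T, t ≤ T → ∃ t', Runs O' (p.subst q) d r t' ∧ t' ≤ t * (1 + g.eval T) := by
  induction h with
  | op o d =>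
    intro T hT
    exact ⟨_, .op o d, Nat.le_mul_of_pos_right _ (by omega)⟩
  | @query d b h =>
    intro T hT
    obtain ⟨t, ht, hle⟩ := hq d b h
    refine ⟨t, ht, hle.trans ?_⟩
    have := Polynomial.eval_nat_mono g (show d.size ≤ T by omega)
    nlinarith [Nat.zero_le (g.eval T)]
  | seq _ _ ihf ihg =>
    intro T hT
    obtain ⟨s, hs, hs'⟩ := ihf T (by omega)
    obtain ⟨t, ht, ht'⟩ := ihg T (by omega)
    exact ⟨_, .seq hs ht, by nlinarith [Nat.zero_le (g.eval T)]⟩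
  | @pair f g' d x y _ _ _ _ ihf ihg =>
    intro T hT
    obtain ⟨s, hs, hs'⟩ := ihf T (by omega)
    obtain ⟨t, ht, ht'⟩ := ihg T (by omega)
    exact ⟨_, .pair hs ht, by nlinarith [Nat.zero_le (g.eval T * (1 + d.size + (x.pair y).size))]⟩
  | @ite_true c f g' d b x _ _ _ hb _ ihf ihg =>
    intro T hT
    obtain ⟨s, hs, hs'⟩ := ihf T (by omega)
    obtain ⟨t, ht, ht'⟩ := ihg T (by omega)
    exact ⟨_, .ite_true hs hb ht, by nlinarith [Nat.zero_le (g.eval T * (1 + d.size))]⟩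
  | @ite_false c f g' d x _ _ _ _ ihf ihg =>
    intro T hT
    obtain ⟨s, hs, hs'⟩ := ihf T (by omega)
    obtain ⟨t, ht, ht'⟩ := ihg T (by omega)
    exact ⟨_, .ite_false hs ht, by nlinarith [Nat.zero_le (g.eval T * (1 + d.size))]⟩
  | @while_step c f d b x y _ _ _ _ hb _ _ ihc ihf ihw =>
    intro T hT
    obtain ⟨s, hs, hs'⟩ := ihc T (by omega)
    obtain ⟨t, ht, ht'⟩ := ihf T (by omega)
    obtain ⟨r, hr, hr'⟩ := ihw T (by omega)
    exact ⟨_, .while_step hs hb ht hr, by nlinarith [Nat.zero_le (g.eval T * (1 + d.size))]⟩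
  | _ =>
    rename_i d _ _ ih
    intro T hT
    obtain ⟨s, hs, hs'⟩ := ih T (by omega)
    exact ⟨_, .while_zero hs, by nlinarith [Nat.zero_le (g.eval T * (1 + d.size))]⟩

theorem CookReducible.trans {P Q R : Problem} (h : CookReducible P Q) (h' : CookReducible Q R) :
    CookReducible P R := by
  obtain ⟨p, f, hp⟩ := h
  obtain ⟨q, g, hq⟩ := h'
  refine ⟨p.subst q, f * (1 + g.comp f), fun a => ?_⟩
  obtain ⟨b, t, ht, hb, hle⟩ := hp a
  have hq' : ∀ d b, Q.oracle d b → ∃ t, Runs R.oracle q d (.ofBool b) t ∧ t ≤ g.eval d.size := by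
    rintro _ b ⟨c, rfl, hb⟩
    obtain ⟨b', t, ht, hb', hle⟩ := hq c
    have : b = b' := by rw [Bool.eq_iff_iff, hb, hb']
    exact ⟨t, this ▸ ht, hle⟩
  obtain ⟨t', ht', hle'⟩ := ht.subst hq' _ hle
  refine ⟨b, t', ht', hb, hle'.trans ?_⟩
  simp only [Polynomial.eval_mul, Polynomial.eval_add, Polynomial.eval_one, Polynomial.eval_comp]
  gcongr

open Classical in
theorem PolyTime.cookReducible {P Q : Problem}
    (h : PolyTime Q.oracle P.encode fun a => .ofBool (decide (P.Holds a))) :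
    CookReducible P Q := by
  obtain ⟨p, g, h⟩ := h
  refine ⟨p, g, fun a => ?_⟩
  obtain ⟨t, ht, hle⟩ := h a
  exact ⟨_, t, ht, by simp, hle⟩

open Classical in
theorem PolyTime.query (Q : Problem) :
    PolyTime Q.oracle Q.encode fun a => .ofBool (decide (Q.Holds a)) :=
  of_runs .query (f := fun a => 1 + (Q.encode a).size + 2)
    (fun a => ⟨_, .query ⟨a, rfl, by simp⟩, Nat.add_le_add_left (size_ofBool _) _⟩)
    (((PolyBdd.const _ 1).add (.size _)).add (.const _ 2))

theorem CookReducible.refl (P : Problem) : CookReducible P P := (PolyTime.query P).cookReducible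

open Classical in
/-- The disjunction of polynomially many oracle queries. -/
theorem PolyTime.any_query {α : Type} {i : α → Data} {Q : Problem} {L : α → List Q.Instance}
    (h : PolyTime Q.oracle i fun a => ofList ((L a).map Q.encode)) :
    PolyTime Q.oracle i fun a => .ofBool (decide (∃ b ∈ L a, Q.Holds b)) := by
  have h1 := h.map (L := L) (e := fun _ => Q.encode)
    (f := fun _ b => .ofBool (decide (Q.Holds b)))
    ((refl (i := fun p : (_ : α) × Q.Instance => .pair (i p.1) (Q.encode p.2))).of_snd.trans
      ((query Q).comap fun p : (_ : α) × Q.Instance => p.2))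
  have h2 := h1.fold (acc := fun a j => .ofBool (decide (∃ b ∈ (L a).take j, Q.Holds b)))
    (b := fun _ => 2) ?_ (.const _ 2) (fun _ _ _ => size_ofBool _) ?_
  · exact h2.congr fun a => by simp
  · exact (const (.ofBool false)).congr fun a => by simp
  · let ι := (a : α) × Fin ((L a).map fun b => Data.ofBool (decide (Q.Holds b))).length
    have hj (p : ι) : p.2.1 < (L p.1).length := by simpa using p.2.2
    have r := refl (O := Q.oracle) (i := fun p : ι => .pair (i p.1)
      (.pair ((L p.1).map fun b => Data.ofBool (decide (Q.Holds b)))[p.2]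
        (.ofBool (decide (∃ b ∈ (L p.1).take p.2, Q.Holds b)))))
    have r1 := r.of_snd.of_fst.congr
      (x := fun p => .ofBool (decide (Q.Holds ((L p.1)[p.2.1]'(hj p))))) fun p => by simp
    refine (r1.ite (const (.ofBool true)) r.of_snd.of_snd).congr fun p => ?_
    rw [List.take_succ_eq_append_getElem (hj p)]
    split_ifs with hh
    · simp only [List.mem_append, List.mem_singleton, or_and_right, exists_or, exists_eq_left, hh,
        or_true, decide_true]
    · simp only [List.mem_append, List.mem_singleton, or_and_right, exists_or, exists_eq_left, hh,
        or_false]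

theorem cookReducible_of_iff_exists {P Q : Problem} (L : P.Instance → List Q.Instance)
    (h : PolyTime Q.oracle P.encode fun a => ofList ((L a).map Q.encode))
    (hL : ∀ a, P.Holds a ↔ ∃ b ∈ L a, Q.Holds b) : CookReducible P Q := by
  classical
  exact (h.any_query.congr fun a => by simp only [hL]).cookReducible

theorem cookReducible_of_iff_not_exists {P Q : Problem} (L : P.Instance → List Q.Instance)
    (h : PolyTime Q.oracle P.encode fun a => ofList ((L a).map Q.encode))
    (hL : ∀ a, P.Holds a ↔ ¬ ∃ b ∈ L a, Q.Holds b) : CookReducible P Q := by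
  classical
  exact (h.any_query.not.congr fun a => by simp only [hL]).cookReducible

/-! ## Renaming of the variables of a guard -/

/-- Renames the control variables of a guard. -/
def Guard.rename {k k' : ℕ} (σ : Fin k → Fin k') : Guard k → Guard k'
  | .le z z' => .le (z.map σ) (z'.map σ)
  | .neg φ => .neg (φ.rename σ)
  | .conj φ ψ => .conj (φ.rename σ) (ψ.rename σ)
  | .disj φ ψ => .disj (φ.rename σ) (ψ.rename σ)

theorem Guard.sat_rename {k k' : ℕ} (σ : Fin k → Fin k') (s : Option (Fin k') → ℚ) (φ : Guard k) :
    (φ.rename σ).Sat s ↔ φ.Sat fun z => s (z.map σ) := by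
  induction φ with
  | le z z' => rfl
  | neg φ ih => simp only [rename, Sat, ih]
  | conj φ ψ ih ih' => simp only [rename, Sat, ih, ih']
  | disj φ ψ ih ih' => simp only [rename, Sat, ih, ih']

/-- Embedding into a larger set of variables with the same indices does not change the encoding.
Only the shift of the second component's variables needs computation. -/
theorem encGuard_rename_of_val_eq {k k' : ℕ} (σ : Fin k → Fin k') (hσ : ∀ i, (σ i : ℕ) = i)
    (φ : Guard k) : encGuard (φ.rename σ) = encGuard φ := by
  have h (z : Option (Fin k)) : encOption encFin (z.map σ) = encOption encFin z := by
    cases z <;> simp [encOption, encFin, hσ]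
  induction φ with
  | le z z' => simp only [Guard.rename, encGuard, h]
  | neg φ ih => simp only [Guard.rename, encGuard, ih]
  | conj φ ψ ih ih' => simp only [Guard.rename, encGuard, ih, ih']
  | disj φ ψ ih ih' => simp only [Guard.rename, encGuard, ih, ih']

/-! ### A stack machine for shifting the variables of a guard -/

namespace Shift

/-- Adds `m` to the index of an encoded variable. -/
def var (m : ℤ) (x : Data) : Data :=
  if x.isPair = true then .pair (num 1) (num (x.snd.toInt + m)) else num 0

/-- One step of a stack machine that adds `m` to the indices of all the variables of a guard. Its
states consist of a stack of tasks and a stack of results. -/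
def step (m : ℤ) (s : Data) : Data :=
  if s.fst.fst.fst.toInt = 0 then
    if s.fst.fst.snd.fst.toInt = 0 then
      .pair s.fst.snd (.pair (.pair (num 0)
        (.pair (var m s.fst.fst.snd.snd.fst) (var m s.fst.fst.snd.snd.snd))) s.snd)
    else if s.fst.fst.snd.fst.toInt = 1 then
      .pair (.pair (.pair (num 0) s.fst.fst.snd.snd) (.pair (.pair (num 1) (num 0)) s.fst.snd)) s.snd
    else
      .pair (.pair (.pair (num 0) s.fst.fst.snd.snd.fst) (.pair (.pair (num 0) s.fst.fst.snd.snd.snd)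
        (.pair (.pair (num s.fst.fst.snd.fst.toInt) (num 0)) s.fst.snd))) s.snd
  else if s.fst.fst.fst.toInt = 1 then
    .pair s.fst.snd (.pair (.pair (num 1) s.snd.fst) s.snd.snd)
  else
    .pair s.fst.snd (.pair (.pair (num s.fst.fst.fst.toInt) (.pair s.snd.snd.fst s.snd.fst))
      s.snd.snd.snd)

/-- `n` steps lead from `s` to `s'`, and the stack of tasks is not empty before any of them. -/
def Reach (m : ℤ) (n : ℕ) (s s' : Data) : Prop :=
  (step m)^[n] s = s' ∧ ∀ j < n, ((step m)^[j] s).fst.isPair = true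

theorem Reach.trans {m : ℤ} {n n' : ℕ} {s s' s'' : Data} (h : Reach m n s s')
    (h' : Reach m n' s' s'') : Reach m (n + n') s s'' := by
  refine ⟨by rw [add_comm, Function.iterate_add_apply, h.1, h'.1], fun j hj => ?_⟩
  by_cases hjn : j < n
  · exact h.2 j hjn
  · obtain ⟨r, rfl⟩ := Nat.exists_eq_add_of_le (not_lt.1 hjn)
    rw [add_comm, Function.iterate_add_apply, h.1]
    exact h'.2 r (by omega)

theorem Reach.single {m : ℤ} {s s' : Data} (h : step m s = s') (hs : s.fst.isPair = true) :
    Reach m 1 s s' :=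
  ⟨h, fun j hj => by obtain rfl : j = 0 := by omega
                     exact hs⟩

theorem var_encOption {k : ℕ} (m : ℕ) (z : Option (Fin k)) :
    var m (encOption encFin z) = encOption encFin (z.map (Fin.natAdd m)) := by
  cases z <;> simp [var, encOption, encFin, Data.isPair, Data.snd, toInt, add_comm]

/-- Programs have no recursion, so the syntax tree is traversed with an explicit stack. Tag 0 asks
to process a guard; tag 1 negates the top result; tags 2 and 3 join the two top results, of which
the upper one is the right operand. Each inner node takes two steps and each atom one, whence the
bound by the size. The stacks below are arbitrary, as the induction requires. -/
theorem reach_guard {k : ℕ} (m : ℕ) (φ : Guard k) : ∃ n ≤ (encGuard φ).size, ∀ todo res,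
    Reach m n (.pair (.pair (.pair (num 0) (encGuard φ)) todo) res)
      (.pair todo (.pair (encGuard (φ.rename (Fin.natAdd m))) res)) := by
  induction φ with
  | le z z' =>
    refine ⟨1, Data.size_pos _, fun todo res => .single ?_ rfl⟩
    simp [step, encGuard, Data.fst, Data.snd, toInt, var_encOption, Guard.rename]
  | neg φ ih =>
    obtain ⟨n, hn, h⟩ := ih
    refine ⟨1 + n + 1, by simp [encGuard, size]; omega, fun todo res =>
      ((Reach.single ?_ rfl).trans
      (h (.pair (.pair (num 1) (num 0)) todo) res)).trans (Reach.single ?_ rfl)⟩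
    · simp [step, encGuard, Data.fst, Data.snd, toInt]
    · simp [step, encGuard, Data.fst, Data.snd, toInt, Guard.rename]
  | conj φ ψ ih ih' =>
    obtain ⟨n, hn, h⟩ := ih
    obtain ⟨n', hn', h'⟩ := ih'
    refine ⟨1 + n + n' + 1, by simp [encGuard, size]; omega, fun todo res =>
      (((Reach.single ?_ rfl).trans (h (.pair (.pair (num 0) (encGuard ψ))
        (.pair (.pair (num 2) (num 0)) todo)) res)).trans (h' _ _)).trans (Reach.single ?_ rfl)⟩
    · simp [step, encGuard, Data.fst, Data.snd, toInt]
    · simp [step, encGuard, Data.fst, Data.snd, toInt, Guard.rename]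
  | disj φ ψ ih ih' =>
    obtain ⟨n, hn, h⟩ := ih
    obtain ⟨n', hn', h'⟩ := ih'
    refine ⟨1 + n + n' + 1, by simp [encGuard, size]; omega, fun todo res =>
      (((Reach.single ?_ rfl).trans (h (.pair (.pair (num 0) (encGuard ψ))
        (.pair (.pair (num 3) (num 0)) todo)) res)).trans (h' _ _)).trans (Reach.single ?_ rfl)⟩
    · simp [step, encGuard, Data.fst, Data.snd, toInt]
    · simp [step, encGuard, Data.fst, Data.snd, toInt, Guard.rename]

theorem size_fst_add_snd (d : Data) : d.fst.size + d.snd.size ≤ d.size + 1 := by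
  cases d with
  | num z => simp only [Data.size, Data.fst, Data.snd, Int.natAbs_zero, Nat.size_zero]; omega
  | pair x y => simp only [Data.size, Data.fst, Data.snd]; omega

theorem size_var (m : ℤ) (x : Data) : (var m x).size ≤ x.size + (num m).size + 5 := by
  unfold var
  split_ifs
  · have h1 := Nat.size_le_size (Int.natAbs_add_le x.snd.toInt m)
    have h2 := Nat.size_add_le x.snd.toInt.natAbs m.natAbs
    have h3 := size_toInt x.snd
    have h4 := size_snd x
    simp only [size, Int.natAbs_one, Nat.size_one]
    omega
  · simp only [size, Int.natAbs_zero, Nat.size_zero]; omega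

/-- A step rearranges parts of the state without duplicating large ones, so the growth is by an
additive constant and a linear number of steps keeps the size polynomial. -/
theorem size_step (m : ℤ) (s : Data) : (step m s).size ≤ s.size + (40 + 2 * (num m).size) := by
  have h1 := size_fst_add_snd s
  have h2 := size_fst_add_snd s.fst
  have h3 := size_fst_add_snd s.fst.fst
  have h4 := size_fst_add_snd s.fst.fst.snd
  have h5 := size_fst_add_snd s.fst.fst.snd.snd
  have h6 := size_fst_add_snd s.snd
  have h7 := size_fst_add_snd s.snd.snd
  have h8 := size_toInt s.fst.fst.fst
  have h9 := size_toInt s.fst.fst.snd.fst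
  have h10 := size_var m s.fst.fst.snd.snd.fst
  have h11 := size_var m s.fst.fst.snd.snd.snd
  have h12 := s.fst.fst.snd.fst.size_pos
  have h13 := s.fst.fst.fst.size_pos
  unfold step
  split_ifs <;> simp only [size, Int.natAbs_zero, Int.natAbs_one, Nat.size_one, Nat.size_zero] at * <;>
    omega

end Shift

/-! ### Renaming of guards in polynomial time -/

namespace PolyTime

variable {O : Data → Bool → Prop} {α : Type} {i o x y z : α → Data}

theorem toInt (h : PolyTime O i x) : PolyTime O i fun a => num (x a).toInt :=
  ((h.pair (const (num 0))).trans (op .add)).congr fun a => by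
    simp [Op.eval, Data.fst, Data.snd, Data.toInt]

theorem shift_var {m : α → ℤ} (hm : PolyTime O i fun a => num (m a)) (h : PolyTime O i x) :
    PolyTime O i fun a => Shift.var (m a) (x a) :=
  (h.isPair.congr fun a => by simp).ite (p := fun a => (x a).isPair = true)
    ((const (num 1)).pair (h.snd.toInt.add hm)) (const (num 0))

theorem shift_step {m : α → ℤ} (hm : PolyTime O i fun a => num (m a)) (h : PolyTime O i x) :
    PolyTime O i fun a => Shift.step (m a) (x a) := by
  have h1 := h.fst.fst
  have h2 := h1.snd
  refine (h1.fst.toInt.eq (const (num 0))).ite ((h2.fst.toInt.eq (const (num 0))).ite ?_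
    ((h2.fst.toInt.eq (const (num 1))).ite ?_ ?_)) ((h1.fst.toInt.eq (const (num 1))).ite ?_ ?_)
  · exact h.fst.snd.pair (((const (num 0)).pair ((shift_var hm h2.snd.fst).pair
      (shift_var hm h2.snd.snd))).pair h.snd)
  · exact (((const (num 0)).pair h2.snd).pair ((const _).pair h.fst.snd)).pair h.snd
  · exact (((const (num 0)).pair h2.snd.fst).pair (((const (num 0)).pair h2.snd.snd).pair
      ((h2.fst.toInt.pair (const (num 0))).pair h.fst.snd))).pair h.snd
  · exact h.fst.snd.pair (((const (num 1)).pair h.snd.fst).pair h.snd.snd)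
  · exact h.fst.snd.pair ((h1.fst.toInt.pair (h.snd.snd.fst.pair h.snd.fst)).pair h.snd.snd.snd)

theorem guard_natAdd {k m : α → ℕ} {φ : ∀ a, Guard (k a)} (hm : PolyTime O i fun a => num (m a))
    (h : PolyTime O i fun a => encGuard (φ a)) :
    PolyTime O i fun a => encGuard ((φ a).rename (Fin.natAdd (m a))) := by
  -- The number of steps is never computed: it only bounds the loop, which stops when the stack of
  -- tasks is empty.
  choose N hN hr using fun a => Shift.reach_guard (m a) (φ a)
  let s (a : α) (j : ℕ) : Data := .pair (num (m a)) ((Shift.step (m a))^[j]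
    (.pair (.pair (.pair (num 0) (encGuard (φ a))) (num 0)) (num 0)))
  have h0 : PolyTime O i fun a => s a 0 :=
    hm.pair ((((const (num 0)).pair h).pair (const _)).pair (const _))
  have hN' : PolyBdd (fun a => s a 0) N :=
    ((PolyTime.size_le (O := O) refl.of_snd.of_fst.of_fst.of_snd).mono hN)
  have hm' : PolyBdd (fun a => s a 0) fun a => (num (m a)).size :=
    PolyTime.size_le (O := O) refl.of_fst
  refine (h0.trans (loop (s := s) (N := N) hN'
    (b := fun a => (s a 0).size + N a * (40 + 2 * (num (m a)).size)) ?_ ?_ ?_ ?_)).congr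
      (x := fun a => .pair (num (m a)) (.pair (num 0)
        (.pair (encGuard ((φ a).rename (Fin.natAdd (m a)))) (num 0)))) (fun a => ?_)
        |>.of_snd.of_snd.of_fst
  · intro a j hj
    suffices h : (s a j).size ≤ (s a 0).size + j * (40 + 2 * (num (m a)).size) from
      h.trans (by gcongr)
    induction j with
    | zero => simp
    | succ j ih =>
      have h1 := ih (by omega)
      simp only [s, Function.iterate_succ_apply', size] at h1 ⊢
      have h2 := Shift.size_step (m a) ((Shift.step (m a))^[j]
        (.pair (.pair (.pair (num 0) (encGuard (φ a))) (num 0)) (num 0)))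
      simp only [size] at h2
      rw [add_mul]
      omega
  · exact (PolyBdd.size _).add (hN'.mul ((PolyBdd.const _ 40).add ((PolyBdd.const _ 2).mul hm')))
  · refine refl.of_snd.fst.isPair.congr ?_
    rintro ⟨⟨a, j⟩, hj⟩
    simp only at hj ⊢
    rcases hj.lt_or_eq with hj | rfl
    · rw [(hr a _ _).2 j hj]; simp [hj]
    · rw [(hr a _ _).1]; simp [Data.fst, Data.isPair]
  · refine (refl.of_fst.pair (shift_step refl.of_fst refl.of_snd)).congr ?_
    rintro ⟨⟨a, j⟩, hj⟩
    simp only [s, Function.iterate_succ_apply']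
  · simp only [s, (hr a _ _).1]

end PolyTime
end RegAut

namespace RegAut

/-! ## Orthogonal projections by fraction-free elimination -/

section Elimination

open Matrix

variable {ι κ : Type} [Fintype ι]

/-- Given the common denominator and the numerators of the orthogonal projection with kernel `U`,
computes those of the orthogonal projection whose kernel is generated by `U` and `v`. -/
def elimStep (s : ℤ × Matrix ι ι ℤ) (v : ι → ℤ) : ℤ × Matrix ι ι ℤ :=
  if v ⬝ᵥ s.2 *ᵥ v = 0 then s
  else (v ⬝ᵥ s.2 *ᵥ v, .of fun a b =>
    ((v ⬝ᵥ s.2 *ᵥ v) * s.2 a b - (s.2 *ᵥ v) a * (s.2 *ᵥ v) b) / s.1)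

/-- `R` is a symmetric idempotent matrix. -/
structure IsProjection (R : Matrix ι ι ℚ) : Prop where
  symm : Rᵀ = R
  idem : R * R = R

namespace IsProjection

variable {R : Matrix ι ι ℚ}

theorem dotProduct_mulVec (h : IsProjection R) (x y : ι → ℚ) : x ⬝ᵥ R *ᵥ y = (R *ᵥ x) ⬝ᵥ (R *ᵥ y) := by
  conv_lhs => rw [← h.idem, ← mulVec_mulVec]
  rw [Matrix.dotProduct_mulVec, ← mulVec_transpose, h.symm]

theorem dotProduct_comm (h : IsProjection R) (x y : ι → ℚ) : x ⬝ᵥ R *ᵥ y = (R *ᵥ x) ⬝ᵥ y := by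
  rw [Matrix.dotProduct_mulVec, ← mulVec_transpose, h.symm]

theorem apply_eq_sum (h : IsProjection R) (a b : ι) : R a b = ∑ c, R a c * R b c := by
  conv_lhs => rw [← h.idem, mul_apply]
  refine Finset.sum_congr rfl fun c _ => ?_
  rw [← congrFun (congrFun h.symm b) c, transpose_apply]

/-- The diagonal entry `R a a` is the sum of the squares of row `a`. So it dominates its own square,
hence is at most 1, and it dominates the square of every entry of that row. -/
theorem abs_apply_le (h : IsProjection R) (a b : ι) : |R a b| ≤ 1 := by
  have h1 : ∀ c, R a c ^ 2 ≤ R a a := fun c => by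
    rw [h.apply_eq_sum a a]
    simp only [← sq]
    exact Finset.single_le_sum (f := fun c => R a c ^ 2) (fun c _ => sq_nonneg _)
      (Finset.mem_univ c)
  have h2 : R a a ≤ 1 := by nlinarith [h1 a]
  rw [← sq_le_one_iff_abs_le_one]
  exact (h1 b).trans h2

theorem dotProduct_mulVec_le (h : IsProjection R) (x : ι → ℚ) : x ⬝ᵥ R *ᵥ x ≤ x ⬝ᵥ x := by
  have h1 : 0 ≤ (x - R *ᵥ x) ⬝ᵥ (x - R *ᵥ x) :=
    Finset.sum_nonneg fun i _ => mul_self_nonneg _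
  rw [sub_dotProduct, dotProduct_sub, dotProduct_sub, ← h.dotProduct_mulVec,
    ← h.dotProduct_comm] at h1
  linarith

theorem dotProduct_mulVec_nonneg (h : IsProjection R) (x : ι → ℚ) : 0 ≤ x ⬝ᵥ R *ᵥ x := by
  rw [h.dotProduct_mulVec]
  exact Finset.sum_nonneg fun i _ => mul_self_nonneg _

theorem mulVec_eq_zero_iff (h : IsProjection R) (x : ι → ℚ) : x ⬝ᵥ R *ᵥ x = 0 ↔ R *ᵥ x = 0 := by
  rw [h.dotProduct_mulVec, dotProduct_self_eq_zero]

/-- Adding a vector to the kernel. -/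
theorem sub_vecMulVec (h : IsProjection R) {v : ι → ℚ} (hv : v ⬝ᵥ R *ᵥ v ≠ 0) :
    IsProjection (R - (v ⬝ᵥ R *ᵥ v)⁻¹ • vecMulVec (R *ᵥ v) (R *ᵥ v)) := by
  have hr : R *ᵥ (R *ᵥ v) = R *ᵥ v := by rw [mulVec_mulVec, h.idem]
  have hr' : (R *ᵥ v) ᵥ* R = R *ᵥ v := by
    rw [← mulVec_transpose, h.symm, hr]
  constructor
  · rw [transpose_sub, transpose_smul, h.symm, transpose_vecMulVec]
  · rw [sub_mul, mul_sub, mul_sub, h.idem, Matrix.mul_smul, Matrix.smul_mul, Matrix.smul_mul,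
      Matrix.mul_smul, mul_vecMulVec, hr, vecMulVec_mul, hr', vecMulVec_mul_vecMulVec,
      ← h.dotProduct_mulVec, vecMulVec_smul, smul_smul, smul_smul]
    rw [mul_assoc, inv_mul_cancel₀ hv]
    simp

/-- The new matrix sends `x` to `R *ᵥ (x - c • v)`, where `c` is the quotient of `v ⬝ᵥ R *ᵥ x` by `v
⬝ᵥ R *ᵥ v`. So `x` is in the kernel iff subtracting this multiple of `v` leads into `U`. -/
theorem sub_vecMulVec_mulVec_eq_zero_iff (h : IsProjection R) {v : ι → ℚ} (hv : v ⬝ᵥ R *ᵥ v ≠ 0)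
    {U : Submodule ℚ (ι → ℚ)} (hU : ∀ x, R *ᵥ x = 0 ↔ x ∈ U) (x : ι → ℚ) :
    (R - (v ⬝ᵥ R *ᵥ v)⁻¹ • vecMulVec (R *ᵥ v) (R *ᵥ v)) *ᵥ x = 0 ↔
      x ∈ U ⊔ Submodule.span ℚ {v} := by
  have e : (R - (v ⬝ᵥ R *ᵥ v)⁻¹ • vecMulVec (R *ᵥ v) (R *ᵥ v)) *ᵥ x =
      R *ᵥ (x - ((v ⬝ᵥ R *ᵥ v)⁻¹ * (v ⬝ᵥ R *ᵥ x)) • v) := by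
    rw [sub_mulVec, smul_mulVec, vecMulVec_mulVec, mulVec_sub, mulVec_smul, h.dotProduct_comm v x]
    simp [smul_smul]
  rw [e, hU, Submodule.mem_sup]
  constructor
  · intro hx
    exact ⟨_, hx, _, Submodule.smul_mem _ _ (Submodule.mem_span_singleton_self v),
      sub_add_cancel _ _⟩
  · rintro ⟨y, hy, z, hz, rfl⟩
    obtain ⟨c, rfl⟩ := Submodule.mem_span_singleton.1 hz
    rw [← hU] at hy
    rw [mulVec_add, mulVec_smul, hy, zero_add, dotProduct_smul, smul_eq_mul, mul_left_comm,
      inv_mul_cancel₀ hv, mul_one, add_sub_cancel_right, ← hU, hy]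

/-- Let `P` be the right-hand side. Since `P * W = 0` and `R` differs from 1 by a multiple of `W`,
`P * R = P`; since `Wᵀ * R = 0` by symmetry, `P * R = R`. -/
theorem eq_of_gram [DecidableEq ι] [Fintype κ] [DecidableEq κ] (h : IsProjection R)
    {W : Matrix ι κ ℚ} (hW : R * W = 0) {K : Matrix κ ι ℚ} (hK : R = 1 - W * K)
    (hG : IsUnit (Wᵀ * W).det) : R = 1 - W * (Wᵀ * W)⁻¹ * Wᵀ := by
  have h1 : (1 - W * (Wᵀ * W)⁻¹ * Wᵀ) * W = 0 := by
    rw [Matrix.sub_mul, Matrix.one_mul, Matrix.mul_assoc, Matrix.mul_assoc,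
      nonsing_inv_mul _ hG, Matrix.mul_one,
      sub_self]
  have h2 : (1 - W * (Wᵀ * W)⁻¹ * Wᵀ) * R = 1 - W * (Wᵀ * W)⁻¹ * Wᵀ := by
    rw [hK, Matrix.mul_sub, Matrix.mul_one, ← Matrix.mul_assoc, h1, Matrix.zero_mul, sub_zero]
  have h3 : Wᵀ * R = 0 := by
    rw [← h.symm, ← transpose_mul, hW, transpose_zero]
  rw [← h2, Matrix.sub_mul, Matrix.one_mul, Matrix.mul_assoc _ Wᵀ, h3, Matrix.mul_zero, sub_zero]

end IsProjection

theorem map_intCast_mulVec [Fintype κ] {ι : Type} (M : Matrix ι κ ℤ) (v : κ → ℤ) (a : ι) :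
    ((M *ᵥ v) a : ℚ) = (M.map (Int.cast : ℤ → ℚ) *ᵥ fun b => (v b : ℚ)) a := by
  simp [mulVec, dotProduct]

/-- The invariant of the elimination: `s` represents the projection with kernel `U`, and its
denominator is a Gram determinant. -/
def ElimInv [DecidableEq ι] (s : ℤ × Matrix ι ι ℤ) (U : Submodule ℚ (ι → ℚ)) : Prop :=
  0 < s.1 ∧ ∃ R : Matrix ι ι ℚ, s.2.map (Int.cast : ℤ → ℚ) = (s.1 : ℚ) • R ∧ IsProjection R ∧
    (∀ x, R *ᵥ x = 0 ↔ x ∈ U) ∧ ∃ (κ : Type) (_ : Fintype κ) (_ : DecidableEq κ)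
      (V : Matrix ι κ ℤ), (Vᵀ * V).det = s.1 ∧ R * V.map (Int.cast : ℤ → ℚ) = 0 ∧
        ∃ K : Matrix κ ι ℚ, R = 1 - V.map (Int.cast : ℤ → ℚ) * K

theorem elimInv_one [DecidableEq ι] : ElimInv ((1, 1) : ℤ × Matrix ι ι ℤ) ⊥ := by
  -- Before any elimination the Gram matrix is empty, with determinant 1.
  refine ⟨one_pos, 1, by simp, ⟨by simp, by simp⟩, by simp, Empty, inferInstance,
    inferInstance, .of fun _ e => e.elim, by simp, ?_, .of fun e _ => e.elim, ?_⟩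
  · ext _ e; exact e.elim
  · ext a b; simp [mul_apply]

/-- By the Gram formula, the only denominators of the projection come from the inverse of the Gram
matrix, and the adjugate shows that the determinant clears them. This integrality is what makes the
division in `elimStep` exact. -/
theorem ElimInv.exists_det_smul [DecidableEq ι] [Fintype κ] [DecidableEq κ] {V : Matrix ι κ ℤ}
    {R : Matrix ι ι ℚ} (h : IsProjection R)
    (hV : R * V.map (Int.cast : ℤ → ℚ) = 0) {K : Matrix κ ι ℚ}
    (hK : R = 1 - V.map (Int.cast : ℤ → ℚ) * K) (hG : (Vᵀ * V).det ≠ 0) :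
    ∃ N : Matrix ι ι ℤ, N.map (Int.cast : ℤ → ℚ) = ((Vᵀ * V).det : ℚ) • R := by
  set W := V.map (Int.cast : ℤ → ℚ) with hW
  have e : Wᵀ * W = (Vᵀ * V).map (Int.castRingHom ℚ) := by
    rw [Matrix.map_mul, hW]; rfl
  have e' : (Wᵀ * W).det = ((Vᵀ * V).det : ℚ) := by
    rw [e]; exact (RingHom.map_det (Int.castRingHom ℚ) _).symm
  have hu : IsUnit (Wᵀ * W).det := by rw [e']; exact (Int.cast_ne_zero.2 hG).isUnit
  refine ⟨(Vᵀ * V).det • 1 - V * (Vᵀ * V).adjugate * Vᵀ, ?_⟩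
  have e2 : (Vᵀ * V).adjugate.map (Int.castRingHom ℚ) = (Wᵀ * W).det • (Wᵀ * W)⁻¹ := by
    rw [inv_def, smul_smul, Ring.mul_inverse_cancel _ hu, one_smul, e]
    exact RingHom.map_adjugate (Int.castRingHom ℚ) _
  have e3 : ((Vᵀ * V).det • 1 - V * (Vᵀ * V).adjugate * Vᵀ).map (Int.castRingHom ℚ) =
      (Wᵀ * W).det • 1 - W * (Vᵀ * V).adjugate.map (Int.castRingHom ℚ) * Wᵀ := by
    rw [Matrix.map_sub _ (map_sub _), Matrix.map_mul, Matrix.map_mul, e']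
    congr 1
    ext a b
    simp only [map_apply, Matrix.smul_apply, one_apply]
    split_ifs <;> simp
  refine Eq.trans e3 ?_
  rw [e2, ← e', h.eq_of_gram hV hK hu, smul_sub, Matrix.mul_smul, Matrix.smul_mul]

/-- Adjoining `v` to the Gram matrix multiplies its determinant by the Schur complement `v ⬝ᵥ R *ᵥ
v`, so the new determinant is the new denominator. As `R` is a projection, the factor is at most `v
⬝ᵥ v`; the additional 1 covers the vectors that are skipped. -/
theorem ElimInv.elimStep [DecidableEq ι] {s : ℤ × Matrix ι ι ℤ} {U : Submodule ℚ (ι → ℚ)}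
    (h : ElimInv s U)
    (v : ι → ℤ) : ElimInv (elimStep s v) (U ⊔ Submodule.span ℚ {fun a => (v a : ℚ)}) ∧
      (RegAut.elimStep s v).1 ≤ s.1 * (1 + v ⬝ᵥ v) := by
  obtain ⟨hpos, R, hR, hp, hU, κ, _, _, V, hdet, hV, K, hK⟩ := h
  set D := s.1 with hD
  set v' : ι → ℚ := fun a => (v a : ℚ) with hv'
  have hD0 : (D : ℚ) ≠ 0 := by exact_mod_cast hpos.ne'
  have hr (a : ι) : ((s.2 *ᵥ v) a : ℚ) = D * (R *ᵥ v') a := by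
    rw [map_intCast_mulVec, hR, smul_mulVec]; rfl
  have hq : ((v ⬝ᵥ s.2 *ᵥ v : ℤ) : ℚ) = D * (v' ⬝ᵥ R *ᵥ v') := by
    simp only [dotProduct, Int.cast_sum, Int.cast_mul, hr, Finset.mul_sum]
    exact Finset.sum_congr rfl fun a _ => by simp only [hv']; ring
  have hvv : ((v ⬝ᵥ v : ℤ) : ℚ) = v' ⬝ᵥ v' := by simp [dotProduct, hv']
  have hvv0 : 0 ≤ v ⬝ᵥ v := Finset.sum_nonneg fun i _ => mul_self_nonneg _
  unfold RegAut.elimStep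
  split_ifs with h0
  -- The quadratic form at `v` is the squared norm of `R *ᵥ v'`. If it vanishes, `v` already lies in
  -- `U` and nothing has to be changed.
  · rw [h0, Int.cast_zero, eq_comm, mul_eq_zero_iff_left hD0, hp.mulVec_eq_zero_iff, hU] at hq
    refine ⟨?_, by nlinarith⟩
    rw [sup_eq_left.2 (by simpa using hq)]
    exact ⟨hpos, R, hR, hp, hU, κ, _, _, V, hdet, hV, K, hK⟩
  · have hc : v' ⬝ᵥ R *ᵥ v' ≠ 0 := fun h => h0 (by rw [h, mul_zero] at hq; exact_mod_cast hq)
    have hp' := hp.sub_vecMulVec hc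
    have hU' := hp.sub_vecMulVec_mulVec_eq_zero_iff hc hU
    set R' := R - (v' ⬝ᵥ R *ᵥ v')⁻¹ • vecMulVec (R *ᵥ v') (R *ᵥ v') with hR'
    set D' := v ⬝ᵥ s.2 *ᵥ v with hD'
    have hD'pos : 0 < D' := by
      have h1 : (0 : ℚ) < D' := by
        rw [hq]
        exact mul_pos (by exact_mod_cast hpos) (lt_of_le_of_ne (hp.dotProduct_mulVec_nonneg _) hc.symm)
      exact_mod_cast h1
    let V' : Matrix ι (κ ⊕ Unit) ℤ := fromCols V (replicateCol Unit v)
    have hV'map : V'.map (Int.cast : ℤ → ℚ) =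
        fromCols (V.map (Int.cast : ℤ → ℚ)) (replicateCol Unit v') := by
      ext a (b | b) <;> simp [V', hv']
    set W := V.map (Int.cast : ℤ → ℚ) with hW
    have hV'0 : R' * V'.map (Int.cast : ℤ → ℚ) = 0 := by
      have h1 : ∀ x ∈ U ⊔ Submodule.span ℚ {v'}, R' *ᵥ x = 0 := fun x hx => (hU' x).2 hx
      rw [hV'map, mul_fromCols]
      ext a (b | b)
      · have h2 : R *ᵥ (fun c => W c b) = 0 := by
          ext a; exact congrFun (congrFun hV a) b
        exact congrFun (h1 _ (Submodule.mem_sup_left ((hU _).1 h2))) a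
      · exact congrFun (h1 _ (Submodule.mem_sup_right (Submodule.mem_span_singleton_self v'))) a
    have hRv : R *ᵥ v' = v' - W *ᵥ (K *ᵥ v') := by
      rw [hK, sub_mulVec, one_mulVec, mulVec_mulVec]
    have hK' : ∃ K' : Matrix (κ ⊕ Unit) ι ℚ, R' = 1 - V'.map (Int.cast : ℤ → ℚ) * K' := by
      -- Substituting `R *ᵥ v' = v' - W *ᵥ (K *ᵥ v')` for the left factor of the rank-one correction
      -- separates the part along the old columns from the part along `v'`.
      refine ⟨fromRows (K - vecMulVec (K *ᵥ v') ((v' ⬝ᵥ R *ᵥ v')⁻¹ • R *ᵥ v'))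
        (replicateRow Unit ((v' ⬝ᵥ R *ᵥ v')⁻¹ • R *ᵥ v')), ?_⟩
      have e1 : W * K = 1 - R := by rw [hK, sub_sub_cancel]
      have e2 : W *ᵥ (K *ᵥ v') = v' - R *ᵥ v' := by rw [hRv, sub_sub_cancel]
      rw [hV'map, fromCols_mul_fromRows, ← vecMulVec_eq, Matrix.mul_sub, mul_vecMulVec, e1, e2, hR']
      ext a b
      simp only [Matrix.sub_apply, Matrix.add_apply, Matrix.smul_apply, vecMulVec_apply,
        Pi.sub_apply, Pi.smul_apply, smul_eq_mul]
      ring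
    obtain ⟨K', hK'⟩ := hK'
    have hdet' : (V'ᵀ * V').det = D' := by
      have hcast : ((V'ᵀ * V').det : ℚ) = D' := by
        have e1 : ((V'ᵀ * V').det : ℚ) =
            ((V'.map (Int.cast : ℤ → ℚ))ᵀ * V'.map (Int.cast : ℤ → ℚ)).det := by
          refine (RingHom.map_det (Int.castRingHom ℚ) _).trans ?_
          rw [RingHom.mapMatrix_apply, Matrix.map_mul]; rfl
        have e2 : (Wᵀ * W).det = D := by
          rw [← hdet]
          refine ((RingHom.map_det (Int.castRingHom ℚ) _).trans ?_).symm
          rw [RingHom.mapMatrix_apply, Matrix.map_mul]; rfl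
        have hu : IsUnit (Wᵀ * W).det := by rw [e2]; exact hD0.isUnit
        have e3 := hp.eq_of_gram hV hK hu
        let := (Wᵀ * W).invertibleOfIsUnitDet hu
        -- Block determinant with a one-by-one lower right block: the old determinant times a Schur
        -- complement, which is the Gram formula for `R` evaluated at `v'`.
        rw [e1, hV'map, transpose_fromCols, fromRows_mul_fromCols, det_fromBlocks₁₁, e2, det_unique,
          hq, invOf_eq_nonsing_inv, e3]
        congr 1
        rw [Matrix.sub_apply, sub_mulVec, dotProduct_sub, one_mulVec]
        congr 1
        have e4 (N : Matrix ι ι ℚ) :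
            (replicateCol Unit v')ᵀ * N * replicateCol Unit v' =
              .of fun _ _ => v' ⬝ᵥ N *ᵥ v' := by
          rw [Matrix.mul_assoc]; rfl
        have e5 : (replicateCol Unit v')ᵀ * W * (Wᵀ * W)⁻¹ * (Wᵀ * replicateCol Unit v') =
            (replicateCol Unit v')ᵀ * (W * (Wᵀ * W)⁻¹ * Wᵀ) * replicateCol Unit v' := by
          simp only [Matrix.mul_assoc]
        rw [e5, e4, of_apply]
      exact_mod_cast hcast
    obtain ⟨N, hN⟩ := ElimInv.exists_det_smul hp' hV'0 hK' (by rw [hdet']; exact h0)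
    rw [hdet'] at hN
    -- Before the division, the numerator is `D` times the entry of the integral matrix `N`, so
    -- integer division loses nothing.
    have hM : (Matrix.of fun a b => (D' * s.2 a b - (s.2 *ᵥ v) a * (s.2 *ᵥ v) b) / D) = N := by
      ext a b
      have h1 : D' * s.2 a b - (s.2 *ᵥ v) a * (s.2 *ᵥ v) b = D * N a b := by
        have h2 := congrFun (congrFun hN a) b
        have h3 := congrFun (congrFun hR a) b
        simp only [map_apply, Matrix.smul_apply, smul_eq_mul, hR', Matrix.sub_apply, vecMulVec_apply] at h2 h3
        have h4 : ((D' * s.2 a b - (s.2 *ᵥ v) a * (s.2 *ᵥ v) b : ℤ) : ℚ) = (D * N a b : ℤ) := by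
          push_cast
          rw [h2, h3, hr, hr, hq]
          field_simp
        exact_mod_cast h4
      rw [of_apply, h1, Int.mul_ediv_cancel_left _ hpos.ne']
    refine ⟨⟨hD'pos, R', ?_, hp', hU', _, inferInstance, inferInstance, V', hdet', hV'0, K', hK'⟩, ?_⟩
    · rw [hM]; exact hN
    · have h1 : (D' : ℚ) ≤ (D * (1 + v ⬝ᵥ v) : ℤ) := by
        push_cast
        rw [hq, hvv]
        have h2 := hp.dotProduct_mulVec_le v'
        have : (0 : ℚ) < D := by exact_mod_cast hpos
        gcongr
        linarith
      exact_mod_cast h1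

end Elimination
end RegAut

namespace RegAut

/-! ## Runs -/

theorem ext_dotProduct_ext {ι : Type} [Fintype ι] (u v : ι → ℚ) (c d : ℚ) :
    ext u c ⬝ᵥ ext v d = c * d + u ⬝ᵥ v := by
  simp [dotProduct, Fintype.sum_option, ext]

theorem ext_eta {ι : Type} (s : Option ι → ℚ) : ext (fun i => s (some i)) (s none) = s := by
  funext i
  cases i <;> rfl

section Transitions

variable {k l n k' l' n' : ℕ}

/-- The step of a configuration that a transition and an input value entail. -/
def Transition.Step (t : Transition k l n) (d : ℚ) (c c' : Fin n × Vec k l) : Prop :=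
  c.1 = t.src ∧ c'.1 = t.tgt ∧
  t.guard.Sat (ext (fun i => c.2 (Sum.inl i)) d) ∧
  (∀ i, c'.2 (Sum.inl i) = ext (fun i => c.2 (Sum.inl i)) d (t.A i)) ∧
  (∀ j, c'.2 (Sum.inr j) = (t.B.mulVec (ext c.2 d) + t.b) j)

theorem Transition.Step.unique {t : Transition k l n} {d : ℚ} {c c₁ c₂ : Fin n × Vec k l}
    (h₁ : t.Step d c c₁) (h₂ : t.Step d c c₂) : c₁ = c₂ := by
  obtain ⟨-, h₁, -, h₁', h₁''⟩ := h₁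
  obtain ⟨-, h₂, -, h₂', h₂''⟩ := h₂
  refine Prod.ext (h₁.trans h₂.symm) (funext fun i => ?_)
  cases i with
  | inl i => rw [h₁', h₂']
  | inr j => rw [h₁'', h₂'']

theorem Transition.exists_step {t : Transition k l n} {d : ℚ} {c : Fin n × Vec k l}
    (h : c.1 = t.src) (h' : t.guard.Sat (ext (fun i => c.2 (Sum.inl i)) d)) :
    ∃ c', t.Step d c c' :=
  ⟨(t.tgt, Sum.elim (fun i => ext (fun i => c.2 (Sum.inl i)) d (t.A i))
    fun j => (t.B.mulVec (ext c.2 d) + t.b) j), h, rfl, h', fun _ => rfl, fun _ => rfl⟩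

/-- A step by one of the transitions in a list. -/
def Next (L : List (Transition k l n)) (d : ℚ) (c c' : Fin n × Vec k l) : Prop :=
  ∃ t ∈ L, t.Step d c c'

/-- Two transitions that start in the same state have jointly unsatisfiable guards. -/
def Transition.Excl (t t' : Transition k l n) : Prop :=
  t.src = t'.src → ¬ ∃ s : Option (Fin k) → ℚ, t.guard.Sat s ∧ t'.guard.Sat s

/-- Distinct transitions exclude each other. -/
def Det (L : List (Transition k l n)) : Prop :=
  ∀ t ∈ L, ∀ t' ∈ L, t ≠ t' → t.Excl t'

theorem Det.next_unique {L : List (Transition k l n)} (h : Det L) {d : ℚ}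
    {c c₁ c₂ : Fin n × Vec k l} (h₁ : Next L d c c₁) (h₂ : Next L d c c₂) : c₁ = c₂ := by
  obtain ⟨t, ht, h₁⟩ := h₁
  obtain ⟨t', ht', h₂⟩ := h₂
  by_cases e : t = t'
  · subst e; exact h₁.unique h₂
  · exact absurd ⟨_, h₁.2.2.1, h₂.2.2.1⟩ (h t ht t' ht' e (h₁.1.symm.trans h₂.1))

/-- Every configuration has a successor under every input. -/
def Total (L : List (Transition k l n)) : Prop := ∀ d c, ∃ c', Next L d c c'

end Transitions

namespace RAQ

variable {A : RAQ} {c c' c'' : A.Config} {d : ℚ} {w w' : List ℚ}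

theorem run_nil_iff : A.Run c [] c' ↔ c = c' :=
  ⟨fun h => by cases h; rfl, fun h => h ▸ .nil c⟩

theorem run_cons_iff : A.Run c (d :: w) c'' ↔ ∃ c', Next A.δ d c c' ∧ A.Run c' w c'' := by
  constructor
  · intro h
    cases h with
    | cons t ht h hr => exact ⟨_, ⟨t, ht, h⟩, hr⟩
  · rintro ⟨c', ⟨t, ht, h⟩, hr⟩
    exact .cons t ht h hr

theorem run_append_iff : A.Run c (w ++ w') c'' ↔ ∃ c', A.Run c w c' ∧ A.Run c' w' c'' := by
  induction w generalizing c with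
  | nil => simp [run_nil_iff]
  | cons d w ih =>
    simp only [List.cons_append, run_cons_iff, ih]
    constructor
    · rintro ⟨x, h, y, h', h''⟩; exact ⟨y, ⟨x, h, h'⟩, h''⟩
    · rintro ⟨y, ⟨x, h, h'⟩, h''⟩; exact ⟨x, h, y, h', h''⟩

theorem run_concat_iff :
    A.Run c (w ++ [d]) c'' ↔ ∃ c', A.Run c w c' ∧ Next A.δ d c' c'' := by
  simp [run_append_iff, run_cons_iff, run_nil_iff]

theorem run_unique (h : Det A.δ) {c₁ c₂ : A.Config} (h₁ : A.Run c w c₁) (h₂ : A.Run c w c₂) :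
    c₁ = c₂ := by
  induction w generalizing c with
  | nil => rw [run_nil_iff] at h₁ h₂; exact h₁.symm.trans h₂
  | cons d w ih =>
    rw [run_cons_iff] at h₁ h₂
    obtain ⟨x, hx, h₁⟩ := h₁
    obtain ⟨y, hy, h₂⟩ := h₂
    obtain rfl := h.next_unique hx hy
    exact ih h₁ h₂

theorem exists_run (h : Total A.δ) (c : A.Config) (w : List ℚ) : ∃ c', A.Run c w c' := by
  induction w generalizing c with
  | nil => exact ⟨c, .nil c⟩
  | cons d w ih =>
    obtain ⟨x, hx⟩ := h d c
    obtain ⟨y, hy⟩ := ih x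
    exact ⟨y, run_cons_iff.2 ⟨x, hx, hy⟩⟩

/-- The set of the outputs in a configuration: it has at most one element. -/
def valueSet {k l : ℕ} (o : Option (LinExpr k l)) (u : Vec k l) : Set ℚ :=
  {r | ∃ g, o = some g ∧ r = g.value u}

theorem mem_outputs {r : ℚ} :
    r ∈ A.outputs w ↔ ∃ c, A.Run A.initial w c ∧ r ∈ valueSet (A.ζ c.1) c.2 := Iff.rfl

theorem outputs_eq (h : Det A.δ) (hr : A.Run A.initial w c) :
    A.outputs w = valueSet (A.ζ c.1) c.2 := by
  ext r
  rw [mem_outputs]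
  constructor
  · rintro ⟨c', h', hc⟩
    rwa [run_unique h hr h']
  · exact fun hc => ⟨c, hr, hc⟩

end RAQ

/-! ## Synchronization of two automata -/

section Sync

variable {k l n k' l' n' : ℕ}

/-- Joins the contents of the variables of two automata. -/
def join (u : Vec k l) (u' : Vec k' l') : Vec (k + k') (l + l') :=
  Sum.elim (Fin.append (fun i => u (.inl i)) fun i => u' (.inl i))
    (Fin.append (fun i => u (.inr i)) fun i => u' (.inr i))

@[simp] theorem join_inl_castAdd (u : Vec k l) (u' : Vec k' l') (i : Fin k) :
    join u u' (.inl (Fin.castAdd k' i)) = u (.inl i) := by simp [join]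

@[simp] theorem join_inl_natAdd (u : Vec k l) (u' : Vec k' l') (i : Fin k') :
    join u u' (.inl (Fin.natAdd k i)) = u' (.inl i) := by simp [join]

@[simp] theorem join_inr_castAdd (u : Vec k l) (u' : Vec k' l') (i : Fin l) :
    join u u' (.inr (Fin.castAdd l' i)) = u (.inr i) := by simp [join]

@[simp] theorem join_inr_natAdd (u : Vec k l) (u' : Vec k' l') (i : Fin l') :
    join u u' (.inr (Fin.natAdd l i)) = u' (.inr i) := by simp [join]

theorem join_dotProduct_join (u v : Vec k l) (u' v' : Vec k' l') :
    join u u' ⬝ᵥ join v v' = u ⬝ᵥ v + u' ⬝ᵥ v' := by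
  simp only [dotProduct, Fintype.sum_sum_type, Fin.sum_univ_add, join_inl_castAdd,
    join_inl_natAdd, join_inr_castAdd, join_inr_natAdd]
  ring

theorem join_surjective (v : Vec (k + k') (l + l')) : ∃ u u', v = join (k := k) (l := l) u u' := by
  refine ⟨Sum.elim (fun i => v (.inl (Fin.castAdd k' i))) fun i => v (.inr (Fin.castAdd l' i)),
    Sum.elim (fun i => v (.inl (Fin.natAdd k i))) fun i => v (.inr (Fin.natAdd l i)), ?_⟩
  funext i
  rcases i with i | i <;> refine Fin.addCases (fun i => ?_) (fun i => ?_) i <;> simp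

theorem join_injective {u v : Vec k l} {u' v' : Vec k' l'} (h : join u u' = join v v') :
    u = v ∧ u' = v' := by
  constructor <;> funext i <;> rcases i with i | i
  · simpa using congrFun h (.inl (Fin.castAdd k' i))
  · simpa using congrFun h (.inr (Fin.castAdd l' i))
  · simpa using congrFun h (.inl (Fin.natAdd k i))
  · simpa using congrFun h (.inr (Fin.natAdd l i))

/-- Two transitions that are taken simultaneously. -/
def Transition.sync (t : Transition k l n) (t' : Transition k' l' n') :
    Transition (k + k') (l + l') (n * n') where
  src := finProdFinEquiv (t.src, t'.src)
  guard := .conj (t.guard.rename (Fin.castAdd k')) (t'.guard.rename (Fin.natAdd k))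
  tgt := finProdFinEquiv (t.tgt, t'.tgt)
  A := Fin.append (fun i => (t.A i).map (Fin.castAdd k')) fun i => (t'.A i).map (Fin.natAdd k)
  B := Fin.append (fun j => ext (join (fun i => t.B j (some i)) 0) (t.B j none))
    fun j => ext (join 0 fun i => t'.B j (some i)) (t'.B j none)
  b := Fin.append t.b t'.b

/-- Joins two configurations. -/
def joinConfig (c : Fin n × Vec k l) (c' : Fin n' × Vec k' l') :
    Fin (n * n') × Vec (k + k') (l + l') :=
  (finProdFinEquiv (c.1, c'.1), join c.2 c'.2)

theorem joinConfig_surjective (e : Fin (n * n') × Vec (k + k') (l + l')) :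
    ∃ c c', e = joinConfig (n := n) (k := k) (l := l) c c' := by
  obtain ⟨p, v⟩ := e
  obtain ⟨u, u', rfl⟩ := join_surjective v
  obtain ⟨⟨p, p'⟩, rfl⟩ := finProdFinEquiv.surjective p
  exact ⟨(p, u), (p', u'), rfl⟩

theorem joinConfig_injective {c e : Fin n × Vec k l} {c' e' : Fin n' × Vec k' l'}
    (h : joinConfig c c' = joinConfig e e') : c = e ∧ c' = e' := by
  obtain ⟨h1, h2⟩ := Prod.ext_iff.1 h
  obtain ⟨h3, h4⟩ := Prod.ext_iff.1 (finProdFinEquiv.injective h1)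
  obtain ⟨h5, h6⟩ := join_injective h2
  exact ⟨Prod.ext h3 h5, Prod.ext h4 h6⟩

theorem Guard.sat_rename_castAdd (u : Vec k l) (u' : Vec k' l') (d : ℚ) (φ : Guard k) :
    (φ.rename (Fin.castAdd k')).Sat (ext (fun i => join u u' (.inl i)) d) ↔
      φ.Sat (ext (fun i => u (.inl i)) d) := by
  rw [Guard.sat_rename]
  refine Iff.of_eq (congrArg (φ.Sat ·) (funext fun z => ?_))
  cases z <;> simp [ext]

theorem Guard.sat_rename_natAdd (u : Vec k l) (u' : Vec k' l') (d : ℚ) (φ : Guard k') :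
    (φ.rename (Fin.natAdd k)).Sat (ext (fun i => join u u' (.inl i)) d) ↔
      φ.Sat (ext (fun i => u' (.inl i)) d) := by
  rw [Guard.sat_rename]
  refine Iff.of_eq (congrArg (φ.Sat ·) (funext fun z => ?_))
  cases z <;> simp [ext]

theorem Transition.step_sync_iff {t : Transition k l n} {t' : Transition k' l' n'} {d : ℚ}
    {c e : Fin n × Vec k l} {c' e' : Fin n' × Vec k' l'} :
    (t.sync t').Step d (joinConfig c c') (joinConfig e e') ↔ t.Step d c e ∧ t'.Step d c' e' := by
  have h1 (i : Fin k) : ext (fun i => join c.2 c'.2 (.inl i)) d ((t.sync t').A (Fin.castAdd k' i)) =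
      ext (fun i => c.2 (.inl i)) d (t.A i) := by
    cases h : t.A i <;> simp [Transition.sync, ext, h]
  have h2 (i : Fin k') : ext (fun i => join c.2 c'.2 (.inl i)) d ((t.sync t').A (Fin.natAdd k i)) =
      ext (fun i => c'.2 (.inl i)) d (t'.A i) := by
    cases h : t'.A i <;> simp [Transition.sync, ext, h]
  have h3 (j : Fin l) : ((t.sync t').B.mulVec (ext (join c.2 c'.2) d) + (t.sync t').b)
      (Fin.castAdd l' j) = (t.B.mulVec (ext c.2 d) + t.b) j := by
    have : (t.sync t').B (Fin.castAdd l' j) =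
      ext (join (fun i => t.B j (some i)) 0) (t.B j none) := by simp [Transition.sync]
    rw [Pi.add_apply, Pi.add_apply, Matrix.mulVec, Matrix.mulVec, this, ext_dotProduct_ext,
      join_dotProduct_join, zero_dotProduct, add_zero, ← ext_dotProduct_ext, ext_eta]
    simp [Transition.sync]
  have h4 (j : Fin l') : ((t.sync t').B.mulVec (ext (join c.2 c'.2) d) + (t.sync t').b)
      (Fin.natAdd l j) = (t'.B.mulVec (ext c'.2 d) + t'.b) j := by
    have : (t.sync t').B (Fin.natAdd l j) =
      ext (join 0 fun i => t'.B j (some i)) (t'.B j none) := by simp [Transition.sync]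
    rw [Pi.add_apply, Pi.add_apply, Matrix.mulVec, Matrix.mulVec, this, ext_dotProduct_ext,
      join_dotProduct_join, zero_dotProduct, zero_add, ← ext_dotProduct_ext, ext_eta]
    simp [Transition.sync]
  have h5 : (t.sync t').guard.Sat (ext (fun i => join c.2 c'.2 (.inl i)) d) ↔
      t.guard.Sat (ext (fun i => c.2 (.inl i)) d) ∧ t'.guard.Sat (ext (fun i => c'.2 (.inl i)) d) := by
    simp only [Transition.sync, Guard.Sat, Guard.sat_rename_castAdd, Guard.sat_rename_natAdd]
  simp only [Transition.Step, joinConfig, h5, Fin.forall_fin_add, h1, h2, h3, h4, join_inl_castAdd,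
    join_inl_natAdd, join_inr_castAdd, join_inr_natAdd]
  simp only [Transition.sync, EmbeddingLike.apply_eq_iff_eq, Prod.mk.injEq]
  tauto

theorem Transition.step_sync_iff_exists {t : Transition k l n} {t' : Transition k' l' n'} {d : ℚ}
    {c : Fin n × Vec k l} {c' : Fin n' × Vec k' l'} {e : Fin (n * n') × Vec (k + k') (l + l')} :
    (t.sync t').Step d (joinConfig c c') e ↔
      ∃ x y, e = joinConfig x y ∧ t.Step d c x ∧ t'.Step d c' y := by
  constructor
  · intro h
    obtain ⟨x, y, rfl⟩ := joinConfig_surjective (n := n) (k := k) (l := l) e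
    exact ⟨x, y, rfl, step_sync_iff.1 h⟩
  · rintro ⟨x, y, rfl, h⟩
    exact step_sync_iff.2 h

/-- The transition that stays in the state `p` and does not change any variable. -/
def Transition.idle (k l : ℕ) (p : Fin n) : Transition k l n where
  src := p
  guard := .le none none
  tgt := p
  A := some
  B j := ext (Pi.single (.inr j) 1) 0
  b := 0

theorem Transition.step_idle_iff {p : Fin n} {d : ℚ} {c e : Fin n × Vec k l} :
    (Transition.idle k l p).Step d c e ↔ c.1 = p ∧ e = c := by
  have h (j : Fin l) : ((Transition.idle k l p).B.mulVec (ext c.2 d) + (Transition.idle k l p).b) j =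
      c.2 (.inr j) := by
    rw [Pi.add_apply, Matrix.mulVec]
    simp only [Transition.idle, ext_dotProduct_ext]
    simp
  simp only [Transition.Step, h]
  simp only [Transition.idle, Guard.Sat, le_refl, ext, true_and]
  constructor
  · rintro ⟨h1, h2, h3, h4⟩
    exact ⟨h1, Prod.ext (h2.trans h1.symm) (funext fun i => by cases i <;> simp [h3, h4])⟩
  · rintro ⟨h1, rfl⟩
    exact ⟨h1, h1, fun _ => rfl, fun _ => rfl⟩

/-- The sum of an expression and the linear part of another one. -/
def LinExpr.join (g : LinExpr k l) (g' : LinExpr k' l') : LinExpr (k + k') (l + l') :=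
  ⟨RegAut.join g.coeff g'.coeff, g.const⟩

theorem LinExpr.value_join (g : LinExpr k l) (g' : LinExpr k' l') (u : Vec k l) (u' : Vec k' l') :
    (g.join g').value (RegAut.join u u') = g.value u + g'.coeff ⬝ᵥ u' := by
  simp only [LinExpr.value, LinExpr.join, join_dotProduct_join]
  ring

/-- The product of `A` and `A'` that takes a transition of both automata in each step, or a
transition of `A'` from the list `I` while `A` pauses. -/
def sync (A A' : RAQ) (I : List (Transition A'.k A'.l A'.n)) : RAQ where
  k := A.k + A'.k
  l := A.l + A'.l
  n := A.n * A'.n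
  q₀ := finProdFinEquiv (A.q₀, A'.q₀)
  u₀ := join A.u₀ A'.u₀
  δ := (A.δ.flatMap fun t => A'.δ.map fun t' => t.sync t') ++
    (List.finRange A.n).flatMap fun p => I.map fun t' => (Transition.idle A.k A.l p).sync t'
  ζ s := Option.map₂ LinExpr.join (A.ζ (finProdFinEquiv.symm s).1) (A'.ζ (finProdFinEquiv.symm s).2)

variable {A A' : RAQ} {I : List (Transition A'.k A'.l A'.n)}

theorem mem_sync_iff {x : Transition (A.k + A'.k) (A.l + A'.l) (A.n * A'.n)} :
    x ∈ (sync A A' I).δ ↔ (∃ t ∈ A.δ, ∃ t' ∈ A'.δ, x = t.sync t') ∨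
      ∃ p, ∃ t' ∈ I, x = (Transition.idle A.k A.l p).sync t' := by
  change x ∈ ((A.δ.flatMap fun t => A'.δ.map fun t' => t.sync t') ++ (List.finRange A.n).flatMap
    fun p => I.map fun t' => (Transition.idle A.k A.l p).sync t' : List (Transition _ _ _)) ↔ _
  simp only [List.mem_append, List.mem_flatMap, List.mem_map, List.mem_finRange, true_and,
    eq_comm]

theorem next_sync_iff {d : ℚ} {c : A.Config} {c' : A'.Config} {e : (sync A A' I).Config} :
    Next (sync A A' I).δ d (joinConfig c c') e ↔ ∃ x y, e = joinConfig x y ∧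
      (Next A.δ d c x ∧ Next A'.δ d c' y ∨ x = c ∧ Next I d c' y) := by
  constructor
  · rintro ⟨r, hr, h⟩
    rcases mem_sync_iff.1 hr with ⟨t, ht, t', ht', rfl⟩ | ⟨p, t', ht', rfl⟩
    · obtain ⟨x, y, rfl, h1, h2⟩ := Transition.step_sync_iff_exists.1 h
      exact ⟨x, y, rfl, .inl ⟨⟨t, ht, h1⟩, t', ht', h2⟩⟩
    · obtain ⟨x, y, rfl, h1, h2⟩ := Transition.step_sync_iff_exists.1 h
      exact ⟨x, y, rfl, .inr ⟨(Transition.step_idle_iff.1 h1).2, t', ht', h2⟩⟩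
  · rintro ⟨x, y, rfl, ⟨⟨t, ht, h1⟩, t', ht', h2⟩ | ⟨rfl, t', ht', h2⟩⟩
    · exact ⟨_, mem_sync_iff.2 (.inl ⟨t, ht, t', ht', rfl⟩), Transition.step_sync_iff.2 ⟨h1, h2⟩⟩
    · exact ⟨_, mem_sync_iff.2 (.inr ⟨x.1, t', ht', rfl⟩),
        Transition.step_sync_iff.2 ⟨Transition.step_idle_iff.2 ⟨rfl, rfl⟩, h2⟩⟩

theorem sat_sync {t : Transition k l n} {t' : Transition k' l' n'}
    {s : Option (Fin (k + k')) → ℚ} (h : (t.sync t').guard.Sat s) :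
    t.guard.Sat (fun z => s (z.map (Fin.castAdd k'))) ∧
      t'.guard.Sat (fun z => s (z.map (Fin.natAdd k))) := by
  simpa only [Transition.sync, Guard.Sat, Guard.sat_rename] using h

theorem Transition.Excl.sync_left {t₁ t₂ : Transition k l n} (h : t₁.Excl t₂)
    (t₁' t₂' : Transition k' l' n') : (t₁.sync t₁').Excl (t₂.sync t₂') := by
  rintro hs ⟨s, h1, h2⟩
  simp only [Transition.sync, EmbeddingLike.apply_eq_iff_eq, Prod.mk.injEq] at hs
  exact h hs.1 ⟨_, (sat_sync h1).1, (sat_sync h2).1⟩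

theorem Transition.Excl.sync_right {t₁' t₂' : Transition k' l' n'} (h : t₁'.Excl t₂')
    (t₁ t₂ : Transition k l n) : (t₁.sync t₁').Excl (t₂.sync t₂') := by
  rintro hs ⟨s, h1, h2⟩
  simp only [Transition.sync, EmbeddingLike.apply_eq_iff_eq, Prod.mk.injEq] at hs
  exact h hs.2 ⟨_, (sat_sync h1).2, (sat_sync h2).2⟩

theorem Transition.Excl.symm {t t' : Transition k l n} (h : t.Excl t') : t'.Excl t :=
  fun hs ⟨s, h1, h2⟩ => h hs.symm ⟨s, h2, h1⟩

/-- Two joint transitions exclude each other as soon as one component does. If `A'` moves in one and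
takes a transition of `I` in the other, `hx` applies; if both pause `A` with the same transition of
`I`, the states in which `A` pauses differ. -/
theorem det_sync (hA : Det A.δ) (hA' : Det A'.δ) (hI : Det I)
    (hx : ∀ t ∈ A'.δ, ∀ t' ∈ I, t.Excl t') : Det (sync A A' I).δ := by
  intro x hx₁ y hy₁ hne
  rcases mem_sync_iff.1 hx₁ with ⟨t, ht, t', ht', rfl⟩ | ⟨p, t', ht', rfl⟩ <;>
    rcases mem_sync_iff.1 hy₁ with ⟨r, hr, r', hr', rfl⟩ | ⟨q, r', hr', rfl⟩
  · by_cases e : t = r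
    · subst e
      exact (hA' t' ht' r' hr' fun e => hne (by rw [e])).sync_right _ _
    · exact (hA t ht r hr e).sync_left _ _
  · exact (hx t' ht' r' hr').sync_right _ _
  · exact (hx r' hr' t' ht').symm.sync_right _ _
  · by_cases e : t' = r'
    · subst e
      intro hs
      have hpq : p = q := congrArg Prod.fst (finProdFinEquiv.injective hs)
      exact absurd (by rw [hpq]) hne
    · exact (hI t' ht' r' hr' e).sync_right _ _

theorem initial_sync : (sync A A' I).initial = joinConfig A.initial A'.initial := rfl

theorem valueSet_sync (c : A.Config) (c' : A'.Config) :
    RAQ.valueSet ((sync A A' I).ζ (joinConfig c c').1) (joinConfig c c').2 =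
      {r | ∃ g, A.ζ c.1 = some g ∧ ∃ g', A'.ζ c'.1 = some g' ∧
        r = g.value c.2 + g'.coeff ⬝ᵥ c'.2} := by
  ext r
  simp only [RAQ.valueSet, sync, joinConfig, Equiv.symm_apply_apply, Set.mem_ofPred_eq,
    Option.map₂_eq_some_iff]
  constructor
  · rintro ⟨_, ⟨g, g', h, h', rfl⟩, rfl⟩
    exact ⟨g, h, g', h', LinExpr.value_join _ _ _ _⟩
  · rintro ⟨g, h, g', h', rfl⟩
    exact ⟨_, ⟨g, g', h, h', rfl⟩, (LinExpr.value_join _ _ _ _).symm⟩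

theorem run_sync_nil_iff {w : List ℚ} {c : A.Config} {c' : A'.Config}
    {e : (sync A A' []).Config} : (sync A A' []).Run (joinConfig c c') w e ↔
      ∃ x y, e = joinConfig x y ∧ A.Run c w x ∧ A'.Run c' w y := by
  induction w generalizing c c' with
  | nil =>
    constructor
    · intro h
      exact ⟨c, c', (RAQ.run_nil_iff.1 h).symm, .nil _, .nil _⟩
    · rintro ⟨x, y, rfl, hx, hy⟩
      rw [RAQ.run_nil_iff] at hx hy
      subst hx hy
      exact .nil _
  | cons d w ih =>
    constructor
    · intro h
      obtain ⟨z, h, hr⟩ := RAQ.run_cons_iff.1 h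
      obtain ⟨x, y, rfl, ⟨h1, h2⟩ | ⟨-, t, ht, -⟩⟩ := next_sync_iff.1 h
      · obtain ⟨a, b, rfl, ha, hb⟩ := ih.1 hr
        exact ⟨a, b, rfl, RAQ.run_cons_iff.2 ⟨x, h1, ha⟩, RAQ.run_cons_iff.2 ⟨y, h2, hb⟩⟩
      · exact absurd ht List.not_mem_nil
    · rintro ⟨a, b, rfl, ha, hb⟩
      obtain ⟨x, h1, ha⟩ := RAQ.run_cons_iff.1 ha
      obtain ⟨y, h2, hb⟩ := RAQ.run_cons_iff.1 hb
      exact RAQ.run_cons_iff.2 ⟨_, next_sync_iff.2 ⟨x, y, rfl, .inl ⟨h1, h2⟩⟩, ih.2 ⟨a, b, rfl, ha, hb⟩⟩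

/-- The first component of a run of the product is a run on some of the letters. -/
theorem exists_run_of_run_sync {w : List ℚ} {c : A.Config} {c' : A'.Config}
    {e : (sync A A' I).Config} (h : (sync A A' I).Run (joinConfig c c') w e) :
    ∃ w' x y, e = joinConfig x y ∧ A.Run c w' x := by
  induction w generalizing c c' with
  | nil =>
    exact ⟨[], c, c', (RAQ.run_nil_iff.1 h).symm, .nil _⟩
  | cons d w ih =>
    obtain ⟨_, h, hr⟩ := RAQ.run_cons_iff.1 h
    obtain ⟨x, y, rfl, ⟨h1, -⟩ | ⟨rfl, -⟩⟩ := next_sync_iff.1 h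
    · obtain ⟨w', a, b, rfl, ha⟩ := ih hr
      exact ⟨d :: w', a, b, rfl, RAQ.run_cons_iff.2 ⟨x, h1, ha⟩⟩
    · exact ih hr

theorem total_sync (hA : Total A.δ) (h : ∀ d c, ∃ c', Next A'.δ d c c' ∨ Next I d c c') :
    Total (sync A A' I).δ := by
  intro d e
  obtain ⟨c, c', rfl⟩ := joinConfig_surjective (n := A.n) (k := A.k) (l := A.l) e
  obtain ⟨y, h | h⟩ := h d c'
  · obtain ⟨x, hx⟩ := hA d c
    exact ⟨_, next_sync_iff.2 ⟨x, y, rfl, .inl ⟨hx, h⟩⟩⟩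
  · exact ⟨_, next_sync_iff.2 ⟨c, y, rfl, .inr ⟨rfl, h⟩⟩⟩

end Sync
end RegAut

namespace RegAut

/-! ## Completion by a sink -/

section Complete

variable {k l n : ℕ}

/-- The guard that excludes all the transitions of a list that start in `p`. -/
def Guard.rest (L : List (Transition k l n)) (p : Fin n) : Guard k :=
  L.foldl (fun φ t => if t.src = p then .conj φ (.neg t.guard) else φ) (.le none none)

theorem Guard.rest_concat (L : List (Transition k l n)) (t : Transition k l n) (p : Fin n) :
    Guard.rest (L ++ [t]) p =
      if t.src = p then .conj (Guard.rest L p) (.neg t.guard) else Guard.rest L p := by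
  simp [Guard.rest, List.foldl_append]

theorem Guard.sat_rest {L : List (Transition k l n)} {p : Fin n} {s : Option (Fin k) → ℚ} :
    (Guard.rest L p).Sat s ↔ ∀ t ∈ L, t.src = p → ¬ t.guard.Sat s := by
  induction L using List.reverseRecOn with
  | nil => simp [Guard.rest, Guard.Sat]
  | append_singleton L t ih =>
    rw [Guard.rest_concat]
    split_ifs with h
    · simp [Guard.Sat, ih, or_imp, forall_and, h]
    · simp [ih, or_imp, forall_and, h]

/-- Adds a state. -/
def Transition.lift (t : Transition k l n) : Transition k l (n + 1) where
  src := Fin.castAdd 1 t.src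
  guard := t.guard
  tgt := Fin.castAdd 1 t.tgt
  A := t.A
  B := t.B
  b := t.b

/-- The transition to the sink. -/
def Transition.toSink (L : List (Transition k l (n + 1))) (p : Fin (n + 1)) :
    Transition k l (n + 1) where
  src := p
  guard := Guard.rest L p
  tgt := Fin.natAdd n 0
  A := some
  B := fun _ => 0
  b := 0

/-- Adds a sink to which all the missing transitions lead. -/
def complete (A : RAQ) : RAQ where
  k := A.k
  l := A.l
  n := A.n + 1
  q₀ := Fin.castAdd 1 A.q₀
  u₀ := A.u₀
  δ := A.δ.map Transition.lift ++ List.ofFn (Transition.toSink (A.δ.map Transition.lift))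
  ζ := Fin.append A.ζ fun _ => none

variable {A : RAQ}

theorem mem_complete_iff {x : Transition A.k A.l (A.n + 1)} : x ∈ (complete A).δ ↔
    (∃ t ∈ A.δ, x = t.lift) ∨ ∃ p, x = .toSink (A.δ.map Transition.lift) p := by
  change x ∈ (A.δ.map Transition.lift ++
    List.ofFn (Transition.toSink (A.δ.map Transition.lift)) : List (Transition _ _ _)) ↔ _
  simp only [List.mem_append, List.mem_map, List.mem_ofFn', Set.mem_range, eq_comm]

theorem Transition.lift_excl_toSink {L : List (Transition k l n)} {t : Transition k l n}
    (ht : t ∈ L) (p : Fin (n + 1)) : t.lift.Excl (.toSink (L.map Transition.lift) p) := by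
  rintro hs ⟨s, h1, h2⟩
  exact Guard.sat_rest.1 h2 _ (List.mem_map_of_mem ht) hs h1

theorem det_complete (h : Det A.δ) : Det (complete A).δ := by
  intro x hx y hy hne
  rcases mem_complete_iff.1 hx with ⟨t, ht, rfl⟩ | ⟨p, rfl⟩ <;>
    rcases mem_complete_iff.1 hy with ⟨r, hr, rfl⟩ | ⟨q, rfl⟩
  · intro hs
    exact h t ht r hr (fun e => hne (by rw [e])) (Fin.castAdd_injective _ _ hs)
  · exact Transition.lift_excl_toSink ht q
  · exact (Transition.lift_excl_toSink hr p).symm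
  · intro hs
    exact absurd (congrArg _ hs) hne

theorem total_complete : Total (complete A).δ := by
  intro d c
  by_cases h : (Guard.rest (A.δ.map Transition.lift) c.1).Sat (ext (fun i => c.2 (.inl i)) d)
  · obtain ⟨c', hc'⟩ := Transition.exists_step (c := c) (d := d)
      (t := .toSink (A.δ.map Transition.lift) c.1) rfl h
    exact ⟨c', _, mem_complete_iff.2 (.inr ⟨_, rfl⟩), hc'⟩
  · replace h := mt Guard.sat_rest.2 h
    push Not at h
    obtain ⟨x, hx, hs, hg⟩ := h
    obtain ⟨t, ht, rfl⟩ := List.mem_map.1 hx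
    obtain ⟨c', hc'⟩ := Transition.exists_step hs.symm hg
    exact ⟨c', _, mem_complete_iff.2 (.inl ⟨t, ht, rfl⟩), hc'⟩

/-- A configuration as a configuration of the completion. -/
def liftConfig (c : Fin n × Vec k l) : Fin (n + 1) × Vec k l := (Fin.castAdd 1 c.1, c.2)

theorem Transition.step_lift_iff {t : Transition k l n} {d : ℚ} {x : Fin (n + 1) × Vec k l}
    {c' : Fin n × Vec k l} :
    t.lift.Step d x (liftConfig c') ↔ ∃ c, x = liftConfig c ∧ t.Step d c c' := by
  constructor
  · rintro ⟨h1, h2, h3⟩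
    exact ⟨(t.src, x.2), Prod.ext h1 rfl, rfl, Fin.castAdd_injective _ _ h2, h3⟩
  · rintro ⟨c, rfl, h1, h2, h3⟩
    exact ⟨congrArg (Fin.castAdd 1) h1, congrArg (Fin.castAdd 1) h2, h3⟩

theorem next_complete_iff {d : ℚ} {x : (complete A).Config} {c' : A.Config} :
    Next (complete A).δ d x (liftConfig c') ↔ ∃ c, x = liftConfig c ∧ Next A.δ d c c' := by
  constructor
  · rintro ⟨r, hr, h⟩
    rcases mem_complete_iff.1 hr with ⟨t, ht, rfl⟩ | ⟨p, rfl⟩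
    · obtain ⟨c, rfl, h'⟩ := Transition.step_lift_iff.1 h
      exact ⟨c, rfl, t, ht, h'⟩
    · have h' := congrArg Fin.val h.2.1
      have := c'.1.2
      simp only [liftConfig, Transition.toSink, Fin.val_castAdd, Fin.val_natAdd] at h'
      omega
  · rintro ⟨c, rfl, t, ht, h⟩
    exact ⟨_, mem_complete_iff.2 (.inl ⟨t, ht, rfl⟩), Transition.step_lift_iff.2 ⟨c, rfl, h⟩⟩

/-- The sink cannot be left, so a run that ends in an old configuration has only old ones. Therefore
just the end is assumed to be old, and the induction recovers the start. -/
theorem run_complete_iff {w : List ℚ} {x : (complete A).Config} {c' : A.Config} :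
    (complete A).Run x w (liftConfig c') ↔ ∃ c, x = liftConfig c ∧ A.Run c w c' := by
  induction w generalizing x with
  | nil =>
    constructor
    · intro h
      exact ⟨c', RAQ.run_nil_iff.1 h, .nil _⟩
    · rintro ⟨c, rfl, h⟩
      obtain rfl : c = c' := RAQ.run_nil_iff.1 h
      exact .nil _
  | cons d w ih =>
    constructor
    · intro h
      obtain ⟨y, hn, hr⟩ := RAQ.run_cons_iff.1 h
      obtain ⟨z, rfl, hr'⟩ := ih.1 hr
      obtain ⟨c, rfl, hn'⟩ := next_complete_iff.1 hn
      exact ⟨c, rfl, RAQ.run_cons_iff.2 ⟨z, hn', hr'⟩⟩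
    · rintro ⟨c, rfl, h⟩
      obtain ⟨z, h, hr⟩ := RAQ.run_cons_iff.1 h
      exact RAQ.run_cons_iff.2 ⟨_, next_complete_iff.2 ⟨c, rfl, h⟩, ih.2 ⟨z, rfl, hr⟩⟩

theorem liftConfig_injective : Function.Injective (liftConfig (k := k) (l := l) (n := n)) := by
  intro c c' h
  obtain ⟨h1, h2⟩ := Prod.ext_iff.1 h
  exact Prod.ext (Fin.castAdd_injective _ _ h1) h2

theorem outputs_complete (w : List ℚ) : (complete A).outputs w = A.outputs w := by
  ext r
  rw [RAQ.mem_outputs, RAQ.mem_outputs]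
  constructor
  · rintro ⟨⟨p, u⟩, h, g, hg, hr⟩
    induction p using Fin.addCases (m := A.n) (n := 1) with
    | left p =>
      obtain ⟨c, hc, h⟩ := (run_complete_iff (c' := ((p, u) : A.Config))).1 h
      have : c = A.initial := liftConfig_injective hc.symm
      refine ⟨(p, u), this ▸ h, g, ?_, hr⟩
      simpa [complete] using hg
    | right p => simp [complete] at hg
  · rintro ⟨c, h, g, hg, hr⟩
    exact ⟨liftConfig c, run_complete_iff.2 ⟨_, rfl, h⟩, g, by simpa [complete, liftConfig] using hg,
      hr⟩

end Complete

/-! ## Recording the output in the variables -/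

section Observe

variable {k l n : ℕ}

/-- Adds two data variables. -/
def obs (u : Vec k l) (f y : ℚ) : Vec k (l + 2) :=
  Sum.elim (fun i => u (.inl i)) (Fin.append (fun j => u (.inr j)) ![f, y])

@[simp] theorem obs_inl (u : Vec k l) (f y : ℚ) (i : Fin k) : obs u f y (.inl i) = u (.inl i) := rfl

@[simp] theorem obs_inr_castAdd (u : Vec k l) (f y : ℚ) (j : Fin l) :
    obs u f y (.inr (Fin.castAdd 2 j)) = u (.inr j) := by simp [obs]

@[simp] theorem obs_inr_natAdd (u : Vec k l) (f y : ℚ) (j : Fin 2) :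
    obs u f y (.inr (Fin.natAdd l j)) = ![f, y] j := by simp [obs]

theorem obs_dotProduct_obs (u v : Vec k l) (f y f' y' : ℚ) :
    obs u f y ⬝ᵥ obs v f' y' = u ⬝ᵥ v + (f * f' + y * y') := by
  simp only [dotProduct, Fintype.sum_sum_type, Fin.sum_univ_add, obs_inl, obs_inr_castAdd,
    obs_inr_natAdd, Fin.sum_univ_two, Matrix.cons_val_zero, Matrix.cons_val_one]
  ring

theorem obs_surjective (v : Vec k (l + 2)) : ∃ u f y, v = obs u f y := by
  refine ⟨Sum.elim (fun i => v (.inl i)) fun j => v (.inr (Fin.castAdd 2 j)),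
    v (.inr (Fin.natAdd l 0)), v (.inr (Fin.natAdd l 1)), funext fun i => ?_⟩
  rcases i with i | i
  · simp
  · refine Fin.addCases (fun i => ?_) (fun i => ?_) i
    · simp
    · fin_cases i <;> simp

theorem obs_injective {u u' : Vec k l} {f f' y y' : ℚ} (h : obs u f y = obs u' f' y') :
    u = u' ∧ f = f' ∧ y = y' := by
  refine ⟨funext fun i => ?_, by simpa using congrFun h (.inr (Fin.natAdd l 0)),
    by simpa using congrFun h (.inr (Fin.natAdd l 1))⟩
  rcases i with i | j
  · simpa using congrFun h (.inl i)
  · simpa using congrFun h (.inr (Fin.castAdd 2 j))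

/-- The expression, or zero if there is none. -/
def emit (o : Option (LinExpr k l)) : LinExpr k l := o.getD ⟨0, 0⟩

/-- Whether there is an expression. -/
def flag (o : Option (LinExpr k l)) : ℚ := if o.isSome then 1 else 0

/-- Stores whether `o` exists, and the value of `o`, in two new data variables. -/
def Transition.observe (t : Transition k l n) (o : Option (LinExpr k l)) :
    Transition k (l + 2) n where
  src := t.src
  guard := t.guard
  tgt := t.tgt
  A := t.A
  B := Fin.append (fun j => ext (obs (fun i => t.B j (some i)) 0 0) (t.B j none))
    ![ext 0 0, ext (obs (emit o).coeff 0 0) 0]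
  b := Fin.append t.b ![flag o, (emit o).const]

theorem Transition.step_observe_iff {t : Transition k l n} {o : Option (LinExpr k l)} {d f y : ℚ}
    {p : Fin n} {u : Vec k l} {e : Fin n × Vec k (l + 2)} :
    (t.observe o).Step d (p, obs u f y) e ↔
      ∃ q u', e = (q, obs u' (flag o) ((emit o).value u)) ∧ t.Step d (p, u) (q, u') := by
  have h1 (j : Fin l) : ((t.observe o).B.mulVec (ext (obs u f y) d) + (t.observe o).b)
      (Fin.castAdd 2 j) = (t.B.mulVec (ext u d) + t.b) j := by
    have : (t.observe o).B (Fin.castAdd 2 j) =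
      ext (obs (fun i => t.B j (some i)) 0 0) (t.B j none) := by simp [Transition.observe]
    rw [Pi.add_apply, Pi.add_apply, Matrix.mulVec, Matrix.mulVec, this, ext_dotProduct_ext,
      obs_dotProduct_obs, zero_mul, zero_mul, add_zero, add_zero, ← ext_dotProduct_ext, ext_eta]
    simp [Transition.observe]
  have h2 : ((t.observe o).B.mulVec (ext (obs u f y) d) + (t.observe o).b) (Fin.natAdd l 0) =
      flag o := by
    have : (t.observe o).B (Fin.natAdd l 0) = ext 0 0 := by simp [Transition.observe]
    rw [Pi.add_apply, Matrix.mulVec, this, ext_dotProduct_ext]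
    simp [Transition.observe]
  have h3 : ((t.observe o).B.mulVec (ext (obs u f y) d) + (t.observe o).b) (Fin.natAdd l 1) =
      (emit o).value u := by
    have : (t.observe o).B (Fin.natAdd l 1) = ext (obs (emit o).coeff 0 0) 0 := by
      simp [Transition.observe]
    rw [Pi.add_apply, Matrix.mulVec, this, ext_dotProduct_ext, obs_dotProduct_obs]
    simp [Transition.observe, LinExpr.value]
  obtain ⟨q, v⟩ := e
  obtain ⟨u', f', y', rfl⟩ := obs_surjective v
  simp only [Transition.Step, Fin.forall_fin_add, h1, obs_inl, obs_inr_castAdd, obs_inr_natAdd,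
    Fin.forall_fin_two, h2, h3, Matrix.cons_val_zero, Matrix.cons_val_one]
  constructor
  · rintro ⟨h1, h2, h3, h4, h5, rfl, rfl⟩
    exact ⟨q, u', rfl, h1, h2, h3, h4, h5⟩
  · rintro ⟨q', u'', h, h1, h2, h3, h4, h5⟩
    obtain ⟨rfl, h⟩ := Prod.ext_iff.1 h
    obtain ⟨rfl, rfl, rfl⟩ := obs_injective h
    exact ⟨h1, h2, h3, h4, h5, rfl, rfl⟩

/-- Adds two data variables, in which after each letter the output before that letter is found:
whether there is one, and its value. The output is a combination of these. -/
def observe (A : RAQ) (cf cy : ℚ) : RAQ where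
  k := A.k
  l := A.l + 2
  n := A.n
  q₀ := A.q₀
  u₀ := obs A.u₀ 0 0
  δ := A.δ.map fun t => t.observe (A.ζ t.src)
  ζ _ := some ⟨obs 0 cf cy, 0⟩

variable {A : RAQ} {cf cy : ℚ}

theorem mem_observe_iff {x : Transition A.k (A.l + 2) A.n} :
    x ∈ (observe A cf cy).δ ↔ ∃ t ∈ A.δ, x = t.observe (A.ζ t.src) := by
  change x ∈ (A.δ.map fun t => t.observe (A.ζ t.src) : List (Transition _ _ _)) ↔ _
  simp only [List.mem_map, eq_comm]

theorem next_observe_iff {d f y : ℚ} {p : Fin A.n} {u : Vec A.k A.l}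
    {e : (observe A cf cy).Config} : Next (observe A cf cy).δ d (p, obs u f y) e ↔
      ∃ q u', e = (q, obs u' (flag (A.ζ p)) ((emit (A.ζ p)).value u)) ∧
        Next A.δ d (p, u) (q, u') := by
  constructor
  · rintro ⟨x, hx, h⟩
    obtain ⟨t, ht, rfl⟩ := mem_observe_iff.1 hx
    obtain ⟨q, u', he, h⟩ := Transition.step_observe_iff.1 h
    obtain rfl : p = t.src := h.1
    exact ⟨q, u', he, t, ht, h⟩
  · rintro ⟨q, u', rfl, t, ht, h⟩
    obtain rfl : p = t.src := h.1
    exact ⟨_, mem_observe_iff.2 ⟨t, ht, rfl⟩, Transition.step_observe_iff.2 ⟨q, u', rfl, h⟩⟩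

theorem det_observe (h : Det A.δ) : Det (observe A cf cy).δ := by
  intro x hx y hy hne
  obtain ⟨t, ht, rfl⟩ := mem_observe_iff.1 hx
  obtain ⟨r, hr, rfl⟩ := mem_observe_iff.1 hy
  exact h t ht r hr fun e => hne (by rw [e])

theorem total_observe (h : Total A.δ) : Total (observe A cf cy).δ := by
  rintro d ⟨p, v⟩
  obtain ⟨u, f, y, rfl⟩ := obs_surjective v
  obtain ⟨⟨q, u'⟩, h⟩ := h d (p, u)
  exact ⟨_, next_observe_iff.2 ⟨q, u', rfl, h⟩⟩

/-- What the new variables record about a word. -/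
def Recorded (A : RAQ) (w : List ℚ) (f y : ℚ) : Prop :=
  (w = [] ∧ f = 0 ∧ y = 0) ∨ ∃ w' d, w = w' ++ [d] ∧
    (f = 1 ∧ A.outputs w' = {y} ∨ f = 0 ∧ y = 0 ∧ A.outputs w' = ∅)

theorem valueSet_eq (o : Option (LinExpr k l)) (u : Vec k l) :
    flag o = 1 ∧ RAQ.valueSet o u = {(emit o).value u} ∨
      flag o = 0 ∧ (emit o).value u = 0 ∧ RAQ.valueSet o u = ∅ := by
  cases o with
  | none => right; simp [flag, emit, RAQ.valueSet, LinExpr.value]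
  | some g =>
    left
    refine ⟨by simp [flag], ?_⟩
    ext r
    simp [emit, RAQ.valueSet]

/-- A transition stores the output at its source, so what is found after `w ++ [d]` concerns `w`.
The empty word has no predecessor and leaves the initial zeros. -/
theorem exists_of_run_observe (hA : Det A.δ) {w : List ℚ} {e : (observe A cf cy).Config}
    (h : (observe A cf cy).Run (observe A cf cy).initial w e) :
    ∃ p u f y, e = (p, obs u f y) ∧ A.Run A.initial w (p, u) ∧ Recorded A w f y := by
  induction w using List.reverseRecOn generalizing e with
  | nil =>
    exact ⟨A.q₀, A.u₀, 0, 0, (RAQ.run_nil_iff.1 h).symm, .nil _, .inl ⟨rfl, rfl, rfl⟩⟩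
  | append_singleton w d ih =>
    obtain ⟨c, h, hn⟩ := RAQ.run_concat_iff.1 h
    obtain ⟨p, u, f, y, rfl, hr, -⟩ := ih h
    obtain ⟨q, u', rfl, hn'⟩ := next_observe_iff.1 hn
    refine ⟨_, _, _, _, rfl, RAQ.run_concat_iff.2 ⟨_, hr, hn'⟩, .inr ⟨w, d, rfl, ?_⟩⟩
    rw [RAQ.outputs_eq hA hr]
    exact valueSet_eq _ _

theorem run_observe (hA : Det A.δ) {w : List ℚ} {p : Fin A.n} {u : Vec A.k A.l} {f y : ℚ}
    (h : (observe A cf cy).Run (observe A cf cy).initial w (p, obs u f y)) :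
    A.Run A.initial w (p, u) ∧ Recorded A w f y := by
  obtain ⟨p', u', f', y', he, hr, hw⟩ := exists_of_run_observe hA h
  obtain ⟨rfl, he⟩ := Prod.ext_iff.1 he
  obtain ⟨rfl, rfl, rfl⟩ := obs_injective he
  exact ⟨hr, hw⟩

/-- A total automaton that records the outputs of `A`. -/
def record (A : RAQ) (cf cy : ℚ) : RAQ := observe (complete A) cf cy

theorem det_record (hA : Det A.δ) : Det (record A cf cy).δ := det_observe (det_complete hA)

theorem total_record : Total (record A cf cy).δ := total_observe total_complete

theorem recorded_complete {w : List ℚ} {f y : ℚ} : Recorded (complete A) w f y ↔ Recorded A w f y := by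
  simp only [Recorded, outputs_complete]

theorem recorded_of_run (hA : Det A.δ) {w : List ℚ} {p : Fin (A.n + 1)} {u : Vec A.k A.l} {f y : ℚ}
    (h : (record A cf cy).Run (record A cf cy).initial w (p, obs u f y)) : Recorded A w f y :=
  recorded_complete.1 (run_observe (det_complete hA) h).2

/-- Because of the sink, every word has a run here, even where `A` itself blocks. -/
theorem exists_run_record (hA : Det A.δ) (w : List ℚ) : ∃ p u f y,
    (record A cf cy).Run (record A cf cy).initial w (p, obs u f y) ∧ Recorded A w f y := by
  obtain ⟨⟨p, v⟩, h⟩ := RAQ.exists_run (total_record (A := A) (cf := cf) (cy := cy)) _ w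
  obtain ⟨u, f, y, rfl⟩ := obs_surjective v
  exact ⟨p, u, f, y, h, recorded_of_run hA h⟩

theorem Recorded.unique {w : List ℚ} {f y f' y' : ℚ} (h : Recorded A w f y)
    (h' : Recorded A w f' y') : f = f' ∧ y = y' := by
  rcases h with ⟨rfl, rfl, rfl⟩ | ⟨v, d, rfl, h⟩
  · rcases h' with ⟨-, rfl, rfl⟩ | ⟨v, d, h, -⟩
    · exact ⟨rfl, rfl⟩
    · simp at h
  · rcases h' with ⟨h, -, -⟩ | ⟨v', d', e, h'⟩
    · simp at h
    · obtain ⟨rfl, -⟩ := List.append_inj' e rfl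
      rcases h with ⟨rfl, h⟩ | ⟨rfl, rfl, h⟩ <;> rcases h' with ⟨rfl, h'⟩ | ⟨rfl, rfl, h'⟩
      · exact ⟨rfl, by simpa using h.symm.trans h'⟩
      · simp [h'] at h
      · simp [h] at h'
      · exact ⟨rfl, rfl⟩

theorem exists_recorded (hA : Det A.δ) (w : List ℚ) : ∃ f y, Recorded A w f y := by
  obtain ⟨p, u, f, y, -, h⟩ := exists_run_record (cf := 0) (cy := 0) hA w
  exact ⟨f, y, h⟩

theorem exists_outputs_not_subset_iff (hA : Det A.δ) : (∃ w, ¬ A.outputs w ⊆ {0}) ↔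
    ∃ w f y, Recorded A w f y ∧ y ≠ 0 := by
  constructor
  · rintro ⟨w, hw⟩
    -- One arbitrary further letter makes up for the delay of the recording.
    obtain ⟨f, y, h⟩ := exists_recorded hA (w ++ [0])
    refine ⟨_, f, y, h, ?_⟩
    rintro rfl
    rcases h with ⟨h, -⟩ | ⟨v, d, e, h⟩
    · simp at h
    · obtain ⟨rfl, -⟩ := List.append_inj' e rfl
      rcases h with ⟨-, h⟩ | ⟨-, -, h⟩ <;> simp [h] at hw
  · rintro ⟨w, f, y, h, hy⟩
    rcases h with ⟨-, -, h⟩ | ⟨v, d, rfl, h⟩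
    · exact absurd h hy
    · rcases h with ⟨-, h⟩ | ⟨-, h, -⟩
      · exact ⟨v, by simpa [h] using hy⟩
      · exact absurd h hy

/-- The flag is needed as well as the value: without it, having no output could not be distinguished
from the output 0. -/
theorem outputs_eq_iff {A' : RAQ} (hA : Det A.δ) (hA' : Det A'.δ) :
    (∀ w, A.outputs w = A'.outputs w) ↔
      ∀ w f y f' y', Recorded A w f y → Recorded A' w f' y' → f = f' ∧ y = y' := by
  constructor
  · intro h w f y f' y' h1 h2
    refine Recorded.unique h1 ?_
    simpa only [Recorded, h] using h2
  · intro h w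
    obtain ⟨f, y, h1⟩ := exists_recorded hA (w ++ [0])
    obtain ⟨f', y', h2⟩ := exists_recorded hA' (w ++ [0])
    obtain ⟨rfl, rfl⟩ := h _ _ _ _ _ h1 h2
    rcases h1 with ⟨h, -⟩ | ⟨v, d, e, h1⟩
    · simp at h
    obtain ⟨rfl, -⟩ := List.append_inj' e rfl
    rcases h2 with ⟨h, -⟩ | ⟨v', d', e, h2⟩
    · simp at h
    obtain ⟨rfl, -⟩ := List.append_inj' e rfl
    rcases h1 with ⟨rfl, h1⟩ | ⟨rfl, -, h1⟩ <;> rcases h2 with ⟨hh, h2⟩ | ⟨hh, -, h2⟩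
    · rw [h1, h2]
    · norm_num at hh
    · norm_num at hh
    · rw [h1, h2]

end Observe
end RegAut

namespace RegAut

/-! ## Equivalence as a non-zero problem -/

/-- An automaton whose outputs are the differences of the recorded outputs. -/
def difference (A A' : RAQ) (cf cy : ℚ) : RAQ := sync (record A cf cy) (record A' (-cf) (-cy)) []

theorem det_difference {A A' : RAQ} {cf cy : ℚ} (hA : Det A.δ) (hA' : Det A'.δ) :
    Det (difference A A' cf cy).δ :=
  det_sync (det_record hA) (det_record hA') (fun _ h => absurd h List.not_mem_nil)
    fun _ _ _ h => absurd h List.not_mem_nil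

/-- Both factors are total, so every word has a run in the product. The second factor has the
negated coefficients, and the constant that the product drops is 0. -/
theorem mem_outputs_difference {A A' : RAQ} {cf cy : ℚ} (hA : Det A.δ) (hA' : Det A'.δ)
    {w : List ℚ} {r : ℚ} : r ∈ (difference A A' cf cy).outputs w ↔ ∃ f y f' y', Recorded A w f y ∧
      Recorded A' w f' y' ∧ r = cf * (f - f') + cy * (y - y') := by
  have hv (c : (record A cf cy).Config) (c' : (record A' (-cf) (-cy)).Config) (u : Vec A.k A.l)
      (u' : Vec A'.k A'.l) (f y f' y' : ℚ) (hc : c.2 = obs u f y) (hc' : c'.2 = obs u' f' y') :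
      r ∈ RAQ.valueSet ((difference A A' cf cy).ζ (joinConfig c c').1) (joinConfig c c').2 ↔
        r = cf * (f - f') + cy * (y - y') := by
    have h1 : (obs 0 cf cy : Vec A.k (A.l + 2)) ⬝ᵥ c.2 = cf * f + cy * y := by
      rw [hc, obs_dotProduct_obs, zero_dotProduct, zero_add]
    have h2 : (obs 0 (-cf) (-cy) : Vec A'.k (A'.l + 2)) ⬝ᵥ c'.2 = -cf * f' + -cy * y' := by
      rw [hc', obs_dotProduct_obs, zero_dotProduct, zero_add]
    have e : cf * (f - f') + cy * (y - y') = cf * f + cy * y + 0 + (-cf * f' + -cy * y') := by ring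
    rw [e, ← h1, ← h2]
    refine (Set.ext_iff.1 (valueSet_sync c c') r).trans ?_
    constructor
    · rintro ⟨g, hg, g', hg', hr⟩
      obtain rfl := Option.some_injective _ hg
      obtain rfl := Option.some_injective _ hg'
      exact hr
    · exact fun hr => ⟨_, rfl, _, rfl, hr⟩
  rw [RAQ.mem_outputs]
  constructor
  · rintro ⟨c, h, hr⟩
    obtain ⟨⟨p, v⟩, ⟨p', v'⟩, rfl, h1, h2⟩ :=
      (run_sync_nil_iff (A := record A cf cy) (A' := record A' (-cf) (-cy))
        (c := (record A cf cy).initial) (c' := (record A' (-cf) (-cy)).initial)).1 h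
    obtain ⟨u, f, y, rfl⟩ := obs_surjective v
    obtain ⟨u', f', y', rfl⟩ := obs_surjective v'
    exact ⟨f, y, f', y', recorded_of_run hA h1, recorded_of_run hA' h2,
      (hv _ _ _ _ _ _ _ _ rfl rfl).1 hr⟩
  · rintro ⟨f, y, f', y', h1, h2, hr⟩
    obtain ⟨p, u, f₁, y₁, hr1, h1'⟩ := exists_run_record (cf := cf) (cy := cy) hA w
    obtain ⟨p', u', f₂, y₂, hr2, h2'⟩ := exists_run_record (cf := -cf) (cy := -cy) hA' w
    obtain ⟨rfl, rfl⟩ := h1.unique h1'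
    obtain ⟨rfl, rfl⟩ := h2.unique h2'
    exact ⟨_, run_sync_nil_iff.2 ⟨_, _, rfl, hr1, hr2⟩, (hv _ _ _ _ _ _ _ _ rfl rfl).2 hr⟩

/-- The coefficients `1 0` compare the flags and `0 1` the values; both differences must vanish on
all words. -/
theorem equivalence_holds_iff (a : equivalence.Instance) : equivalence.Holds a ↔
    ¬ ∃ b ∈ [(⟨difference a.1.1 a.2.1 1 0, det_difference a.1.2 a.2.2⟩ : DetRAQ),
      ⟨difference a.1.1 a.2.1 0 1, det_difference a.1.2 a.2.2⟩], nonZero.Holds b := by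
  obtain ⟨⟨A, hA⟩, A', hA'⟩ := a
  refine (outputs_eq_iff hA hA').trans ?_
  simp only [List.mem_cons, List.not_mem_nil, or_false, exists_eq_or_imp, exists_eq_left, nonZero,
    Set.subset_def, Set.mem_singleton_iff, mem_outputs_difference hA hA']
  constructor
  · rintro h (⟨w, hw⟩ | ⟨w, hw⟩) <;>
    · refine hw ?_
      rintro _ ⟨f, y, f', y', h1, h2, rfl⟩
      obtain ⟨rfl, rfl⟩ := h _ _ _ _ _ h1 h2
      ring
  · intro h w f y f' y' h1 h2
    push Not at h
    have e1 := h.1 w _ ⟨f, y, f', y', h1, h2, rfl⟩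
    have e2 := h.2 w _ ⟨f, y, f', y', h1, h2, rfl⟩
    exact ⟨by linarith, by linarith⟩

/-! ## Controllers with a single register -/

section Control

variable {m : ℕ}

/-- A transition of a controller, which has one control variable, without data variables. -/
def control (p : Fin m) (φ : Guard 1) (q : Fin m) (s : Option (Fin 1)) : Transition 1 0 m :=
  ⟨p, φ, q, fun _ => s, fun _ => 0, 0⟩

/-- The contents `z` of the register of a controller. -/
def reg (z : ℚ) : Vec 1 0 := fun _ => z

/-- The input is equal to the contents of the register. -/
def Guard.same : Guard 1 := .conj (.le none (some 0)) (.le (some 0) none)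

/-- The guard that always holds. -/
def Guard.any : Guard 1 := .le none none

theorem exists_eq_reg (v : Vec 1 0) : ∃ z, v = reg z := by
  refine ⟨v (.inl 0), funext fun i => ?_⟩
  rcases i with i | i
  · rw [Subsingleton.elim i 0]; rfl
  · exact i.elim0

theorem step_control_iff {p q r : Fin m} {φ : Guard 1} {s : Option (Fin 1)} {d z : ℚ}
    {e : Fin m × Vec 1 0} : (control p φ q s).Step d (r, reg z) e ↔
      r = p ∧ φ.Sat (ext (fun _ => z) d) ∧ e = (q, reg (ext (fun _ => z) d s)) := by
  obtain ⟨e, v⟩ := e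
  obtain ⟨z', rfl⟩ := exists_eq_reg v
  constructor
  · rintro ⟨h1, h2, h3, h4, -⟩
    have h4 := h4 0
    simp only [control, reg] at h1 h2 h3 h4
    exact ⟨h1, h3, by rw [h2, h4]⟩
  · rintro ⟨h1, h3, h⟩
    obtain ⟨rfl, h⟩ := Prod.ext_iff.1 h
    have h4 : z' = ext (fun _ => z) d s := congrFun h (.inl 0)
    exact ⟨h1, rfl, h3, fun _ => h4, fun j => j.elim0⟩

theorem add_zero_dotProduct_reg (r z : ℚ) : r + (0 : Vec 1 0) ⬝ᵥ reg z = r := by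
  rw [zero_dotProduct, add_zero]

theorem Guard.sat_same {s : Option (Fin 1) → ℚ} : Guard.same.Sat s ↔ s none = s (some 0) := by
  simp only [Guard.same, Guard.Sat, le_antisymm_iff]

theorem Guard.sat_any {s : Option (Fin 1) → ℚ} : Guard.any.Sat s ↔ True := by
  simp only [Guard.any, Guard.Sat, le_refl]

end Control

/-! ## Commutativity as equivalence -/

/-- The transitions of `swapper b` that forward a letter. -/
def swapperSteps (b : Bool) : List (Transition 1 0 3) :=
  if b then [control 0 .any 1 none, control 1 (.neg .same) 2 (some 0)]
    else [control 1 .same 0 (some 0), control 2 .same 0 (some 0), control 1 (.neg .same) 2 (some 0)]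

/-- The transitions of `swapper b` that do not forward a letter. -/
def swapperIdle (b : Bool) : List (Transition 1 0 3) :=
  if b then [control 1 .same 0 (some 0), control 2 .same 0 (some 0)] else [control 0 .any 1 none]

/-- The controller for swaps of letters, which reads blocks `d d` and `d d' d`. The first letter of
a block is forwarded at once if `b` holds, and at the end of the block otherwise. -/
def swapper (b : Bool) : RAQ where
  k := 1
  l := 0
  n := 3
  q₀ := 0
  u₀ := reg 0
  δ := swapperSteps b
  ζ p := if p = 0 then some ⟨0, 0⟩ else none

/-- Letters of blocks are forwarded to `A`. -/
def swapped (A : RAQ) (b : Bool) : RAQ := sync A (swapper b) (swapperIdle b)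

/-- Determinism of the product requires that forwarding and non-forwarding transitions also exclude
each other; treating the union at once covers all hypotheses of `det_sync`. -/
theorem det_swapper_union (b : Bool) : Det (swapperSteps b ++ swapperIdle b) := by
  intro t ht t' ht' hne hs
  rintro ⟨s, h1, h2⟩
  cases b
  · simp only [swapperSteps, swapperIdle, if_false, Bool.false_eq_true, List.cons_append,
      List.nil_append, List.mem_cons, List.not_mem_nil, or_false] at ht ht'
    rcases ht with rfl | rfl | rfl | rfl <;> rcases ht' with rfl | rfl | rfl | rfl <;>
      first
      | exact hne rfl
      | exact h1 h2
      | exact h2 h1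
      | exact absurd hs (by decide)
  · simp only [swapperSteps, swapperIdle, if_true, List.cons_append,
      List.nil_append, List.mem_cons, List.not_mem_nil, or_false] at ht ht'
    rcases ht with rfl | rfl | rfl | rfl <;> rcases ht' with rfl | rfl | rfl | rfl <;>
      first
      | exact hne rfl
      | exact h1 h2
      | exact h2 h1
      | exact absurd hs (by decide)

/-- `Det` concerns distinct transitions only. Transitions carry rational data, so they are told
apart by their source and target, on which `decide` works. -/
theorem swapper_disjoint {b : Bool} {t t' : Transition 1 0 3} (ht : t ∈ swapperSteps b)
    (ht' : t' ∈ swapperIdle b) : t ≠ t' := by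
  have key (b : Bool) : ∀ p : Fin 3 × Fin 3, p ∈ (swapperSteps b).map (fun t => (t.src, t.tgt)) →
      p ∉ (swapperIdle b).map fun t => (t.src, t.tgt) := by
    cases b <;> decide
  rintro rfl
  exact key b _ (List.mem_map_of_mem ht) (List.mem_map_of_mem ht')

theorem det_swapped {A : RAQ} (hA : Det A.δ) (b : Bool) : Det (swapped A b).δ :=
  det_sync hA (fun t ht t' ht' => det_swapper_union b t (List.mem_append_left _ ht) t'
      (List.mem_append_left _ ht'))
    (fun t ht t' ht' => det_swapper_union b t (List.mem_append_right _ ht) t'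
      (List.mem_append_right _ ht'))
    fun t ht t' ht' => det_swapper_union b t (List.mem_append_left _ ht) t'
      (List.mem_append_right _ ht') (swapper_disjoint ht ht')

/-- A step by a letter that is forwarded if `b` holds. -/
def Move (A : RAQ) (b : Bool) (d : ℚ) (c c' : A.Config) : Prop :=
  if b then Next A.δ d c c' else c' = c

section Swapped

variable {A : RAQ} {b : Bool} {c c' : A.Config} {d z : ℚ} {e : (swapped A b).Config}

theorem next_swapper_iff (p : Fin 3) (y : Fin 3 × Vec 1 0) :
    Next (swapperSteps b) d (p, reg z) y ↔
      (b = true ∧ p = 0 ∧ y = (1, reg d)) ∨ (b = false ∧ p = 1 ∧ d = z ∧ y = (0, reg z)) ∨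
      (b = false ∧ p = 2 ∧ d = z ∧ y = (0, reg z)) ∨ (p = 1 ∧ d ≠ z ∧ y = (2, reg z)) := by
  cases b <;>
    simp [Next, swapperSteps, step_control_iff, Guard.sat_any, Guard.sat_same, Guard.Sat, ext]

theorem next_swapperIdle_iff (p : Fin 3) (y : Fin 3 × Vec 1 0) :
    Next (swapperIdle b) d (p, reg z) y ↔
      (b = false ∧ p = 0 ∧ y = (1, reg d)) ∨ (b = true ∧ p = 1 ∧ d = z ∧ y = (0, reg z)) ∨
      (b = true ∧ p = 2 ∧ d = z ∧ y = (0, reg z)) := by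
  cases b <;>
    simp [Next, swapperIdle, step_control_iff, Guard.sat_any, Guard.sat_same, ext]

theorem next_swapped_iff (p : Fin 3) :
    Next (swapped A b).δ d (joinConfig c ((p, reg z) : Fin 3 × Vec 1 0)) e ↔
      ∃ (x : A.Config) (y : Fin 3 × Vec 1 0), e = joinConfig x y ∧
        (Next A.δ d c x ∧ Next (swapperSteps b) d (p, reg z) y ∨
          x = c ∧ Next (swapperIdle b) d (p, reg z) y) :=
  next_sync_iff (A' := swapper b) (I := swapperIdle b)

theorem next_swapped_zero_iff :
    Next (swapped A b).δ d (joinConfig c ((0, reg z) : Fin 3 × Vec 1 0)) e ↔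
      ∃ x, e = joinConfig x ((1, reg d) : Fin 3 × Vec 1 0) ∧ Move A b d c x := by
  simp only [next_swapped_iff, next_swapper_iff, next_swapperIdle_iff]
  cases b <;> simp [Move]

theorem next_swapped_one_iff :
    Next (swapped A b).δ d (joinConfig c ((1, reg z) : Fin 3 × Vec 1 0)) e ↔
      (d = z ∧ ∃ x, e = joinConfig x ((0, reg z) : Fin 3 × Vec 1 0) ∧ Move A (!b) d c x) ∨
      (d ≠ z ∧ ∃ x, e = joinConfig x ((2, reg z) : Fin 3 × Vec 1 0) ∧ Next A.δ d c x) := by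
  simp only [next_swapped_iff, next_swapper_iff, next_swapperIdle_iff]
  by_cases hd : d = z <;> cases b <;> simp [Move, hd]

theorem next_swapped_two_iff :
    Next (swapped A b).δ d (joinConfig c ((2, reg z) : Fin 3 × Vec 1 0)) e ↔
      d = z ∧ ∃ x, e = joinConfig x ((0, reg z) : Fin 3 × Vec 1 0) ∧ Move A (!b) d c x := by
  simp only [next_swapped_iff, next_swapper_iff, next_swapperIdle_iff]
  by_cases hd : d = z <;> cases b <;> simp [Move, hd]

/-- The first word is a sequence of blocks, and the others are the words that are forwarded. -/
inductive Blocks : List ℚ → List ℚ → List ℚ → Prop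
  | nil : Blocks [] [] []
  | single (d : ℚ) {w v v' : List ℚ} (h : Blocks w v v') : Blocks (d :: d :: w) (d :: v) (d :: v')
  | swap {d d' : ℚ} (hd : d' ≠ d) {w v v' : List ℚ} (h : Blocks w v v') :
      Blocks (d :: d' :: d :: w) (d :: d' :: v) (d' :: d :: v')

theorem run_swapped_of_blocks {w v v' : List ℚ} (hw : Blocks w v v')
    (h : A.Run c (if b then v else v') c') (z : ℚ) :
    ∃ z', (swapped A b).Run (joinConfig c ((0, reg z) : Fin 3 × Vec 1 0)) w
      (joinConfig c' ((0, reg z') : Fin 3 × Vec 1 0)) := by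
  induction hw generalizing c z with
  | nil =>
    simp only [ite_self] at h
    obtain rfl := RAQ.run_nil_iff.1 h
    exact ⟨z, .nil _⟩
  | single d _ ih =>
    cases b
    · obtain ⟨x, hx, h⟩ := RAQ.run_cons_iff.1 h
      obtain ⟨z', hr⟩ := ih h d
      exact ⟨z', RAQ.run_cons_iff.2 ⟨_, next_swapped_zero_iff.2 ⟨_, rfl, rfl⟩,
        RAQ.run_cons_iff.2 ⟨_, next_swapped_one_iff.2 (.inl ⟨rfl, x, rfl, hx⟩), hr⟩⟩⟩
    · obtain ⟨x, hx, h⟩ := RAQ.run_cons_iff.1 h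
      obtain ⟨z', hr⟩ := ih h d
      exact ⟨z', RAQ.run_cons_iff.2 ⟨_, next_swapped_zero_iff.2 ⟨_, rfl, hx⟩,
        RAQ.run_cons_iff.2 ⟨_, next_swapped_one_iff.2 (.inl ⟨rfl, x, rfl, rfl⟩), hr⟩⟩⟩
  | @swap d d' hd _ _ _ _ ih =>
    cases b
    · obtain ⟨x, hx, h⟩ := RAQ.run_cons_iff.1 h
      obtain ⟨y, hy, h⟩ := RAQ.run_cons_iff.1 h
      obtain ⟨z', hr⟩ := ih h d
      exact ⟨z', RAQ.run_cons_iff.2 ⟨_, next_swapped_zero_iff.2 ⟨_, rfl, rfl⟩,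
        RAQ.run_cons_iff.2 ⟨_, next_swapped_one_iff.2 (.inr ⟨hd, x, rfl, hx⟩),
          RAQ.run_cons_iff.2 ⟨_, next_swapped_two_iff.2 ⟨rfl, y, rfl, hy⟩, hr⟩⟩⟩⟩
    · obtain ⟨x, hx, h⟩ := RAQ.run_cons_iff.1 h
      obtain ⟨y, hy, h⟩ := RAQ.run_cons_iff.1 h
      obtain ⟨z', hr⟩ := ih h d
      exact ⟨z', RAQ.run_cons_iff.2 ⟨_, next_swapped_zero_iff.2 ⟨_, rfl, hx⟩,
        RAQ.run_cons_iff.2 ⟨_, next_swapped_one_iff.2 (.inr ⟨hd, y, rfl, hy⟩),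
          RAQ.run_cons_iff.2 ⟨_, next_swapped_two_iff.2 ⟨rfl, y, rfl, rfl⟩, hr⟩⟩⟩⟩

/-- The input is consumed block by block: its second letter shows whether a block has length two or
three. In the middle of a block the controller is in state 1 or 2, hence not final. -/
theorem exists_blocks_of_run : ∀ (w : List ℚ) (c : A.Config) (z z' : ℚ),
    (swapped A b).Run (joinConfig c ((0, reg z) : Fin 3 × Vec 1 0)) w
      (joinConfig c' ((0, reg z') : Fin 3 × Vec 1 0)) →
    ∃ v v', Blocks w v v' ∧ A.Run c (if b then v else v') c'
  | [], c, z, z', h => by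
    obtain ⟨rfl, -⟩ := joinConfig_injective (RAQ.run_nil_iff.1 h)
    exact ⟨[], [], .nil, by simpa using .nil _⟩
  | [d], c, z, z', h => by
    obtain ⟨x, hx, h⟩ := RAQ.run_cons_iff.1 h
    obtain ⟨x, rfl, -⟩ := next_swapped_zero_iff.1 hx
    obtain ⟨-, h⟩ := joinConfig_injective (RAQ.run_nil_iff.1 h)
    exact absurd (show (1 : Fin 3) = 0 from congrArg Prod.fst h) (by decide)
  | d :: d' :: w, c, z, z', h => by
    obtain ⟨_, hx₀, h₁⟩ := RAQ.run_cons_iff.1 h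
    obtain ⟨x, rfl, hx⟩ := next_swapped_zero_iff.1 hx₀
    obtain ⟨_, hy₀, h₂⟩ := RAQ.run_cons_iff.1 h₁
    rcases next_swapped_one_iff.1 hy₀ with ⟨rfl, y, rfl, hy⟩ | ⟨hd, y, rfl, hy⟩
    · obtain ⟨v, v', hv, hr⟩ := exists_blocks_of_run w _ _ _ h₂
      refine ⟨_, _, .single _ hv, ?_⟩
      cases b
      · obtain rfl : x = c := hx
        exact RAQ.run_cons_iff.2 ⟨_, hy, hr⟩
      · obtain rfl : y = x := hy
        exact RAQ.run_cons_iff.2 ⟨_, hx, hr⟩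
    · cases w with
      | nil =>
        obtain ⟨-, h⟩ := joinConfig_injective (RAQ.run_nil_iff.1 h₂)
        exact absurd (show (2 : Fin 3) = 0 from congrArg Prod.fst h) (by decide)
      | cons d'' w =>
        obtain ⟨_, hr₀, h₃⟩ := RAQ.run_cons_iff.1 h₂
        obtain ⟨rfl, r, rfl, hr⟩ := next_swapped_two_iff.1 hr₀
        obtain ⟨v, v', hv, hr'⟩ := exists_blocks_of_run w _ _ _ h₃
        refine ⟨_, _, .swap hd hv, ?_⟩
        cases b
        · obtain rfl : x = c := hx
          exact RAQ.run_cons_iff.2 ⟨_, hy, RAQ.run_cons_iff.2 ⟨_, hr, hr'⟩⟩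
        · obtain rfl : r = y := hr
          exact RAQ.run_cons_iff.2 ⟨_, hx, RAQ.run_cons_iff.2 ⟨_, hy, hr'⟩⟩

theorem mem_outputs_swapped {w : List ℚ} {r : ℚ} : r ∈ (swapped A b).outputs w ↔
    ∃ v v', Blocks w v v' ∧ r ∈ A.outputs (if b then v else v') := by
  constructor
  · rintro ⟨c, h, g, hg, rfl⟩
    obtain ⟨c, ⟨p, u⟩, rfl⟩ := joinConfig_surjective (n := A.n) (k := A.k) (l := A.l) c
    obtain ⟨z, rfl⟩ := exists_eq_reg u
    obtain ⟨g₁, h1, g₂, h2, hr⟩ := (Set.ext_iff.1 (valueSet_sync (A' := swapper b)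
      (I := swapperIdle b) c (p, reg z)) _).1 ⟨g, hg, rfl⟩
    have key : ∀ (p : Fin 3) (g : LinExpr 1 0),
        (if p = 0 then some (⟨0, 0⟩ : LinExpr 1 0) else none) = some g → p = 0 ∧ g = ⟨0, 0⟩ := by
      intro p g h
      split_ifs at h with hp
      exact ⟨hp, (Option.some_injective _ h).symm⟩
    obtain ⟨hp, hg₂⟩ := key p g₂ h2
    subst hp hg₂
    obtain ⟨v, v', hv, hrun⟩ := exists_blocks_of_run w A.initial 0 z h
    exact ⟨v, v', hv, c, hrun, g₁, h1, hr.trans (add_zero_dotProduct_reg _ _)⟩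
  · rintro ⟨v, v', hv, c, h, g, hg, rfl⟩
    obtain ⟨z', hr⟩ := run_swapped_of_blocks hv h 0
    exact ⟨_, hr, (Set.ext_iff.1 (valueSet_sync (A' := swapper b) (I := swapperIdle b) c
      ((0, reg z') : Fin 3 × Vec 1 0)) _).2
        ⟨g, hg, (⟨0, 0⟩ : LinExpr 1 0), rfl, (add_zero_dotProduct_reg _ _).symm⟩⟩

end Swapped

theorem Blocks.perm {w v v' : List ℚ} (h : Blocks w v v') : v'.Perm v := by
  induction h with
  | nil => exact .nil
  | single d _ ih => exact ih.cons d
  | swap _ _ ih => exact (List.Perm.swap _ _ _).trans ((ih.cons _).cons _)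

/-- The side condition `d' ≠ d` makes parsing into blocks deterministic, so both swapped automata
derive their words from the same decomposition of the input. -/
theorem Blocks.unique {w v v' u u' : List ℚ} (h : Blocks w v v') (h' : Blocks w u u') :
    v = u ∧ v' = u' := by
  induction h generalizing u u' with
  | nil => cases h'; exact ⟨rfl, rfl⟩
  | single d _ ih =>
    cases h' with
    | single _ h' => obtain ⟨rfl, rfl⟩ := ih h'; exact ⟨rfl, rfl⟩
    | swap hd _ => exact absurd rfl hd
  | swap hd _ ih =>
    cases h' with
    | single _ h' => exact absurd rfl hd
    | swap _ h' => obtain ⟨rfl, rfl⟩ := ih h'; exact ⟨rfl, rfl⟩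

theorem exists_blocks_append {w v v' : List ℚ} (h : Blocks w v v') (u : List ℚ) :
    ∃ w', Blocks w' (u ++ v) (u ++ v') := by
  induction u with
  | nil => exact ⟨w, h⟩
  | cons d u ih =>
    obtain ⟨w', h'⟩ := ih
    exact ⟨_, h'.single d⟩

/-- The prefix is arbitrary so that the induction can pass over common first letters by moving them
into it. -/
theorem outputs_append_perm {A : RAQ}
    (h : ∀ u d d' v, A.outputs (u ++ d :: d' :: v) = A.outputs (u ++ d' :: d :: v))
    {w w' : List ℚ} (hw : w'.Perm w) (u : List ℚ) : A.outputs (u ++ w) = A.outputs (u ++ w') := by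
  induction hw generalizing u with
  | nil => rfl
  | cons d _ ih => simpa using ih (u ++ [d])
  | swap d d' v => exact h u d d' v
  | trans _ _ ih ih' => exact (ih' u).trans (ih u)

theorem commutativity_holds_iff (a : commutativity.Instance) : commutativity.Holds a ↔
    ∃ b ∈ [((⟨swapped a.1 true, det_swapped a.2 true⟩, ⟨swapped a.1 false, det_swapped a.2 false⟩) :
      DetRAQ × DetRAQ)], equivalence.Holds b := by
  obtain ⟨A, hA⟩ := a
  constructor
  · refine fun h => ⟨_, List.mem_singleton_self _, fun w => ?_⟩
    ext r
    rw [mem_outputs_swapped, mem_outputs_swapped]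
    refine exists_congr fun v => exists_congr fun v' => and_congr_right fun hv => ?_
    exact Set.ext_iff.1 (h v v' hv.perm) r
  · rintro ⟨b, hb, h⟩ w w' hw
    obtain rfl := List.mem_singleton.1 hb
    refine outputs_append_perm (fun u d d' v => ?_) hw []
    -- Equal neighbours have no block of their own, but their swap changes nothing.
    by_cases hd : d' = d
    · rw [hd]
    · obtain ⟨x, hx⟩ := exists_blocks_append .nil v
      obtain ⟨y, hy⟩ := exists_blocks_append (hx.swap hd) u
      rw [List.append_nil] at hy
      ext r
      have h1 := Set.ext_iff.1 (h y) r
      rw [mem_outputs_swapped, mem_outputs_swapped] at h1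
      constructor
      · intro hr
        obtain ⟨v₁, v₂, hv, hr⟩ := h1.1 ⟨_, _, hy, hr⟩
        obtain ⟨rfl, rfl⟩ := hy.unique hv
        exact hr
      · intro hr
        obtain ⟨v₁, v₂, hv, hr⟩ := h1.2 ⟨_, _, hy, hr⟩
        obtain ⟨rfl, rfl⟩ := hy.unique hv
        exact hr

/-! ## Non-zero as commutativity -/

/-- The transition of `selector` that forwards a letter. -/
def selectorSteps : List (Transition 1 0 4) := [control 2 .any 2 (some 0)]

/-- The transitions of `selector` that do not forward a letter. -/
def selectorIdle : List (Transition 1 0 4) :=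
  [control 0 .any 1 none, control 1 (.neg (.le none (some 0))) 2 (some 0),
    control 1 (.le none (some 0)) 3 (some 0), control 3 .any 3 (some 0)]

/-- The controller that skips two letters and then forwards the others if the first letter was
smaller than the second. -/
def selector : RAQ where
  k := 1
  l := 0
  n := 4
  q₀ := 0
  u₀ := reg 0
  δ := selectorSteps
  ζ _ := some ⟨0, 0⟩

/-- Letters are forwarded to the automaton that records the outputs of `A`. -/
def selected (A : RAQ) : RAQ := sync (record A 0 1) selector selectorIdle

theorem det_selector_union : Det (selectorSteps ++ selectorIdle) := by
  intro t ht t' ht' hne hs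
  rintro ⟨s, h1, h2⟩
  simp only [selectorSteps, selectorIdle, List.cons_append, List.nil_append, List.mem_cons,
    List.not_mem_nil, or_false] at ht ht'
  rcases ht with rfl | rfl | rfl | rfl | rfl <;> rcases ht' with rfl | rfl | rfl | rfl | rfl <;>
    first
    | exact hne rfl
    | exact h1 h2
    | exact h2 h1
    | exact absurd hs (by decide)

theorem det_selected {A : RAQ} (hA : Det A.δ) : Det (selected A).δ := by
  refine det_sync (det_record hA) (fun t ht t' ht' => det_selector_union t
    (List.mem_append_left _ ht) t' (List.mem_append_left _ ht'))
    (fun t ht t' ht' => det_selector_union t (List.mem_append_right _ ht) t'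
      (List.mem_append_right _ ht'))
    fun t ht t' ht' => det_selector_union t (List.mem_append_left _ ht) t'
      (List.mem_append_right _ ht') ?_
  have key : ∀ p : Fin 4 × Fin 4, p ∈ selectorSteps.map (fun t => (t.src, t.tgt)) →
      p ∉ selectorIdle.map fun t => (t.src, t.tgt) := by
    decide
  rintro rfl
  exact key _ (List.mem_map_of_mem ht) (List.mem_map_of_mem ht')

section Selected

variable {A : RAQ} {d z : ℚ}

theorem next_selector_iff (p : Fin 4) (y : Fin 4 × Vec 1 0) :
    Next selectorSteps d (p, reg z) y ↔ p = 2 ∧ y = (2, reg z) := by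
  simp [Next, selectorSteps, step_control_iff, Guard.sat_any, ext]

theorem next_selectorIdle_iff (p : Fin 4) (y : Fin 4 × Vec 1 0) :
    Next selectorIdle d (p, reg z) y ↔ p = 0 ∧ y = (1, reg d) ∨ p = 1 ∧ z < d ∧ y = (2, reg z) ∨
      p = 1 ∧ d ≤ z ∧ y = (3, reg z) ∨ p = 3 ∧ y = (3, reg z) := by
  simp [Next, selectorIdle, step_control_iff, Guard.sat_any, Guard.Sat, ext]

theorem total_selected : Total (selected A).δ := by
  have key : ∀ (d : ℚ) (c : Fin 4 × Vec 1 0),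
      ∃ c', Next selectorSteps d c c' ∨ Next selectorIdle d c c' := by
    rintro d ⟨p, v⟩
    obtain ⟨z, rfl⟩ := exists_eq_reg v
    simp only [next_selector_iff, next_selectorIdle_iff]
    have hp : p = 0 ∨ p = 1 ∨ p = 2 ∨ p = 3 := by revert p; decide
    rcases hp with rfl | rfl | rfl | rfl
    · exact ⟨_, .inr (.inl ⟨rfl, rfl⟩)⟩
    · rcases lt_or_ge z d with h | h
      · exact ⟨_, .inr (.inr (.inl ⟨rfl, h, rfl⟩))⟩
      · exact ⟨_, .inr (.inr (.inr (.inl ⟨rfl, h, rfl⟩)))⟩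
    · exact ⟨_, .inl ⟨rfl, rfl⟩⟩
    · exact ⟨_, .inr (.inr (.inr (.inr ⟨rfl, rfl⟩)))⟩
  exact total_sync (A' := selector) total_record key

theorem valueSet_selected (p : Fin (A.n + 1)) (u : Vec A.k A.l) (f y : ℚ) (c : selector.Config) :
    RAQ.valueSet ((selected A).ζ (joinConfig ((p, obs u f y) : (record A 0 1).Config) c).1)
      (joinConfig ((p, obs u f y) : (record A 0 1).Config) c).2 = {y} := by
  have h1 (v : Vec 1 0) : (obs 0 0 1 : Vec A.k (A.l + 2)) ⬝ᵥ obs u f y + 0 + (0 : Vec 1 0) ⬝ᵥ v =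
      y := by
    rw [obs_dotProduct_obs, zero_dotProduct, zero_dotProduct]; ring
  ext r
  refine (Set.ext_iff.1 (valueSet_sync (A' := selector) (I := selectorIdle)
    ((p, obs u f y) : (record A 0 1).Config) c) r).trans ?_
  constructor
  · rintro ⟨g, hg, g', hg', hr⟩
    obtain rfl := Option.some_injective _ hg
    obtain rfl := Option.some_injective _ hg'
    exact hr.trans (h1 _)
  · exact fun hr => ⟨_, rfl, _, rfl, hr.trans (h1 _).symm⟩

theorem run_selected_two {c c' : (record A 0 1).Config} {w : List ℚ}
    (h : (record A 0 1).Run c w c') : (selected A).Run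
      (joinConfig c ((2, reg z) : Fin 4 × Vec 1 0)) w
      (joinConfig c' ((2, reg z) : Fin 4 × Vec 1 0)) := by
  induction w generalizing c with
  | nil => rw [RAQ.run_nil_iff.1 h]; exact .nil _
  | cons d w ih =>
    obtain ⟨x, hx, h⟩ := RAQ.run_cons_iff.1 h
    exact RAQ.run_cons_iff.2 ⟨_, next_sync_iff.2 ⟨x, _, rfl,
      .inl ⟨hx, (next_selector_iff _ _).2 ⟨rfl, rfl⟩⟩⟩, ih h⟩

theorem run_selected_three (c : (record A 0 1).Config) (w : List ℚ) : (selected A).Run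
    (joinConfig c ((3, reg z) : Fin 4 × Vec 1 0)) w
    (joinConfig c ((3, reg z) : Fin 4 × Vec 1 0)) := by
  induction w with
  | nil => exact .nil _
  | cons d w ih =>
    exact RAQ.run_cons_iff.2 ⟨_, next_sync_iff.2 ⟨c, _, rfl,
      .inr ⟨rfl, (next_selectorIdle_iff _ _).2 (.inr (.inr (.inr ⟨rfl, rfl⟩)))⟩⟩, ih⟩

theorem next_selected_zero (c : (record A 0 1).Config) : Next (selected A).δ d
    (joinConfig c ((0, reg z) : Fin 4 × Vec 1 0)) (joinConfig c ((1, reg d) : Fin 4 × Vec 1 0)) :=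
  next_sync_iff.2 ⟨c, _, rfl, .inr ⟨rfl, (next_selectorIdle_iff _ _).2 (.inl ⟨rfl, rfl⟩)⟩⟩

theorem next_selected_one_lt (c : (record A 0 1).Config) (h : z < d) : Next (selected A).δ d
    (joinConfig c ((1, reg z) : Fin 4 × Vec 1 0)) (joinConfig c ((2, reg z) : Fin 4 × Vec 1 0)) :=
  next_sync_iff.2 ⟨c, _, rfl,
    .inr ⟨rfl, (next_selectorIdle_iff _ _).2 (.inr (.inl ⟨rfl, h, rfl⟩))⟩⟩

theorem next_selected_one_le (c : (record A 0 1).Config) (h : d ≤ z) : Next (selected A).δ d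
    (joinConfig c ((1, reg z) : Fin 4 × Vec 1 0)) (joinConfig c ((3, reg z) : Fin 4 × Vec 1 0)) :=
  next_sync_iff.2 ⟨c, _, rfl,
    .inr ⟨rfl, (next_selectorIdle_iff _ _).2 (.inr (.inr (.inl ⟨rfl, h, rfl⟩)))⟩⟩

end Selected

/-- If `y ≠ 0` is recorded on `w`, then `0 :: 1 :: w` yields `y`, while `1 :: 0 :: w` leaves the
initial zero in place. Conversely, if only zeros are recorded, totality gives exactly `{0}` on all
words, which is invariant under permutations. -/
theorem nonZero_holds_iff_selected (a : nonZero.Instance) : nonZero.Holds a ↔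
    ¬ ∃ b ∈ [(⟨selected a.1, det_selected a.2⟩ : DetRAQ)], commutativity.Holds b := by
  obtain ⟨A, hA⟩ := a
  refine (exists_outputs_not_subset_iff hA).trans ?_
  constructor
  · rintro ⟨w, f, y, hw, hy⟩ ⟨b, hb, hcomm⟩
    obtain rfl := List.mem_singleton.1 hb
    obtain ⟨p, u, f', y', hr, hw'⟩ := exists_run_record (cf := 0) (cy := 1) hA w
    obtain ⟨rfl, rfl⟩ := hw.unique hw'
    have h1 : (selected A).outputs (0 :: 1 :: w) = {y} := by
      refine (RAQ.outputs_eq (det_selected hA) (RAQ.run_cons_iff.2 ⟨_,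
        next_selected_zero (z := 0) (record A 0 1).initial,
        RAQ.run_cons_iff.2 ⟨_, next_selected_one_lt _ one_pos, run_selected_two hr⟩⟩)).trans ?_
      exact valueSet_selected _ _ _ _ _
    have h2 : (selected A).outputs (1 :: 0 :: w) = {0} := by
      refine (RAQ.outputs_eq (det_selected hA) (RAQ.run_cons_iff.2 ⟨_,
        next_selected_zero (z := 0) (record A 0 1).initial,
        RAQ.run_cons_iff.2 ⟨_, next_selected_one_le _ zero_le_one,
          run_selected_three _ w⟩⟩)).trans ?_
      exact valueSet_selected (A := A) _ A.u₀ 0 0 _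
    have h3 := hcomm (0 :: 1 :: w) (1 :: 0 :: w) (.swap _ _ _)
    exact hy (by simpa using h1.symm.trans (h3.trans h2))
  · intro h
    by_contra hz
    push Not at hz
    refine h ⟨_, List.mem_singleton_self _, fun w w' _ => ?_⟩
    have key (w : List ℚ) : (selected A).outputs w = {0} := by
      obtain ⟨c, hc⟩ := RAQ.exists_run (total_selected (A := A)) (selected A).initial w
      refine (RAQ.outputs_eq (det_selected hA) hc).trans ?_
      -- Whichever letters are forwarded, the first component follows a genuine run of the recording
      -- automaton, whose recorded value is 0 by assumption.
      obtain ⟨v, ⟨p, x⟩, c', rfl, hv⟩ :=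
        exists_run_of_run_sync (A := record A 0 1) (A' := selector) (I := selectorIdle)
          (c := (record A 0 1).initial) (c' := selector.initial) hc
      obtain ⟨u, f, y, rfl⟩ := obs_surjective x
      rw [← hz _ _ _ (recorded_of_run hA hv)]
      exact valueSet_selected _ _ _ _ _
    exact (key w).trans (key w').symm

/-! ## Non-zero as an invariant -/

section Unit

variable {k l : ℕ}

/-- The coordinates of `Vec k (l + 1)` other than the last one. -/
def coord (j : Fin (k + l)) : Fin k ⊕ Fin (l + 1) :=
  Fin.addCases (fun i => .inl i) (fun i => .inr i.castSucc) j

theorem coord_injective : Function.Injective (coord (k := k) (l := l)) := by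
  intro i j h
  induction i using Fin.addCases <;> induction j using Fin.addCases <;> simp [coord] at h <;>
    rw [h]

/-- The unit vectors other than the last one. -/
def unitVec (j : Fin (k + l)) : Vec k (l + 1) := Pi.single (coord j) 1

theorem unitVec_inl (j : Fin (k + l)) (i : Fin k) :
    unitVec j (.inl i) = if (i : ℕ) = j then 1 else 0 := by
  have : unitVec j (.inl i) = if Sum.inl i = coord j then 1 else 0 := Pi.single_apply _ _ _
  rw [this]
  refine if_congr ?_ rfl rfl
  induction j using Fin.addCases with
  | left j => simp [coord, Fin.ext_iff]
  | right j => simp [coord]; omega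

theorem unitVec_inr (j : Fin (k + l)) (i : Fin (l + 1)) :
    unitVec j (.inr i) = if k + (i : ℕ) = j then 1 else 0 := by
  have : unitVec j (.inr i) = if Sum.inr i = coord j then 1 else 0 := Pi.single_apply _ _ _
  rw [this]
  refine if_congr ?_ rfl rfl
  induction j using Fin.addCases with
  | left j => simp [coord]; omega
  | right j => simp [coord, Fin.ext_iff]

theorem linearIndependent_unitVec : LinearIndependent ℚ (unitVec (k := k) (l := l)) :=
  (Pi.linearIndependent_single_one (Fin k ⊕ Fin (l + 1)) ℚ).comp coord coord_injective

/-- The hyperplane is given by explicit independent generators, so the queries are legal instances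
and no basis has to be computed. -/
theorem mem_span_unitVec {u : Vec k (l + 1)} :
    u ∈ Submodule.span ℚ (Set.range (unitVec (k := k) (l := l))) ↔ u (.inr (Fin.last l)) = 0 := by
  constructor
  · intro h
    induction h using Submodule.span_induction with
    | mem x hx =>
      obtain ⟨j, rfl⟩ := hx
      rw [unitVec_inr, if_neg]
      have := j.2
      simp only [Fin.val_last]
      omega
    | zero => rfl
    | add x y _ _ hx hy => rw [Pi.add_apply, hx, hy, add_zero]
    | smul a x _ hx => rw [Pi.smul_apply, hx, smul_zero]
  · intro h
    have hs (j : Fin (k + l)) (a : ℚ) : (Pi.single (coord j) a : Vec k (l + 1)) ∈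
        Submodule.span ℚ (Set.range (unitVec (k := k) (l := l))) := by
      have : (Pi.single (coord j) a : Vec k (l + 1)) = a • unitVec j := by
        rw [unitVec, ← Pi.single_smul, smul_eq_mul, mul_one]
      rw [this]
      exact Submodule.smul_mem _ _ (Submodule.subset_span ⟨j, rfl⟩)
    rw [← Finset.univ_sum_single u]
    refine Submodule.sum_mem _ fun i _ => ?_
    rcases i with i | i
    · simpa [coord] using hs (Fin.castAdd l i) (u (.inl i))
    · induction i using Fin.lastCases with
      | last => rw [h, Pi.single_zero]; exact Submodule.zero_mem _
      | cast i => simpa [coord] using hs (Fin.natAdd k i) (u (.inr i.castSucc))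

end Unit

/-- At the state `q`, the recorded output is always zero. -/
def basisQuery (A : DetRAQ) (q : Fin (A.1.n + 1)) : BasisInstance where
  aut := ⟨record A.1 0 1, det_record A.2⟩
  q := q
  p := 0
  m := A.1.k + (A.1.l + 1)
  v := unitVec
  indep := linearIndependent_unitVec

/-- At the state `q`, the recorded output is always zero. -/
def spanQuery (A : DetRAQ) (q : Fin (A.1.n + 1)) : SpanInstance where
  aut := ⟨record A.1 0 1, det_record A.2⟩
  q := q
  m := A.1.k + (A.1.l + 1)
  v := Fin.cons 0 (unitVec (k := A.1.k) (l := A.1.l + 1))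

theorem obs_last {k l : ℕ} (u : Vec k l) (f y : ℚ) :
    obs u f y (.inr (Fin.last (l + 1))) = y :=
  obs_inr_natAdd u f y 1

theorem exists_mem_ofFn {α : Type} {n : ℕ} {f : Fin n → α} {p : α → Prop} :
    (∃ b ∈ List.ofFn f, p b) ↔ ∃ i, p (f i) := by
  simp [List.mem_ofFn]

/-- The recorded value is the last data variable, and a non-zero one may turn up at any state; this
is why one query is made for each state, the sink included. -/
theorem nonZero_holds_iff_reach (A : DetRAQ) : nonZero.Holds A ↔ ∃ q : Fin (A.1.n + 1),
    ∃ u ∈ (record A.1 0 1).reach q, u (.inr (Fin.last (A.1.l + 1))) ≠ 0 := by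
  obtain ⟨A, hA⟩ := A
  refine (exists_outputs_not_subset_iff hA).trans ?_
  constructor
  · rintro ⟨w, f, y, hw, hy⟩
    obtain ⟨p, u, f', y', hr, hw'⟩ := exists_run_record (cf := 0) (cy := 1) hA w
    obtain ⟨rfl, rfl⟩ := hw.unique hw'
    refine ⟨p, obs u f y, ⟨w, hr⟩, fun h => hy ((obs_last u f y).symm.trans h)⟩
  · rintro ⟨q, v, ⟨w, hr⟩, hv⟩
    obtain ⟨u, f, y, rfl⟩ := obs_surjective v
    exact ⟨w, f, y, recorded_of_run hA hr, fun h => hv ((obs_last u f y).trans h)⟩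

theorem nonZero_holds_iff_basis (A : nonZero.Instance) : nonZero.Holds A ↔
    ∃ b ∈ List.ofFn (basisQuery A), invariantBasis.Holds b := by
  refine (nonZero_holds_iff_reach A).trans ?_
  refine Iff.trans (exists_congr fun q => ?_) exists_mem_ofFn.symm
  have key (u : Vec A.1.k (A.1.l + 1 + 1)) : u ∈ AffineSubspace.mk' (0 : Vec A.1.k (A.1.l + 1 + 1))
      (Submodule.span ℚ (Set.range (unitVec (k := A.1.k) (l := A.1.l + 1)))) ↔
        u (.inr (Fin.last (A.1.l + 1))) = 0 := by
    rw [AffineSubspace.mem_mk', vsub_eq_sub, sub_zero, mem_span_unitVec]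
  refine Iff.trans ?_ Set.not_subset.symm
  exact exists_congr fun u => and_congr_right fun _ => (key u).not.symm

/-- With 0 among the generators, the affine span is the linear span of the others. -/
theorem nonZero_holds_iff_span (A : nonZero.Instance) : nonZero.Holds A ↔
    ∃ b ∈ List.ofFn (spanQuery A), invariantSpan.Holds b := by
  refine (nonZero_holds_iff_reach A).trans ?_
  refine Iff.trans (exists_congr fun q => ?_) exists_mem_ofFn.symm
  have key (u : Vec A.1.k (A.1.l + 1 + 1)) : u ∈ (affineSpan ℚ (Set.range (Fin.cons 0
      (unitVec (k := A.1.k) (l := A.1.l + 1)) : Fin (A.1.k + (A.1.l + 1) + 1) → _)) : Set _) ↔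
        u (.inr (Fin.last (A.1.l + 1))) = 0 := by
    rw [Fin.range_cons, affineSpan_insert_zero, SetLike.mem_coe, mem_span_unitVec]
  refine Iff.trans ?_ Set.not_subset.symm
  exact exists_congr fun u => and_congr_right fun _ => (key u).not.symm

end RegAut

namespace RegAut

/-! ## Affine spaces as kernels -/

section Homogeneous

open Matrix

variable {k l : ℕ}

/-- The homogeneous coordinates of a vector, or of a direction. -/
def homog (u : Vec k l) (c : ℚ) : Fin (k + l + 1) → ℚ :=
  Fin.append (Fin.append (fun i => u (.inl i)) fun j => u (.inr j)) fun _ : Fin 1 => c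

/-- `homog` as a linear map. -/
def homogMap : Vec k l × ℚ →ₗ[ℚ] Fin (k + l + 1) → ℚ where
  toFun x := homog x.1 x.2
  map_add' x y := by
    funext i
    induction i using Fin.addCases with
    | left i => induction i using Fin.addCases <;> simp [homog]
    | right i => simp [homog]
  map_smul' a x := by
    funext i
    induction i using Fin.addCases with
    | left i => induction i using Fin.addCases <;> simp [homog]
    | right i => simp [homog]

theorem homogMap_injective : Function.Injective (homogMap (k := k) (l := l)) := by
  rintro ⟨u, c⟩ ⟨u', c'⟩ h
  have h : homog u c = homog u' c' := h
  refine Prod.ext (funext fun i => ?_) ?_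
  · rcases i with i | i
    · simpa [homog] using congrFun h (Fin.castAdd 1 (Fin.castAdd l i))
    · simpa [homog] using congrFun h (Fin.castAdd 1 (Fin.natAdd k i))
  · simpa [homog] using congrFun h (Fin.natAdd (k + l) 0)

theorem homog_mem_span_iff {κ : Type} {x : κ → Vec k l × ℚ} {u : Vec k l} {c : ℚ} :
    homog u c ∈ Submodule.span ℚ (Set.range fun i => homog (x i).1 (x i).2) ↔
      (u, c) ∈ Submodule.span ℚ (Set.range x) := by
  have h : (Set.range fun i => homog (x i).1 (x i).2) = homogMap '' Set.range x := by
    rw [← Set.range_comp]; rfl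
  rw [h, Submodule.span_image, show homog u c = homogMap (u, c) from rfl, Submodule.mem_map]
  exact ⟨fun ⟨y, hy, e⟩ => homogMap_injective e ▸ hy, fun h => ⟨_, h, rfl⟩⟩

/-- The second coordinate forces the coefficient of `(p, 1)` to be 1, so the remaining vectors
describe `u - p`. -/
theorem mem_span_cons_iff {V : Type} [AddCommGroup V] [Module ℚ V] {m : ℕ} {p u : V}
    {v : Fin m → V} : (u, (1 : ℚ)) ∈ Submodule.span ℚ (Set.range
      (Fin.cons (p, 1) fun i => (v i, 0) : Fin (m + 1) → V × ℚ)) ↔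
      u ∈ AffineSubspace.mk' p (Submodule.span ℚ (Set.range v)) := by
  have h : (Set.range fun i => (v i, (0 : ℚ))) = LinearMap.inl ℚ V ℚ '' Set.range v := by
    rw [← Set.range_comp]; rfl
  rw [Fin.range_cons, Submodule.mem_span_insert, h, Submodule.span_image, AffineSubspace.mem_mk',
    vsub_eq_sub]
  constructor
  · rintro ⟨a, z, hz, e⟩
    obtain ⟨y, hy, rfl⟩ := Submodule.mem_map.1 hz
    obtain ⟨e1, e2⟩ := Prod.ext_iff.1 e
    obtain rfl : a = 1 := by simpa using e2.symm
    rw [show u = p + y by simpa using e1, add_sub_cancel_left]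
    exact hy
  · exact fun hu => ⟨1, _, Submodule.mem_map.2 ⟨_, hu, rfl⟩, by ext <;> simp⟩

/-- The second coordinate says that the coefficients sum to 1, which is what makes a linear
combination affine. -/
theorem mem_span_one_iff {V : Type} [AddCommGroup V] [Module ℚ V] {m : ℕ} {u : V} {v : Fin m → V} :
    (u, (1 : ℚ)) ∈ Submodule.span ℚ (Set.range fun i => (v i, (1 : ℚ))) ↔
      u ∈ affineSpan ℚ (Set.range v) := by
  rw [Submodule.mem_span_range_iff_exists_fun]
  constructor
  · rintro ⟨c, hc⟩
    obtain ⟨h1, h2⟩ := Prod.ext_iff.1 hc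
    have h1 : ∑ i, c i • v i = u := by simpa [Prod.fst_sum] using h1
    have h2 : ∑ i, c i = 1 := by simpa [Prod.snd_sum] using h2
    rw [← h1, ← Finset.univ.affineCombination_eq_linear_combination v c h2]
    exact affineCombination_mem_affineSpan h2 v
  · intro h
    obtain ⟨c, h2, rfl⟩ := eq_affineCombination_of_mem_affineSpan_of_fintype h
    rw [Finset.univ.affineCombination_eq_linear_combination v c h2]
    exact ⟨c, by ext <;> simp [Prod.fst_sum, Prod.snd_sum, h2]⟩

/-- An integral multiple of a vector. -/
def scale {n : ℕ} (x : Fin n → ℚ) (i : Fin n) : ℤ :=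
  (x i).num * ((∏ j, ((x j).den : ℤ)) / (x i).den)

theorem scale_eq {n : ℕ} (x : Fin n → ℚ) :
    (fun i => (scale x i : ℚ)) = ((∏ j, ((x j).den : ℤ) : ℤ) : ℚ) • x := by
  funext i
  have hd : ((x i).den : ℤ) ∣ ∏ j, ((x j).den : ℤ) := Finset.dvd_prod_of_mem _ (Finset.mem_univ i)
  have h0 : ((x i).den : ℚ) ≠ 0 := by exact_mod_cast (x i).den_ne_zero
  rw [scale, Int.cast_mul, Int.cast_div hd (by exact_mod_cast h0), Pi.smul_apply, smul_eq_mul]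
  conv_rhs => rw [← Rat.num_div_den (x i)]
  push_cast
  ring

theorem span_scale {n : ℕ} {κ : Type} (x : κ → Fin n → ℚ) :
    Submodule.span ℚ (Set.range fun j i => (scale (x j) i : ℚ)) = Submodule.span ℚ (Set.range x) := by
  have h (j : κ) : ((∏ i, ((x j i).den : ℤ) : ℤ) : ℚ) ≠ 0 :=
    Int.cast_ne_zero.2 (Finset.prod_ne_zero_iff.2 fun i _ => by exact_mod_cast (x j i).den_ne_zero)
  refine le_antisymm (Submodule.span_le.2 ?_) (Submodule.span_le.2 ?_)
  · rintro _ ⟨j, rfl⟩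
    beta_reduce
    rw [scale_eq]
    exact Submodule.smul_mem _ _ (Submodule.subset_span ⟨j, rfl⟩)
  · rintro _ ⟨j, rfl⟩
    have e : x j = (((∏ i, ((x j i).den : ℤ) : ℤ) : ℚ))⁻¹ • fun i => (scale (x j) i : ℚ) := by
      rw [scale_eq, smul_smul, inv_mul_cancel₀ (h j), one_smul]
    rw [e]
    exact Submodule.smul_mem _ _ (Submodule.subset_span ⟨j, rfl⟩)

/-- The elimination of a list of vectors. -/
def eliminate {n : ℕ} (L : List (Fin n → ℤ)) : ℤ × Matrix (Fin n) (Fin n) ℤ :=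
  L.foldl elimStep (1, 1)

theorem eliminate_concat {n : ℕ} (L : List (Fin n → ℤ)) (v : Fin n → ℤ) :
    eliminate (L ++ [v]) = elimStep (eliminate L) v := List.foldl_concat ..

/-- Iterating `ElimInv.elimStep` multiplies the bounds for the denominators. A product of `1 + v ⬝ᵥ
v` has polynomial bit size, so the numbers do not explode. -/
theorem elimInv_eliminate {n : ℕ} (L : List (Fin n → ℤ)) :
    ElimInv (eliminate L) (Submodule.span ℚ {x | ∃ v ∈ L, x = fun i => (v i : ℚ)}) ∧
      (eliminate L).1 ≤ (L.map fun v => 1 + v ⬝ᵥ v).prod := by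
  induction L using List.reverseRecOn with
  | nil => simpa [eliminate] using elimInv_one
  | append_singleton L v ih =>
    obtain ⟨h1, h2⟩ := ih.1.elimStep v
    rw [eliminate_concat]
    refine ⟨?_, h2.trans ?_⟩
    · convert h1
      rw [← Submodule.span_union]
      congr 1
      ext x
      simp [or_and_right, exists_or, or_comm]
    · rw [List.map_append, List.prod_append, List.map_singleton, List.prod_singleton]
      refine mul_le_mul_of_nonneg_right ih.2 ?_
      have := Finset.sum_nonneg fun i (_ : i ∈ Finset.univ) => mul_self_nonneg (v i)
      exact add_nonneg zero_le_one this

theorem ElimInv.abs_apply_le {n : ℕ} {s : ℤ × Matrix (Fin n) (Fin n) ℤ}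
    {U : Submodule ℚ (Fin n → ℚ)} (h : ElimInv s U) (a b : Fin n) : |s.2 a b| ≤ s.1 := by
  obtain ⟨hpos, R, hR, hp, -⟩ := h
  have h1 := congrFun (congrFun hR a) b
  simp only [map_apply, Matrix.smul_apply, smul_eq_mul] at h1
  have h2 : |(s.2 a b : ℚ)| ≤ s.1 := by
    rw [h1, abs_mul, abs_of_pos (by exact_mod_cast hpos)]
    exact mul_le_of_le_one_right (by exact_mod_cast hpos.le) (hp.abs_apply_le a b)
  exact_mod_cast h2

/-- A linear expression from homogeneous coordinates. -/
def LinExpr.ofHomog (r : Fin (k + l + 1) → ℤ) : LinExpr k l where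
  coeff := Sum.elim (fun i => r (Fin.castAdd 1 (Fin.castAdd l i)))
    fun j => r (Fin.castAdd 1 (Fin.natAdd k j))
  const := r (Fin.natAdd (k + l) 0)

theorem LinExpr.value_ofHomog (r : Fin (k + l + 1) → ℤ) (u : Vec k l) :
    (LinExpr.ofHomog r).value u = (fun i => (r i : ℚ)) ⬝ᵥ homog u 1 := by
  simp [LinExpr.value, LinExpr.ofHomog, dotProduct, Fin.sum_univ_add, homog]

/-- The rows of the matrix to which the multiples of vectors are eliminated. -/
def separator {m : ℕ} (x : Fin m → Fin (k + l + 1) → ℚ) (a : Fin (k + l + 1)) : LinExpr k l :=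
  .ofHomog ((eliminate (List.ofFn fun j => scale (x j))).2 a)

/-- The matrix is a non-zero multiple of a projection whose kernel is the span of the scaled
vectors, and scaling does not change the span. A point lies in that kernel iff all rows vanish on
it. -/
theorem exists_separator_value_ne_zero_iff {m : ℕ} {x : Fin m → Fin (k + l + 1) → ℚ} {u : Vec k l} :
    (∃ a, (separator x a).value u ≠ 0) ↔ homog u 1 ∉ Submodule.span ℚ (Set.range x) := by
  obtain ⟨hpos, R, hR, -, hU, -⟩ := (elimInv_eliminate (List.ofFn fun j => scale (x j))).1
  have e : {y : Fin (k + l + 1) → ℚ | ∃ v ∈ List.ofFn fun j => scale (x j), y = fun i => (v i : ℚ)} =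
      Set.range fun j i => (scale (x j) i : ℚ) := by
    ext y
    simp [List.mem_ofFn, eq_comm]
  rw [e, span_scale] at hU
  rw [← hU, ← ne_eq, Function.ne_iff]
  refine exists_congr fun a => ?_
  have h1 : (separator x a).value u =
      (eliminate (List.ofFn fun j => scale (x j))).1 * (R *ᵥ homog u 1) a := by
    rw [separator, LinExpr.value_ofHomog]
    change ((eliminate (List.ofFn fun j => scale (x j))).2.map (Int.cast : ℤ → ℚ) *ᵥ homog u 1) a = _
    rw [hR, smul_mulVec]; rfl
  rw [h1, mul_ne_zero_iff, and_iff_right (by exact_mod_cast hpos.ne')]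
  rfl

end Homogeneous

/-! ## Invariants as non-zero problems -/

/-- The automaton with `q` as its only final state and `g` as the output there. -/
def focus (A : RAQ) (q : Fin A.n) (g : LinExpr A.k A.l) : RAQ where
  k := A.k
  l := A.l
  n := A.n
  q₀ := A.q₀
  u₀ := A.u₀
  δ := A.δ
  ζ p := if p = q then some g else none

section Focus

variable {A : RAQ} {q : Fin A.n} {g : LinExpr A.k A.l}

theorem run_focus_iff {w : List ℚ} {c c' : A.Config} : (focus A q g).Run c w c' ↔ A.Run c w c' := by
  induction w generalizing c with
  | nil => exact RAQ.run_nil_iff.trans RAQ.run_nil_iff.symm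
  | cons d w ih =>
    exact RAQ.run_cons_iff.trans ((exists_congr fun x => and_congr_right fun _ => ih).trans
      (RAQ.run_cons_iff (A := A)).symm)

theorem exists_outputs_focus_not_subset_iff :
    (∃ w, ¬ (focus A q g).outputs w ⊆ {0}) ↔ ∃ u ∈ A.reach q, g.value u ≠ 0 := by
  constructor
  · rintro ⟨w, hw⟩
    obtain ⟨r, ⟨⟨p, u⟩, hr, g', hg, rfl⟩, hz⟩ := Set.not_subset.1 hw
    have key : ∀ p : Fin A.n, (if p = q then some g else none) = some g' →
        A.Run A.initial w (p, u) → A.Run A.initial w (q, u) ∧ g = g' := by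
      intro p h hr
      split_ifs at h with hp
      exact ⟨hp ▸ hr, Option.some_injective _ h⟩
    obtain ⟨h, rfl⟩ := key p hg (run_focus_iff.1 hr)
    exact ⟨u, ⟨w, h⟩, hz⟩
  · rintro ⟨u, ⟨w, hr⟩, hz⟩
    exact ⟨w, Set.not_subset.2 ⟨_, ⟨(q, u), run_focus_iff.2 hr, g, if_pos rfl, rfl⟩, hz⟩⟩

end Focus

/-- The non-zero problems for the affine space that is generated by the vectors `x`. -/
def focused (A : DetRAQ) (q : Fin A.1.n) {m : ℕ} (x : Fin m → Vec A.1.k A.1.l × ℚ)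
    (a : Fin (A.1.k + A.1.l + 1)) : DetRAQ :=
  ⟨focus A.1 q (separator (fun j => homog (x j).1 (x j).2) a), A.2⟩

/-- A vector lies outside iff some form is non-zero on it. The quantifiers over forms and reachable
vectors commute, which gives one non-zero query for each homogeneous coordinate. -/
theorem exists_nonZero_focused_iff (A : DetRAQ) (q : Fin A.1.n) {m : ℕ}
    (x : Fin m → Vec A.1.k A.1.l × ℚ) : (∃ b ∈ List.ofFn (focused A q x), nonZero.Holds b) ↔
      ∃ u ∈ A.1.reach q, (u, 1) ∉ Submodule.span ℚ (Set.range x) := by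
  refine exists_mem_ofFn.trans ((exists_congr fun a => exists_outputs_focus_not_subset_iff).trans ?_)
  rw [exists_comm]
  refine exists_congr fun u => exists_and_left.trans (and_congr_right fun _ => ?_)
  rw [exists_separator_value_ne_zero_iff, homog_mem_span_iff]

/-- The generators of the affine space, in homogeneous coordinates. -/
def BasisInstance.generators (a : BasisInstance) : Fin (a.m + 1) → Vec a.aut.1.k a.aut.1.l × ℚ :=
  Fin.cons (a.p, 1) fun i => (a.v i, 0)

/-- The generators of the affine space, in homogeneous coordinates. -/
def SpanInstance.generators (a : SpanInstance) : Fin (a.m + 1) → Vec a.aut.1.k a.aut.1.l × ℚ :=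
  fun i => (a.v i, 1)

theorem invariantBasis_holds_iff (a : invariantBasis.Instance) : invariantBasis.Holds a ↔
    ∃ b ∈ List.ofFn (focused a.aut a.q a.generators), nonZero.Holds b := by
  refine Set.not_subset.trans (Iff.trans ?_ (exists_nonZero_focused_iff _ _ _).symm)
  exact exists_congr fun u => and_congr_right fun _ => mem_span_cons_iff.not.symm

theorem invariantSpan_holds_iff (a : invariantSpan.Instance) : invariantSpan.Holds a ↔
    ∃ b ∈ List.ofFn (focused a.aut a.q a.generators), nonZero.Holds b := by
  refine Set.not_subset.trans (Iff.trans ?_ (exists_nonZero_focused_iff _ _ _).symm)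
  exact exists_congr fun u => and_congr_right fun _ => mem_span_one_iff.not.symm

end RegAut

namespace RegAut

/-! ## Polynomial-time computations on encoded automata -/

open Data

/-- `n` can be computed in polynomial time, also in unary notation. -/
structure PolyDim (O : Data → Bool → Prop) {α : Type} (i : α → Data) (n : α → ℕ) : Prop where
  bdd : PolyBdd i n
  num : PolyTime O i fun a => .num (n a)

section Dim

variable {O : Data → Bool → Prop} {α : Type} {i : α → Data} {n n' : α → ℕ}

theorem PolyBdd.ext {β : α → Type} {y : (p : (a : α) × β a) → Data} (h : PolyBdd i n) :
    PolyBdd (fun p : (a : α) × β a => .pair (i p.1) (y p)) fun p => n p.1 :=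
  PolyBdd.trans (m := fun p : (a : α) × β a => i p.1)
    ((PolyBdd.size fun p : (a : α) × β a => .pair (i p.1) (y p)).mono fun p => by
      simp only [Data.size]; omega) (h.comap Sigma.fst)

namespace PolyDim

theorem ext {β : α → Type} {y : (p : (a : α) × β a) → Data} (h : PolyDim O i n) :
    PolyDim O (fun p : (a : α) × β a => .pair (i p.1) (y p)) fun p => n p.1 :=
  ⟨h.bdd.ext, h.num.ext⟩

theorem const (c : ℕ) : PolyDim O i fun _ => c := ⟨.const _ _, .const _⟩

theorem add (h : PolyDim O i n) (h' : PolyDim O i n') : PolyDim O i fun a => n a + n' a :=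
  ⟨h.bdd.add h'.bdd, (h.num.add h'.num).congr fun a => by rw [Nat.cast_add]⟩

theorem mul (h : PolyDim O i n) (h' : PolyDim O i n') : PolyDim O i fun a => n a * n' a :=
  ⟨h.bdd.mul h'.bdd, (h.num.mul h'.num).congr fun a => by rw [Nat.cast_mul]⟩

end PolyDim

end Dim

namespace PolyTime

variable {O : Data → Bool → Prop} {α : Type} {i : α → Data}

section Families

variable {β γ : α → Type} {n n' : α → ℕ} {e : ∀ a, β a → Data} {e' : ∀ a, γ a → Data}
  {f : ∀ a, Fin (n a) → β a}

theorem encFun_ofFn (hn : PolyDim O i n)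
    (hf : PolyTime O (fun p : (a : α) × Fin (n a) => .pair (i p.1) (encFin p.2))
      fun p => e p.1 (f p.1 p.2)) : PolyTime O i fun a => encFun (e a) (f a) :=
  ofFn (f := fun a j => e a (f a j)) hn.bdd hn.num hf

theorem encFun_const (hn : PolyDim O i n) {x : ∀ a, β a} (hx : PolyTime O i fun a => e a (x a)) :
    PolyTime O i fun a => encFun (e a) fun _ : Fin (n a) => x a :=
  encFun_ofFn hn hx.ext

theorem encFun_get {j : ∀ a, Fin (n a)} (h : PolyTime O i fun a => encFun (e a) (f a))
    (hj : PolyTime O i fun a => encFin (j a)) : PolyTime O i fun a => e a (f a (j a)) :=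
  lookup (f := fun a j => e a (f a j)) h hj

theorem encFun_bdd (h : PolyTime O i fun a => encFun (e a) (f a)) : PolyBdd i n :=
  bdd_of_ofFn (f := fun a j => e a (f a j)) h

theorem encFun_map {g : ∀ a, β a → γ a} (h : PolyTime O i fun a => encFun (e a) (f a))
    (hg : PolyTime O (fun p : (a : α) × β a => .pair (i p.1) (e p.1 p.2))
      fun p => e' p.1 (g p.1 p.2)) : PolyTime O i fun a => encFun (e' a) fun j => g a (f a j) :=
  (map (L := fun a => List.ofFn (f a)) (e := e) (f := fun a b => e' a (g a b))
    (h.congr fun a => by rw [List.map_ofFn]; rfl) hg).congr fun a => by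
      rw [List.map_ofFn]; rfl

theorem encFun_cons {x : ∀ a, β a} (hx : PolyTime O i fun a => e a (x a))
    (h : PolyTime O i fun a => encFun (e a) (f a)) :
    PolyTime O i fun a => encFun (e a) (Fin.cons (x a) (f a) : Fin (n a + 1) → β a) :=
  (hx.pair h).congr fun a => by simp [encFun, List.ofFn_succ, ofList]

theorem encFun_two {x y : ∀ a, β a} (hx : PolyTime O i fun a => e a (x a))
    (hy : PolyTime O i fun a => e a (y a)) : PolyTime O i fun a => encFun (e a) ![x a, y a] :=
  (hx.cons (hy.cons nil)).congr fun a => by simp [encFun, List.ofFn_succ]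

/-- The encoding of `some` is a pair and that of `none` is not, so one test separates the cases; the
content is then passed on as a local datum. -/
theorem option {o : ∀ a, Option (β a)} {f : ∀ a, Option (β a) → Data}
    (ho : PolyTime O i fun a => encOption (e a) (o a)) (hn : PolyTime O i fun a => f a none)
    (hs : PolyTime O (fun p : (a : α) × β a => .pair (i p.1) (e p.1 p.2))
      fun p => f p.1 (some p.2)) : PolyTime O i fun a => f a (o a) := by
  have h (a : α) : (encOption (e a) (o a)).isPair = (o a).isSome := by
    cases o a <;> rfl
  refine cases (ho.isPair.congr fun a => by rw [h]) ?_ ?_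
  · let φ (a : {a // (o a).isSome = true}) : (a : α) × β a := ⟨a.1, (o a.1).get a.2⟩
    have h1 := (refl (O := O) (i := fun a : {a // (o a).isSome = true} => i a)).pair
      (ho.snd.comap Subtype.val)
    refine ((h1.congr fun a => ?_).trans (hs.comap φ)).congr fun a => ?_
    · conv_lhs => rw [← Option.some_get a.2]
      rfl
    · simp [φ]
  · exact (hn.comap Subtype.val).congr fun a => by
      rw [Option.isNone_iff_eq_none.1 (Option.isSome_eq_false_iff.1 a.2)]

end Families

section Indices

variable {n n' : α → ℕ} {p q : ∀ a, Fin (n a)} {p' : ∀ a, Fin (n' a)} {x y : α → Data}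

theorem ite_eq (hp : PolyTime O i fun a => encFin (p a)) (hq : PolyTime O i fun a => encFin (q a))
    (hx : PolyTime O i x) (hy : PolyTime O i y) :
    PolyTime O i fun a => if p a = q a then x a else y a :=
  ((hp.eq hq).ite hx hy).congr fun a => if_congr (by rw [Nat.cast_inj, Fin.ext_iff]) rfl rfl

theorem finProd (hn' : PolyDim O i n') (hp : PolyTime O i fun a => encFin (p a))
    (hp' : PolyTime O i fun a => encFin (p' a)) :
    PolyTime O i fun a => encFin (finProdFinEquiv (p a, p' a)) :=
  (hp'.add (hn'.num.mul hp)).congr fun a => by simp [encFin, finProdFinEquiv]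

theorem finProd_symm_fst {j : ∀ a, Fin (n a * n' a)} (hn' : PolyDim O i n')
    (hj : PolyTime O i fun a => encFin (j a)) :
    PolyTime O i fun a => encFin (finProdFinEquiv.symm (j a)).1 :=
  (hj.div hn'.num).congr fun a => by simp [encFin, finProdFinEquiv]

theorem finProd_symm_snd {j : ∀ a, Fin (n a * n' a)} (hn' : PolyDim O i n')
    (hj : PolyTime O i fun a => encFin (j a)) :
    PolyTime O i fun a => encFin (finProdFinEquiv.symm (j a)).2 :=
  (hj.sub (hn'.num.mul (hj.div hn'.num))).congr fun a => by
    simp [encFin, finProdFinEquiv, Fin.modNat, Int.emod_def]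

end Indices

section Vectors

variable {k l k' l' : α → ℕ} {u : ∀ a, Vec (k a) (l a)} {u' : ∀ a, Vec (k' a) (l' a)} {f y : α → ℚ}

theorem vec_inl (h : PolyTime O i fun a => encVec (u a)) :
    PolyTime O i fun a => encFun encRat fun j => u a (.inl j) := h.of_fst

theorem vec_inr (h : PolyTime O i fun a => encVec (u a)) :
    PolyTime O i fun a => encFun encRat fun j => u a (.inr j) := h.of_snd

theorem vec_zero (hk : PolyDim O i k) (hl : PolyDim O i l) :
    PolyTime O i fun a => encVec (0 : Vec (k a) (l a)) :=
  (encFun_const (e := fun _ => encRat) (x := fun _ => 0) hk (const _)).pair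
    (encFun_const (e := fun _ => encRat) (x := fun _ => 0) hl (const _))

theorem vec_join (h : PolyTime O i fun a => encVec (u a)) (h' : PolyTime O i fun a => encVec (u' a)) :
    PolyTime O i fun a => encVec (join (u a) (u' a)) :=
  (encFun_append (e := fun _ => encRat) h.vec_inl h'.vec_inl).pair
    (encFun_append (e := fun _ => encRat) h.vec_inr h'.vec_inr)

theorem vec_obs (h : PolyTime O i fun a => encVec (u a)) (hf : PolyTime O i fun a => encRat (f a))
    (hy : PolyTime O i fun a => encRat (y a)) :
    PolyTime O i fun a => encVec (obs (u a) (f a) (y a)) :=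
  h.vec_inl.pair (encFun_append (e := fun _ => encRat) (n' := fun _ => 2) h.vec_inr
    (encFun_two (e := fun _ => encRat) hf hy))

theorem row_ext (h : PolyTime O i fun a => encVec (u a)) (hf : PolyTime O i fun a => encRat (f a)) :
    PolyTime O i fun a => encRow (RegAut.ext (u a) (f a)) := h.pair hf

end Vectors

section Expressions

variable {k l k' l' : α → ℕ} {g : ∀ a, LinExpr (k a) (l a)} {g' : ∀ a, LinExpr (k' a) (l' a)}
  {u : ∀ a, Vec (k a) (l a)} {c : α → ℚ}

theorem expr_mk (h : PolyTime O i fun a => encVec (u a)) (hc : PolyTime O i fun a => encRat (c a)) :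
    PolyTime O i fun a => encLinExpr ⟨u a, c a⟩ := h.pair hc

theorem expr_coeff (h : PolyTime O i fun a => encLinExpr (g a)) :
    PolyTime O i fun a => encVec (g a).coeff := h.of_fst

theorem expr_const (h : PolyTime O i fun a => encLinExpr (g a)) :
    PolyTime O i fun a => encRat (g a).const := h.of_snd

theorem expr_join (h : PolyTime O i fun a => encLinExpr (g a))
    (h' : PolyTime O i fun a => encLinExpr (g' a)) :
    PolyTime O i fun a => encLinExpr ((g a).join (g' a)) :=
  (h.expr_coeff.vec_join h'.expr_coeff).expr_mk h.expr_const

theorem encOption_some {β : α → Type} {e : ∀ a, β a → Data} {x : ∀ a, β a}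
    (h : PolyTime O i fun a => e a (x a)) : PolyTime O i fun a => encOption (e a) (some (x a)) :=
  (const (.num 1)).pair h

theorem expr_map₂ {o : ∀ a, Option (LinExpr (k a) (l a))} {o' : ∀ a, Option (LinExpr (k' a) (l' a))}
    (h : PolyTime O i fun a => encOption encLinExpr (o a))
    (h' : PolyTime O i fun a => encOption encLinExpr (o' a)) :
    PolyTime O i fun a => encOption encLinExpr (Option.map₂ LinExpr.join (o a) (o' a)) := by
  refine option (f := fun a o => encOption encLinExpr (Option.map₂ LinExpr.join o (o' a))) h
    ((const (.num 0)).congr fun a => by rw [Option.map₂_none_left]; rfl) ?_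
  refine option (o := fun p : (a : α) × LinExpr (k a) (l a) => o' p.1)
    (f := fun p o => encOption encLinExpr (Option.map₂ LinExpr.join (some p.2) o)) h'.ext
    ((const (.num 0)).congr fun a => by rw [Option.map₂_none_right]; rfl) ?_
  let β := (p : (a : α) × LinExpr (k a) (l a)) × LinExpr (k' p.1) (l' p.1)
  have h1 : PolyTime O (fun p : (a : α) × LinExpr (k a) (l a) => .pair (i p.1) (encLinExpr p.2))
      fun p => encLinExpr p.2 := refl.of_snd
  exact (encOption_some (expr_join (g := fun p : β => p.1.2) (g' := fun p : β => p.2) h1.ext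
    refl.of_snd)).congr fun _ => rfl

end Expressions

end PolyTime
end RegAut

/-! ### Transitions and guards in polynomial time -/

namespace RegAut

open Data

namespace PolyTime

variable {O : Data → Bool → Prop} {α : Type} {i : α → Data}

section Transitions

variable {k l n k' l' n' : α → ℕ} {t : ∀ a, Transition (k a) (l a) (n a)}
  {t' : ∀ a, Transition (k' a) (l' a) (n' a)}

theorem trans_src (h : PolyTime O i fun a => encTransition (t a)) :
    PolyTime O i fun a => encFin (t a).src := h.of_fst

theorem trans_guard (h : PolyTime O i fun a => encTransition (t a)) :
    PolyTime O i fun a => encGuard (t a).guard := h.of_snd.of_fst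

theorem trans_tgt (h : PolyTime O i fun a => encTransition (t a)) :
    PolyTime O i fun a => encFin (t a).tgt := h.of_snd.of_snd.of_fst

theorem trans_A (h : PolyTime O i fun a => encTransition (t a)) :
    PolyTime O i fun a => encFun (encOption encFin) (t a).A := h.of_snd.of_snd.of_snd.of_fst

theorem trans_B (h : PolyTime O i fun a => encTransition (t a)) :
    PolyTime O i fun a => encFun encRow (t a).B := h.of_snd.of_snd.of_snd.of_snd.of_fst

theorem trans_b (h : PolyTime O i fun a => encTransition (t a)) :
    PolyTime O i fun a => encFun encRat (t a).b := h.of_snd.of_snd.of_snd.of_snd.of_snd.of_fst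

theorem trans_mk (h1 : PolyTime O i fun a => encFin (t a).src)
    (h2 : PolyTime O i fun a => encGuard (t a).guard) (h3 : PolyTime O i fun a => encFin (t a).tgt)
    (h4 : PolyTime O i fun a => encFun (encOption encFin) (t a).A)
    (h5 : PolyTime O i fun a => encFun encRow (t a).B)
    (h6 : PolyTime O i fun a => encFun encRat (t a).b) :
    PolyTime O i fun a => encTransition (t a) :=
  h1.cons (h2.cons (h3.cons (h4.cons (h5.cons (h6.cons nil)))))

theorem guard_conj {φ ψ : ∀ a, Guard (k a)} (h : PolyTime O i fun a => encGuard (φ a))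
    (h' : PolyTime O i fun a => encGuard (ψ a)) :
    PolyTime O i fun a => encGuard ((φ a).conj (ψ a)) := (const (.num 2)).pair (h.pair h')

theorem encFun_map_castAdd {s : ∀ a, Fin (n a) → Option (Fin (k a))}
    (h : PolyTime O i fun a => encFun (encOption encFin) (s a)) :
    PolyTime O i fun a => encFun (encOption encFin) fun j => (s a j).map (Fin.castAdd (k' a)) := by
  refine h.congr fun a => ?_
  have h (o : Option (Fin (k a))) :
      encOption encFin (o.map (Fin.castAdd (k' a))) = encOption encFin o := by cases o <;> rfl
  simp only [encFun, h]

theorem encFun_map_natAdd {s : ∀ a, Fin (n a) → Option (Fin (k a))} (hk' : PolyDim O i k')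
    (h : PolyTime O i fun a => encFun (encOption encFin) (s a)) :
    PolyTime O i fun a => encFun (encOption encFin) fun j => (s a j).map (Fin.natAdd (k' a)) := by
  refine encFun_map (e := fun _ => encOption encFin) (e' := fun _ => encOption encFin)
    (g := fun a o => o.map (Fin.natAdd (k' a))) h ?_
  let β := (a : α) × Option (Fin (k a))
  have h1 : PolyTime O (fun p : β => .pair (i p.1) (encOption encFin p.2))
      fun p => encOption encFin p.2 := refl.of_snd
  refine option (o := fun p : β => p.2) (e := fun _ => encFin)
    (f := fun p o => encOption encFin (o.map (Fin.natAdd (k' p.1)))) h1 (const (.num 0)) ?_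
  have h2 : PolyTime O (fun p : (p : β) × Fin (k p.1) =>
      .pair (.pair (i p.1.1) (encOption encFin p.1.2)) (encFin p.2)) fun p => encFin p.2 :=
    refl.of_snd
  have h3 := hk'.num.ext (y := fun p : β => encOption encFin p.2)
  have h4 := h3.ext (y := fun p : (p : β) × Fin (k p.1) => encFin p.2)
  exact ((const (.num 1)).pair (h4.add h2)).congr fun p => by
    simp [encOption, encFin]

theorem trans_sync (hk : PolyDim O i k) (hl : PolyDim O i l) (hk' : PolyDim O i k')
    (hl' : PolyDim O i l') (hn' : PolyDim O i n') (h : PolyTime O i fun a => encTransition (t a))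
    (h' : PolyTime O i fun a => encTransition (t' a)) :
    PolyTime O i fun a => encTransition ((t a).sync (t' a)) := by
  refine trans_mk (finProd hn' h.trans_src h'.trans_src) ?_ (finProd hn' h.trans_tgt h'.trans_tgt)
    ?_ ?_ (encFun_append (e := fun _ => encRat) h.trans_b h'.trans_b)
  · refine guard_conj (h.trans_guard.congr fun a => ?_) (guard_natAdd hk.num h'.trans_guard)
    exact (encGuard_rename_of_val_eq (Fin.castAdd (k' a)) (fun _ => rfl) _).symm
  · exact encFun_append (e := fun _ => encOption encFin) (encFun_map_castAdd h.trans_A)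
      (encFun_map_natAdd hk h'.trans_A)
  · refine encFun_append (e := fun _ => encRow) ?_ ?_
    · refine encFun_map (e := fun _ => encRow) (e' := fun _ => encRow)
        (g := fun _ b => RegAut.ext (join (fun i => b (some i)) 0) (b none)) h.trans_B ?_
      have h1 : PolyTime O (fun p : (a : α) × (Option (Fin (k a) ⊕ Fin (l a)) → ℚ) =>
        .pair (i p.1) (encRow p.2)) fun p => encRow p.2 := refl.of_snd
      exact (vec_join h1.of_fst (vec_zero hk'.ext hl'.ext)).row_ext h1.of_snd
    · refine encFun_map (e := fun _ => encRow) (e' := fun _ => encRow)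
        (g := fun _ b => RegAut.ext (join 0 fun i => b (some i)) (b none)) h'.trans_B ?_
      have h1 : PolyTime O (fun p : (a : α) × (Option (Fin (k' a) ⊕ Fin (l' a)) → ℚ) =>
        .pair (i p.1) (encRow p.2)) fun p => encRow p.2 := refl.of_snd
      exact (vec_join (vec_zero hk.ext hl.ext) h1.of_fst).row_ext h1.of_snd

theorem encFun_some (hk : PolyDim O i k) :
    PolyTime O i fun a => encFun (encOption encFin) (some : Fin (k a) → _) := by
  have h : PolyTime O (fun p : (a : α) × Fin (k a) => .pair (i p.1) (encFin p.2))
    fun p => encFin p.2 := refl.of_snd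
  exact encFun_ofFn (e := fun _ => encOption encFin) hk (encOption_some (e := fun _ => encFin) h)

theorem trans_idle {p : ∀ a, Fin (n a)} (hk : PolyDim O i k) (hl : PolyDim O i l)
    (hp : PolyTime O i fun a => encFin (p a)) :
    PolyTime O i fun a => encTransition (Transition.idle (k a) (l a) (p a)) := by
  -- The encoding of this guard does not depend on the number of variables, so a guard over none of
  -- them may stand for it.
  refine trans_mk hp (const (encGuard (.le none none : Guard 0))) hp (encFun_some hk) ?_
    (encFun_const (e := fun _ => encRat) (x := fun _ => 0) hl (const _))
  refine encFun_ofFn (e := fun _ => encRow) hl (row_ext ?_ (const (encRat 0)))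
  refine (encFun_const (e := fun _ => encRat) (x := fun _ => 0) hk.ext (const _)).pair ?_
  refine encFun_ofFn (e := fun _ => encRat) hl.ext ?_
  let β := (a : α) × Fin (l a)
  have h1 : PolyTime O (fun p : β => .pair (i p.1) (encFin p.2)) fun p => encFin p.2 := refl.of_snd
  have h2 : PolyTime O (fun p : (p : β) × Fin (l p.1) =>
    .pair (.pair (i p.1.1) (encFin p.1.2)) (encFin p.2)) fun p => encFin p.2 := refl.of_snd
  refine (ite_eq (p := fun p : (p : β) × Fin (l p.1) => p.2) (q := fun p => p.1.2) h2 h1.ext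
    (const (encRat 1)) (const (encRat 0))).congr fun p => ?_
  rw [Pi.single_apply]
  simp only [Sum.inr.injEq]
  split_ifs <;> rfl

theorem trans_observe {o : ∀ a, Option (LinExpr (k a) (l a))} (hk : PolyDim O i k)
    (hl : PolyDim O i l) (h : PolyTime O i fun a => encTransition (t a))
    (ho : PolyTime O i fun a => encOption encLinExpr (o a)) :
    PolyTime O i fun a => encTransition ((t a).observe (o a)) := by
  have hflag : PolyTime O i fun a => encRat (flag (o a)) :=
    option (f := fun _ o => encRat (flag o)) ho (const (encRat 0)) (const (encRat 1))
  have hemit : PolyTime O i fun a => encLinExpr (emit (o a)) :=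
    option (f := fun _ o => encLinExpr (emit o)) ho (expr_mk (vec_zero hk hl) (const (encRat 0)))
      refl.of_snd
  have h0 : PolyTime O i fun _ => encRat 0 := const _
  refine trans_mk h.trans_src h.trans_guard h.trans_tgt h.trans_A ?_
    (encFun_append (e := fun _ => encRat) (n' := fun _ => 2) h.trans_b
      (encFun_two (e := fun _ => encRat) hflag hemit.expr_const))
  refine encFun_append (e := fun _ => encRow) (n' := fun _ => 2) ?_
    (encFun_two (e := fun _ => encRow) (row_ext (vec_zero hk (hl.add (.const 2))) h0)
      (row_ext (vec_obs hemit.expr_coeff h0 h0) h0))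
  refine encFun_map (e := fun _ => encRow) (e' := fun _ => encRow)
    (g := fun _ b => RegAut.ext (obs (fun i => b (some i)) 0 0) (b none)) h.trans_B ?_
  have h1 : PolyTime O (fun p : (a : α) × (Option (Fin (k a) ⊕ Fin (l a)) → ℚ) =>
    .pair (i p.1) (encRow p.2)) fun p => encRow p.2 := refl.of_snd
  exact (vec_obs h1.of_fst (const _) (const _)).row_ext h1.of_snd

/-- Each transition contributes at most its guard and a constant number of bits for the connectives,
and these are covered by the other fields of its encoding. So the conjunction grows linearly. -/
theorem size_encGuard_rest {k l n : ℕ} (L : List (Transition k l n)) (p : Fin n) :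
    (encGuard (Guard.rest L p)).size ≤ (ofList (L.map encTransition)).size + 20 := by
  induction L using List.reverseRecOn with
  | nil => simp [Guard.rest, encGuard, encOption, Data.size]
  | append_singleton L t ih =>
    have h1 : (encGuard t.guard).size + 10 ≤ (encTransition t).size := by
      have h1 := (encFin t.src).size_pos
      have h2 := (encFin t.tgt).size_pos
      have h3 := (encFun (encOption encFin) t.A).size_pos
      have h4 := (encFun encRow t.B).size_pos
      simp only [encTransition, ofList, Data.size]
      omega
    have h2 := size_ofList_append (L.map encTransition) [encTransition t]
    rw [List.map_append, List.map_singleton]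
    simp only [ofList, Data.size, Int.natAbs_zero, Nat.size_zero] at h2
    rw [Guard.rest_concat]
    split_ifs
    · have h3 : (Int.natAbs 2).size = 2 := by decide
      simp only [encGuard, Data.size, Int.natAbs_one, Nat.size_one, h3]
      omega
    · omega

theorem guard_rest {L : ∀ a, List (Transition (k a) (l a) (n a))} {p : ∀ a, Fin (n a)}
    (hL : PolyTime O i fun a => ofList ((L a).map encTransition))
    (hp : PolyTime O i fun a => encFin (p a)) :
    PolyTime O i fun a => encGuard (Guard.rest (L a) (p a)) := by
  have h := hL.fold (acc := fun a j => encGuard (Guard.rest ((L a).take j) (p a)))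
    (b := fun a => (ofList ((L a).map encTransition)).size + 20)
    (const (encGuard (.le none none : Guard 0))) (hL.size_le.add (.const _ _)) ?_ ?_
  · exact h.congr fun a => by rw [List.length_map, List.take_length]
  · intro a j _
    have h1 := size_encGuard_rest ((L a).take j) (p a)
    have h2 := size_ofList_append (((L a).take j).map encTransition) (((L a).drop j).map encTransition)
    have h3 := (ofList (((L a).drop j).map encTransition)).size_pos
    rw [← List.map_append, List.take_append_drop] at h2
    omega
  · let β := (a : α) × Fin ((L a).map encTransition).length
    let t (p : β) : Transition (k p.1) (l p.1) (n p.1) := (L p.1)[p.2.1]'(by simpa using p.2.2)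
    have r := refl (O := O) (i := fun q : β => .pair (i q.1) (.pair ((L q.1).map encTransition)[q.2]
      (encGuard (Guard.rest ((L q.1).take q.2) (p q.1)))))
    have h1 := r.of_snd.of_fst.congr (x := fun q => encTransition (t q)) fun q => by simp [t]
    have h2 := r.of_snd.of_snd
    refine (ite_eq (p := fun q => (t q).src) (q := fun q => p q.1) h1.trans_src hp.ext
      (guard_conj (ψ := fun q => (t q).guard.neg) h2 ((const (.num 1)).pair h1.trans_guard))
      h2).congr fun q => ?_
    have h3 : (L q.1).take (q.2 + 1) = (L q.1).take q.2 ++ [t q] :=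
      (List.take_concat_get' _ _ _).symm
    rw [h3, Guard.rest_concat]
    split_ifs <;> rfl

end Transitions

end PolyTime
end RegAut

/-! ### The constructions on automata in polynomial time -/

namespace RegAut

open Data

namespace PolyTime

variable {O : Data → Bool → Prop} {α : Type} {i : α → Data} {A A' : α → RAQ}

section Automata

theorem raq_init (h : PolyTime O i fun a => encRAQ (A a)) : PolyTime O i fun a => encFin (A a).q₀ :=
  h.of_snd.of_snd.of_snd.of_fst

theorem raq_vec (h : PolyTime O i fun a => encRAQ (A a)) : PolyTime O i fun a => encVec (A a).u₀ :=
  h.of_snd.of_snd.of_snd.of_snd.of_fst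

theorem raq_trans (h : PolyTime O i fun a => encRAQ (A a)) :
    PolyTime O i fun a => ofList ((A a).δ.map encTransition) :=
  h.of_snd.of_snd.of_snd.of_snd.of_snd.of_fst

theorem raq_out (h : PolyTime O i fun a => encRAQ (A a)) :
    PolyTime O i fun a => encFun (encOption encLinExpr) (A a).ζ :=
  h.of_snd.of_snd.of_snd.of_snd.of_snd.of_snd.of_fst

theorem raq_k (h : PolyTime O i fun a => encRAQ (A a)) : PolyDim O i fun a => (A a).k :=
  ⟨encFun_bdd (e := fun _ => encRat) h.raq_vec.vec_inl, h.of_fst⟩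

theorem raq_l (h : PolyTime O i fun a => encRAQ (A a)) : PolyDim O i fun a => (A a).l :=
  ⟨encFun_bdd (e := fun _ => encRat) h.raq_vec.vec_inr, h.of_snd.of_fst⟩

theorem raq_n (h : PolyTime O i fun a => encRAQ (A a)) : PolyDim O i fun a => (A a).n :=
  ⟨encFun_bdd (e := fun _ => encOption encLinExpr) h.raq_out, h.of_snd.of_snd.of_fst⟩

theorem raq_mk (hk : PolyDim O i fun a => (A a).k) (hl : PolyDim O i fun a => (A a).l)
    (hn : PolyDim O i fun a => (A a).n) (h1 : PolyTime O i fun a => encFin (A a).q₀)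
    (h2 : PolyTime O i fun a => encVec (A a).u₀)
    (h3 : PolyTime O i fun a => ofList ((A a).δ.map encTransition))
    (h4 : PolyTime O i fun a => encFun (encOption encLinExpr) (A a).ζ) :
    PolyTime O i fun a => encRAQ (A a) :=
  hk.num.cons (hl.num.cons (hn.num.cons (h1.cons (h2.cons (h3.cons (h4.cons nil))))))

theorem raq_sync {I : ∀ a, List (Transition (A' a).k (A' a).l (A' a).n)}
    (h : PolyTime O i fun a => encRAQ (A a)) (h' : PolyTime O i fun a => encRAQ (A' a))
    (hI : PolyTime O i fun a => ofList ((I a).map encTransition)) :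
    PolyTime O i fun a => encRAQ (sync (A a) (A' a) (I a)) := by
  refine raq_mk (h.raq_k.add h'.raq_k) (h.raq_l.add h'.raq_l) (h.raq_n.mul h'.raq_n)
    (finProd h'.raq_n h.raq_init h'.raq_init) (h.raq_vec.vec_join h'.raq_vec) ?_ ?_
  · have h1 : PolyTime O i fun a => ofList ((A a).δ.flatMap fun t =>
        (A' a).δ.map fun t' => encTransition (t.sync t')) := by
      refine flatMap (e := fun _ => encTransition)
        (f := fun a t => (A' a).δ.map fun t' => encTransition (t.sync t')) h.raq_trans ?_
      refine map (L := fun p : (a : α) × Transition (A a).k (A a).l (A a).n => (A' p.1).δ)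
        (e := fun _ => encTransition) (f := fun p t' => encTransition (p.2.sync t'))
        h'.raq_trans.ext ?_
      let β := (a : α) × Transition (A a).k (A a).l (A a).n
      let γ := (p : β) × Transition (A' p.1).k (A' p.1).l (A' p.1).n
      have h1 : PolyTime O (fun p : β => .pair (i p.1) (encTransition p.2))
        fun p => encTransition p.2 := refl.of_snd
      have h2 : PolyTime O (fun p : γ => .pair (.pair (i p.1.1) (encTransition p.1.2))
        (encTransition p.2)) fun p => encTransition p.2 := refl.of_snd
      have hm {m : α → ℕ} (h : PolyDim O i m) : PolyDim O (fun p : γ => .pair (.pair (i p.1.1)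
          (encTransition p.1.2)) (encTransition p.2)) fun p => m p.1.1 :=
        (h.ext (y := fun p : β => encTransition p.2)).ext (y := fun p : γ => encTransition p.2)
      exact trans_sync (t := fun p : γ => p.1.2) (t' := fun p : γ => p.2) (hm h.raq_k) (hm h.raq_l)
        (hm h'.raq_k) (hm h'.raq_l) (hm h'.raq_n) h1.ext h2
    have h2 : PolyTime O i fun a => ofList ((List.finRange (A a).n).flatMap fun p =>
        (I a).map fun t' => encTransition ((Transition.idle (A a).k (A a).l p).sync t')) := by
      refine flatMap (e := fun _ => encFin)
        (f := fun a p => (I a).map fun t' =>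
          encTransition ((Transition.idle (A a).k (A a).l p).sync t'))
        ((encFun_ofFn (e := fun _ => encFin) (f := fun a j => j) h.raq_n refl.of_snd).congr
          fun a => by rw [encFun, List.ofFn_eq_map]) ?_
      refine map (L := fun p : (a : α) × Fin (A a).n => I p.1) (e := fun _ => encTransition)
        (f := fun p t' => encTransition ((Transition.idle (A p.1).k (A p.1).l p.2).sync t'))
        hI.ext ?_
      let β := (a : α) × Fin (A a).n
      let γ := (p : β) × Transition (A' p.1).k (A' p.1).l (A' p.1).n
      have h1 : PolyTime O (fun p : β => .pair (i p.1) (encFin p.2)) fun p => encFin p.2 :=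
        refl.of_snd
      have h2 : PolyTime O (fun p : γ => .pair (.pair (i p.1.1) (encFin p.1.2))
        (encTransition p.2)) fun p => encTransition p.2 := refl.of_snd
      have hm {m : α → ℕ} (h : PolyDim O i m) : PolyDim O (fun p : γ => .pair (.pair (i p.1.1)
          (encFin p.1.2)) (encTransition p.2)) fun p => m p.1.1 :=
        (h.ext (y := fun p : β => encFin p.2)).ext (y := fun p : γ => encTransition p.2)
      exact trans_sync (t := fun p : γ => Transition.idle (A p.1.1).k (A p.1.1).l p.1.2)
        (t' := fun p : γ => p.2) (hm h.raq_k) (hm h.raq_l) (hm h'.raq_k) (hm h'.raq_l)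
        (hm h'.raq_n) (trans_idle h.raq_k.ext h.raq_l.ext h1).ext h2
    refine (h1.append h2).congr fun a => ?_
    simp only [sync, List.map_append, List.map_flatMap, List.map_map]
    rfl
  · refine encFun_ofFn (e := fun _ => encOption encLinExpr) (h.raq_n.mul h'.raq_n) ?_
    let β := (a : α) × Fin ((A a).n * (A' a).n)
    have h1 : PolyTime O (fun p : β => .pair (i p.1) (encFin p.2)) fun p => encFin p.2 :=
      refl.of_snd
    exact expr_map₂ (encFun_get (e := fun _ => encOption encLinExpr) h.raq_out.ext
        (finProd_symm_fst h'.raq_n.ext h1))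
      (encFun_get (e := fun _ => encOption encLinExpr) h'.raq_out.ext
        (finProd_symm_snd h'.raq_n.ext h1))

theorem raq_complete (h : PolyTime O i fun a => encRAQ (A a)) :
    PolyTime O i fun a => encRAQ (complete (A a)) := by
  -- Adding a last state changes no index, so lifted transitions have the same encodings.
  have hlift : PolyTime O i fun a => ofList (((A a).δ.map Transition.lift).map encTransition) :=
    h.raq_trans.congr fun a => by rw [List.map_map]; rfl
  refine raq_mk h.raq_k h.raq_l (h.raq_n.add (.const 1)) h.raq_init h.raq_vec ?_
    (encFun_append (e := fun _ => encOption encLinExpr) (n' := fun _ => 1) h.raq_out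
      (encFun_const (e := fun _ => encOption encLinExpr) (.const 1) (const (.num 0))))
  have h1 : PolyTime O i fun a => encFun encTransition
      (Transition.toSink ((A a).δ.map Transition.lift)) := by
    refine encFun_ofFn (e := fun _ => encTransition) (h.raq_n.add (.const 1)) ?_
    let β := (a : α) × Fin ((A a).n + 1)
    have h1 : PolyTime O (fun p : β => .pair (i p.1) (encFin p.2)) fun p => encFin p.2 :=
      refl.of_snd
    refine trans_mk h1 (guard_rest (L := fun p : β => (A p.1).δ.map Transition.lift) hlift.ext h1)
      (h.raq_n.num.ext.congr fun p => by simp [encFin, Transition.toSink]) (encFun_some h.raq_k.ext)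
      (encFun_const (e := fun _ => encRow) (x := fun _ => 0) h.raq_l.ext
        ((vec_zero h.raq_k.ext h.raq_l.ext).row_ext (const (encRat 0))))
      (encFun_const (e := fun _ => encRat) (x := fun _ => 0) h.raq_l.ext (const (encRat 0)))
  refine (hlift.append h1).congr fun a => ?_
  rw [complete, List.map_append, List.map_ofFn]
  rfl

theorem raq_observe {cf cy : ℚ} (h : PolyTime O i fun a => encRAQ (A a)) :
    PolyTime O i fun a => encRAQ (observe (A a) cf cy) := by
  have h0 : PolyTime O i fun _ => encRat 0 := const _
  refine raq_mk h.raq_k (h.raq_l.add (.const 2)) h.raq_n h.raq_init (vec_obs h.raq_vec h0 h0) ?_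
    (encFun_const (e := fun _ => encOption encLinExpr) h.raq_n (encOption_some
      (e := fun _ => encLinExpr) (expr_mk (vec_obs (vec_zero h.raq_k h.raq_l) (const _) (const _)) h0)))
  refine (map (L := fun a => (A a).δ) (e := fun _ => encTransition)
    (f := fun a t => encTransition (t.observe ((A a).ζ t.src))) h.raq_trans ?_).congr fun a => by
      rw [observe, List.map_map]; rfl
  let β := (a : α) × Transition (A a).k (A a).l (A a).n
  have h1 : PolyTime O (fun p : β => .pair (i p.1) (encTransition p.2))
    fun p => encTransition p.2 := refl.of_snd
  exact trans_observe h.raq_k.ext h.raq_l.ext h1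
    (encFun_get (e := fun _ => encOption encLinExpr) h.raq_out.ext h1.trans_src)

theorem raq_record {cf cy : ℚ} (h : PolyTime O i fun a => encRAQ (A a)) :
    PolyTime O i fun a => encRAQ (record (A a) cf cy) := h.raq_complete.raq_observe

theorem raq_focus {q : ∀ a, Fin (A a).n} {g : ∀ a, LinExpr (A a).k (A a).l}
    (h : PolyTime O i fun a => encRAQ (A a)) (hq : PolyTime O i fun a => encFin (q a))
    (hg : PolyTime O i fun a => encLinExpr (g a)) :
    PolyTime O i fun a => encRAQ (focus (A a) (q a) (g a)) := by
  refine raq_mk h.raq_k h.raq_l h.raq_n h.raq_init h.raq_vec h.raq_trans ?_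
  refine encFun_ofFn (e := fun _ => encOption encLinExpr) h.raq_n ?_
  let β := (a : α) × Fin (A a).n
  have h1 : PolyTime O (fun p : β => .pair (i p.1) (encFin p.2)) fun p => encFin p.2 :=
    refl.of_snd
  refine (ite_eq (p := fun p : β => p.2) (q := fun p => q p.1) h1 hq.ext
    (encOption_some (e := fun _ => encLinExpr) hg.ext) (const (.num 0))).congr fun p => ?_
  simp only [focus]
  split_ifs <;> rfl

end Automata

end PolyTime

/-! ### The cycle through equivalence and commutativity, and non-zero to invariants -/

section Reductions

theorem ofList_map_ofFn {β : Type} (e : β → Data) {n : ℕ} (f : Fin n → β) :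
    ofList ((List.ofFn f).map e) = encFun e f := by
  rw [List.map_ofFn]; rfl

theorem equivalence_cookReducible_nonZero : CookReducible equivalence nonZero := by
  have h1 : PolyTime nonZero.oracle equivalence.encode fun a => encRAQ a.1.1 := PolyTime.refl.of_fst
  have h2 : PolyTime nonZero.oracle equivalence.encode fun a => encRAQ a.2.1 := PolyTime.refl.of_snd
  have h (cf cy : ℚ) : PolyTime nonZero.oracle equivalence.encode
      fun a => encRAQ (difference a.1.1 a.2.1 cf cy) :=
    h1.raq_record.raq_sync h2.raq_record (I := fun _ => []) PolyTime.nil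
  refine cookReducible_of_iff_not_exists _ ?_ equivalence_holds_iff
  exact (h 1 0).cons ((h 0 1).cons .nil)

theorem commutativity_cookReducible_equivalence : CookReducible commutativity equivalence := by
  have h1 : PolyTime equivalence.oracle commutativity.encode fun a => encRAQ a.1 := PolyTime.refl
  have h (b : Bool) : PolyTime equivalence.oracle commutativity.encode
      fun a => encRAQ (swapped a.1 b) :=
    -- The controller and its list of idle transitions are fixed, hence constants of the program.
    h1.raq_sync (A' := fun _ => swapper b) (I := fun _ => swapperIdle b) (.const _) (.const _)
  refine cookReducible_of_iff_exists _ ?_ commutativity_holds_iff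
  exact ((h true).pair (h false)).cons .nil

theorem nonZero_cookReducible_commutativity : CookReducible nonZero commutativity := by
  have h1 : PolyTime commutativity.oracle nonZero.encode fun a => encRAQ a.1 := PolyTime.refl
  have h : PolyTime commutativity.oracle nonZero.encode fun a => encRAQ (selected a.1) :=
    h1.raq_record.raq_sync (A' := fun _ => selector) (I := fun _ => selectorIdle) (.const _) (.const _)
  refine cookReducible_of_iff_not_exists _ ?_ nonZero_holds_iff_selected
  exact h.cons .nil

theorem PolyTime.unitVec {O : Data → Bool → Prop} {α : Type} {i : α → Data} {k l : α → ℕ}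
    {j : ∀ a, Fin (k a + l a)} (hk : PolyDim O i k) (hl : PolyDim O i l)
    (hj : PolyTime O i fun a => encFin (j a)) :
    PolyTime O i fun a => encVec (RegAut.unitVec (j a)) := by
  have h1 : PolyTime O (fun p : (a : α) × Fin (k a) => .pair (i p.1) (encFin p.2))
    fun p => encFin p.2 := refl.of_snd
  have h2 : PolyTime O (fun p : (a : α) × Fin (l a + 1) => .pair (i p.1) (encFin p.2))
    fun p => encFin p.2 := refl.of_snd
  refine (encFun_ofFn (e := fun _ => encRat) hk ?_).pair
    (encFun_ofFn (e := fun _ => encRat) (hl.add (.const 1)) ?_)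
  · refine ((h1.eq hj.ext).ite (const (encRat 1)) (const (encRat 0))).congr fun p => ?_
    rw [unitVec_inl]
    simp only [Nat.cast_inj]
    split_ifs <;> rfl
  · refine (((hk.num.ext.add h2).eq hj.ext).ite (const (encRat 1)) (const (encRat 0))).congr
      fun p => ?_
    rw [unitVec_inr]
    simp only [← Nat.cast_add, Nat.cast_inj]
    split_ifs <;> rfl

theorem nonZero_cookReducible_invariantBasis : CookReducible nonZero invariantBasis := by
  have h : PolyTime invariantBasis.oracle nonZero.encode fun a => encRAQ a.1 := PolyTime.refl
  have hm := h.raq_k.add (h.raq_l.add (.const 1))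
  have h0 := PolyTime.vec_zero h.raq_k (h.raq_l.add (.const 2))
  have hv : PolyTime invariantBasis.oracle nonZero.encode fun a => encFun encVec
      (unitVec (k := a.1.k) (l := a.1.l + 1)) :=
    PolyTime.encFun_ofFn (e := fun _ => encVec) hm (PolyTime.unitVec
      (j := fun p : (a : DetRAQ) × Fin (a.1.k + (a.1.l + 1)) => p.2) h.raq_k.ext
      (h.raq_l.ext.add (.const 1)) PolyTime.refl.of_snd)
  refine cookReducible_of_iff_exists _ ?_ nonZero_holds_iff_basis
  refine (PolyTime.encFun_ofFn (e := fun _ => invariantBasis.encode) (f := basisQuery)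
    (h.raq_n.add (.const 1)) ?_).congr fun a => (ofList_map_ofFn _ _).symm
  exact (h.raq_record (cf := 0) (cy := 1)).ext.cons (PolyTime.refl.of_snd.cons (h0.ext.cons
    (hm.num.ext.cons (hv.ext.cons .nil))))

theorem nonZero_cookReducible_invariantSpan : CookReducible nonZero invariantSpan := by
  have h : PolyTime invariantSpan.oracle nonZero.encode fun a => encRAQ a.1 := PolyTime.refl
  have hm := h.raq_k.add (h.raq_l.add (.const 1))
  have h0 := PolyTime.vec_zero h.raq_k (h.raq_l.add (.const 2))
  have hv : PolyTime invariantSpan.oracle nonZero.encode fun a => encFun encVec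
      (unitVec (k := a.1.k) (l := a.1.l + 1)) :=
    PolyTime.encFun_ofFn (e := fun _ => encVec) hm (PolyTime.unitVec
      (j := fun p : (a : DetRAQ) × Fin (a.1.k + (a.1.l + 1)) => p.2) h.raq_k.ext
      (h.raq_l.ext.add (.const 1)) PolyTime.refl.of_snd)
  refine cookReducible_of_iff_exists _ ?_ nonZero_holds_iff_span
  refine (PolyTime.encFun_ofFn (e := fun _ => invariantSpan.encode) (f := spanQuery)
    (h.raq_n.add (.const 1)) ?_).congr fun a => (ofList_map_ofFn _ _).symm
  exact (h.raq_record (cf := 0) (cy := 1)).ext.cons (PolyTime.refl.of_snd.cons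
    (hm.num.ext.cons ((PolyTime.encFun_cons (e := fun _ => encVec) h0 hv).ext.cons .nil)))

end Reductions
end RegAut

/-! ### Fraction-free elimination in polynomial time -/

namespace RegAut

open Data

namespace PolyTime

variable {O : Data → Bool → Prop} {α : Type} {i : α → Data}

section Elimination

open Matrix

variable {n m : α → ℕ}

theorem dotProduct {u v : ∀ a, Fin (n a) → ℤ} (hn : PolyDim O i n)
    (hu : PolyTime O i fun a => encFun .num (u a)) (hv : PolyTime O i fun a => encFun .num (v a)) :
    PolyTime O i fun a => num (u a ⬝ᵥ v a) := by
  refine sum_int (f := fun a j => u a j * v a j) hn.bdd hn.num ?_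
  have h1 : PolyTime O (fun p : (a : α) × Fin (n a) => .pair (i p.1) (encFin p.2))
    fun p => encFin p.2 := refl.of_snd
  exact (encFun_get (e := fun _ => .num) hu.ext h1).mul (encFun_get (e := fun _ => .num) hv.ext h1)

theorem mulVec {M : ∀ a, Matrix (Fin (m a)) (Fin (n a)) ℤ} {v : ∀ a, Fin (n a) → ℤ}
    (hn : PolyDim O i n) (hM : PolyTime O i fun a => encFun (encFun .num) (M a))
    (hv : PolyTime O i fun a => encFun .num (v a)) :
    PolyTime O i fun a => encFun .num (M a *ᵥ v a) := by
  refine encFun_map (e := fun _ => encFun .num) (e' := fun _ => .num)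
    (g := fun a r => r ⬝ᵥ v a) hM ?_
  have h1 : PolyTime O (fun p : (a : α) × (Fin (n a) → ℤ) => .pair (i p.1) (encFun .num p.2))
    fun p => encFun .num p.2 := refl.of_snd
  exact dotProduct hn.ext h1 hv.ext

theorem matrix_ofFn {M : ∀ a, Matrix (Fin (m a)) (Fin (n a)) ℤ} (hm : PolyDim O i m)
    (hn : PolyDim O i n) (hM : PolyTime O (fun p : (p : (a : α) × Fin (m a)) × Fin (n p.1) =>
      .pair (.pair (i p.1.1) (encFin p.1.2)) (encFin p.2)) fun p => .num (M p.1.1 p.1.2 p.2)) :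
    PolyTime O i fun a => encFun (encFun .num) (M a) :=
  encFun_ofFn (e := fun _ => encFun .num) hm (encFun_ofFn (e := fun _ => .num) hn.ext hM)

/-- The encoding of the state of an elimination. -/
def encElim {n : ℕ} (s : ℤ × Matrix (Fin n) (Fin n) ℤ) : Data :=
  .pair (.num s.1) (encFun (encFun .num) s.2)

theorem elimStep {s : ∀ a, ℤ × Matrix (Fin (n a)) (Fin (n a)) ℤ} {v : ∀ a, Fin (n a) → ℤ}
    (hn : PolyDim O i n) (hs : PolyTime O i fun a => encElim (s a))
    (hv : PolyTime O i fun a => encFun .num (v a)) :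
    PolyTime O i fun a => encElim (RegAut.elimStep (s a) (v a)) := by
  have hr := mulVec hn hs.of_snd hv
  have hq := dotProduct hn hv hr
  have hM : PolyTime O i fun a => encFun (encFun .num) (Matrix.of fun x y =>
      ((v a ⬝ᵥ (s a).2 *ᵥ v a) * (s a).2 x y -
        ((s a).2 *ᵥ v a) x * ((s a).2 *ᵥ v a) y) / (s a).1) := by
    refine matrix_ofFn hn hn ?_
    let β := (a : α) × Fin (n a)
    have h1 : PolyTime O (fun p : β => .pair (i p.1) (encFin p.2)) fun p => encFin p.2 :=
      refl.of_snd
    have h2 : PolyTime O (fun p : (p : β) × Fin (n p.1) =>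
      .pair (.pair (i p.1.1) (encFin p.1.2)) (encFin p.2)) fun p => encFin p.2 := refl.of_snd
    have h3 := (encFun_get (e := fun _ => encFun .num) hs.of_snd.ext h1)
    have h4 := (encFun_get (e := fun _ => .num) hr.ext h1)
    have h5 := (hs.of_fst.ext (y := fun p : β => encFin p.2)).ext
      (y := fun p : (p : β) × Fin (n p.1) => encFin p.2)
    have h6 := (hq.ext (y := fun p : β => encFin p.2)).ext
      (y := fun p : (p : β) × Fin (n p.1) => encFin p.2)
    have h7 := (hr.ext (y := fun p : β => encFin p.2)).ext
      (y := fun p : (p : β) × Fin (n p.1) => encFin p.2)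
    exact ((h6.mul (encFun_get (e := fun _ => .num) h3.ext h2)).sub
      (h4.ext.mul (encFun_get (e := fun _ => .num) h7 h2))).div h5
  refine ((hq.eq (const (.num 0))).ite hs (hq.pair hM)).congr fun a => ?_
  unfold RegAut.elimStep
  split_ifs <;> rfl

theorem _root_.RegAut.one_le_prod_int {L : List ℤ} (h : ∀ x ∈ L, 1 ≤ x) : 1 ≤ L.prod := by
  induction L with
  | nil => simp
  | cons x L ih =>
    have h1 := h x List.mem_cons_self
    have h2 := ih fun y hy => h y (List.mem_cons_of_mem _ hy)
    rw [List.prod_cons]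
    nlinarith

/-- All factors are at least 1, so the product over all vectors bounds every intermediate
denominator. -/
theorem _root_.RegAut.eliminate_take_le {n : ℕ} (L : List (Fin n → ℤ)) (j : ℕ) :
    (eliminate (L.take j)).1 ≤ (L.map fun v => 1 + v ⬝ᵥ v).prod := by
  refine (elimInv_eliminate (L.take j)).2.trans ?_
  have h (L : List (Fin n → ℤ)) : 1 ≤ (L.map fun v => 1 + v ⬝ᵥ v).prod := by
    refine one_le_prod_int fun x hx => ?_
    obtain ⟨v, -, rfl⟩ := List.mem_map.1 hx
    exact le_add_of_nonneg_right (Finset.sum_nonneg fun i _ => mul_self_nonneg (v i))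
  conv_rhs => rw [← List.take_append_drop j L, List.map_append, List.prod_append]
  exact le_mul_of_one_le_right (zero_le_one.trans (h _)) (h _)

/-- The entries of a projection are at most 1 in absolute value, so the numerators are bounded by
the denominator, and thus by `c`. -/
theorem _root_.RegAut.size_encElim_le {n : ℕ} (L : List (Fin n → ℤ)) (j : ℕ) {c : ℤ}
    (hc : (L.map fun v => 1 + v ⬝ᵥ v).prod = c) : (encElim (eliminate (L.take j))).size ≤
      1 + (num c).size + (1 + n * (1 + (1 + n * (1 + (num c).size)))) := by
  have h := (elimInv_eliminate (L.take j)).1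
  have h0 := h.1
  have h1 := eliminate_take_le L j
  rw [hc] at h1
  have h2 {z : ℤ} (hz : |z| ≤ (eliminate (L.take j)).1) : (num z).size ≤ (num c).size := by
    have hz := hz.trans h1
    rw [Int.abs_eq_natAbs] at hz
    exact Nat.add_le_add_left (Nat.size_le_size (by omega)) 1
  have h3 (x : Fin n) : (encFun .num ((eliminate (L.take j)).2 x)).size ≤
      1 + n * (1 + (num c).size) := by
    refine (size_ofList_le (c := (num c).size) fun d hd => ?_).trans (by rw [List.length_ofFn])
    obtain ⟨y, rfl⟩ := (List.mem_ofFn' _ _).1 hd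
    exact h2 (h.abs_apply_le x y)
  refine Nat.add_le_add (Nat.add_le_add_left (h2 (abs_of_pos h0).le) 1) ?_
  refine (size_ofList_le (c := 1 + n * (1 + (num c).size)) fun d hd => ?_).trans
    (by rw [List.length_ofFn])
  obtain ⟨y, rfl⟩ := (List.mem_ofFn' _ _).1 hd
  exact h3 y

theorem eliminate {w : ∀ a, Fin (m a) → Fin (n a) → ℤ} (hn : PolyDim O i n) (hm : PolyDim O i m)
    (hw : PolyTime O i fun a => encFun (encFun .num) (w a)) :
    PolyTime O i fun a => encElim (RegAut.eliminate (List.ofFn (w a))) := by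
  -- This product is computed only for the sake of a bound: as the result of a polynomial-time
  -- computation it has polynomial size, and it dominates all the numbers in the elimination states.
  have hc : PolyTime O i fun a => num (∏ j, (1 + w a j ⬝ᵥ w a j)) := by
    refine prod_int (f := fun a j => 1 + w a j ⬝ᵥ w a j) hm.bdd hm.num ?_
    have h1 : PolyTime O (fun p : (a : α) × Fin (m a) => .pair (i p.1) (encFin p.2))
      fun p => encFin p.2 := refl.of_snd
    have h2 := encFun_get (e := fun _ => encFun .num) hw.ext h1
    exact add (u := fun _ => 1) (const _) (dotProduct hn.ext h2 h2)
  have hone : PolyTime O i fun a => encElim (1, (1 : Matrix (Fin (n a)) (Fin (n a)) ℤ)) := by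
    refine (const (.num 1)).pair (matrix_ofFn hn hn ?_)
    let β := (a : α) × Fin (n a)
    have h1 : PolyTime O (fun p : β => .pair (i p.1) (encFin p.2)) fun p => encFin p.2 :=
      refl.of_snd
    have h2 : PolyTime O (fun p : (p : β) × Fin (n p.1) =>
      .pair (.pair (i p.1.1) (encFin p.1.2)) (encFin p.2)) fun p => encFin p.2 := refl.of_snd
    refine (ite_eq (p := fun p : (p : β) × Fin (n p.1) => p.1.2) (q := fun p => p.2) h1.ext h2
      (const (.num 1)) (const (.num 0))).congr fun p => ?_
    have h3 : (1 : Matrix (Fin (n p.1.1)) (Fin (n p.1.1)) ℤ) p.1.2 p.2 =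
      if p.1.2 = p.2 then 1 else 0 := Matrix.one_apply
    refine Eq.trans ?_ (congrArg Data.num h3.symm)
    split_ifs <;> rfl
  have h := PolyTime.fold (L := fun a => List.ofFn fun j => encFun .num (w a j))
    (acc := fun a j => encElim (RegAut.eliminate ((List.ofFn (w a)).take j)))
    (b := fun a => 1 + (num (∏ j, (1 + w a j ⬝ᵥ w a j))).size +
      (1 + n a * (1 + (1 + n a * (1 + (num (∏ j, (1 + w a j ⬝ᵥ w a j))).size)))))
    hw hone ?_ ?_ ?_
  · refine h.congr fun a => ?_
    rw [List.length_ofFn, List.take_of_length_le (by rw [List.length_ofFn])]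
  · have h1 := PolyBdd.const i 1
    exact (h1.add hc.size_le).add (h1.add (hn.bdd.mul
       (h1.add (h1.add (hn.bdd.mul (h1.add hc.size_le))))))
  · intro a j _
    exact size_encElim_le _ _ (by rw [List.map_ofFn, List.prod_ofFn]; rfl)
  · let β := (a : α) × Fin (List.ofFn fun j => encFun .num (w a j)).length
    let v (p : β) : Fin (n p.1) → ℤ := w p.1 (p.2.cast (List.length_ofFn ..))
    have r := refl (O := O) (i := fun q : β => .pair (i q.1) (.pair
      (List.ofFn fun j => encFun .num (w q.1 j))[q.2]
      (encElim (RegAut.eliminate ((List.ofFn (w q.1)).take q.2)))))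
    have h1 := r.of_snd.of_fst.congr (x := fun q => encFun .num (v q)) fun q => by simp [v]; rfl
    refine (elimStep hn.ext r.of_snd.of_snd h1).congr fun q => ?_
    have h3 : (List.ofFn (w q.1)).take (q.2 + 1) = (List.ofFn (w q.1)).take q.2 ++ [v q] := by
      have h4 : (q.2 : ℕ) < (List.ofFn (w q.1)).length := by
        simpa using q.2.2
      rw [← List.take_concat_get' _ _ h4]
      simp [v]
      rfl
    rw [h3, eliminate_concat]

end Elimination

end PolyTime
end RegAut

/-! ### The non-zero queries for an affine space in polynomial time -/

namespace RegAut

open Data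

namespace PolyTime

variable {O : Data → Bool → Prop} {α : Type} {i : α → Data} {k l n m : α → ℕ}

theorem homog {u : ∀ a, Vec (k a) (l a)} {c : α → ℚ} (h : PolyTime O i fun a => encVec (u a))
    (hc : PolyTime O i fun a => encRat (c a)) :
    PolyTime O i fun a => encFun encRat (RegAut.homog (u a) (c a)) :=
  encFun_append (e := fun _ => encRat) (n' := fun _ => 1)
    (encFun_append (e := fun _ => encRat) h.vec_inl h.vec_inr)
    (encFun_const (e := fun _ => encRat) (.const 1) hc)

theorem scale {x : ∀ a, Fin (n a) → ℚ} (hn : PolyDim O i n)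
    (hx : PolyTime O i fun a => encFun encRat (x a)) :
    PolyTime O i fun a => encFun .num (RegAut.scale (x a)) := by
  have h1 : PolyTime O (fun p : (a : α) × Fin (n a) => .pair (i p.1) (encFin p.2))
    fun p => encFin p.2 := refl.of_snd
  have h2 := encFun_get (e := fun _ => encRat) hx.ext h1
  have h3 : PolyTime O i fun a => num (∏ j, ((x a j).den : ℤ)) :=
    prod_int (f := fun a j => ((x a j).den : ℤ)) hn.bdd hn.num h2.of_snd
  exact encFun_ofFn (e := fun _ => .num) hn (h2.of_fst.mul (h3.ext.div h2.of_snd))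

theorem expr_ofHomog {r : ∀ a, Fin (k a + l a + 1) → ℤ} (hk : PolyDim O i k) (hl : PolyDim O i l)
    (hr : PolyTime O i fun a => encFun .num (r a)) :
    PolyTime O i fun a => encLinExpr (LinExpr.ofHomog (r a)) := by
  have hrat {β : Type} {y : β → Data} {z : β → ℤ} (h : PolyTime O y fun b => num (z b)) :
      PolyTime O y fun b => encRat (z b) :=
    (h.pair (const (.num 1))).congr fun b => (encRat_intCast _).symm
  refine expr_mk (PolyTime.pair ?_ ?_) ?_
  · refine encFun_ofFn (e := fun _ => encRat) hk (hrat ?_)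
    have h1 : PolyTime O (fun p : (a : α) × Fin (k a) => .pair (i p.1) (encFin p.2))
      fun p => encFin (Fin.castAdd 1 (Fin.castAdd (l p.1) p.2)) := refl.of_snd
    exact encFun_get (e := fun _ => .num) hr.ext h1
  · refine encFun_ofFn (e := fun _ => encRat) hl (hrat ?_)
    have h1 : PolyTime O (fun p : (a : α) × Fin (l a) => .pair (i p.1) (encFin p.2))
      fun p => encFin p.2 := refl.of_snd
    have h2 : PolyTime O (fun p : (a : α) × Fin (l a) => .pair (i p.1) (encFin p.2))
        fun p => encFin (Fin.castAdd 1 (Fin.natAdd (k p.1) p.2)) :=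
      (hk.num.ext.add h1).congr fun p => by simp [encFin]
    exact encFun_get (e := fun _ => .num) hr.ext h2
  · refine hrat (encFun_get (e := fun _ => .num) hr ((hk.num.add hl.num).congr fun a => ?_))
    simp [encFin]

theorem separator {x : ∀ a, Fin (m a) → Fin (k a + l a + 1) → ℚ} {j : ∀ a, Fin (k a + l a + 1)}
    (hk : PolyDim O i k) (hl : PolyDim O i l) (hm : PolyDim O i m)
    (hx : PolyTime O i fun a => encFun (encFun encRat) (x a))
    (hj : PolyTime O i fun a => encFin (j a)) :
    PolyTime O i fun a => encLinExpr (RegAut.separator (x a) (j a)) := by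
  have hn := (hk.add hl).add (.const 1)
  have h1 : PolyTime O i fun a => encFun (encFun .num) fun j => RegAut.scale (x a j) := by
    refine encFun_map (e := fun _ => encFun encRat) (e' := fun _ => encFun .num)
      (g := fun _ => RegAut.scale) hx ?_
    have h2 : PolyTime O (fun p : (a : α) × (Fin (k a + l a + 1) → ℚ) =>
      .pair (i p.1) (encFun encRat p.2)) fun p => encFun encRat p.2 := refl.of_snd
    exact scale hn.ext h2
  exact expr_ofHomog hk hl (encFun_get (e := fun _ => encFun .num) (eliminate hn hm h1).of_snd hj)

theorem focused {A : α → DetRAQ} {q : ∀ a, Fin (A a).1.n}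
    {x : ∀ a, Fin (m a) → Vec (A a).1.k (A a).1.l × ℚ} (hm : PolyDim O i m)
    (hA : PolyTime O i fun a => encRAQ (A a).1) (hq : PolyTime O i fun a => encFin (q a))
    (hx : PolyTime O i fun a => encFun (encFun encRat)
      fun j => RegAut.homog (x a j).1 (x a j).2) :
    PolyTime O i fun a => ofList ((List.ofFn (RegAut.focused (A a) (q a) (x a))).map
      nonZero.encode) := by
  refine (encFun_ofFn (e := fun _ => nonZero.encode) (f := fun a => RegAut.focused (A a) (q a) (x a))
    ((hA.raq_k.add hA.raq_l).add (.const 1)) ?_).congr fun a => (ofList_map_ofFn _ _).symm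
  have h1 : PolyTime O (fun p : (a : α) × Fin ((A a).1.k + (A a).1.l + 1) =>
    .pair (i p.1) (encFin p.2)) fun p => encFin p.2 := refl.of_snd
  exact hA.ext.raq_focus hq.ext (separator hA.raq_k.ext hA.raq_l.ext hm.ext hx.ext h1)

end PolyTime

/-! ### Reductions of the invariant problems to non-zero -/

theorem invariantBasis_cookReducible_nonZero : CookReducible invariantBasis nonZero := by
  have r := PolyTime.refl (O := nonZero.oracle) (i := invariantBasis.encode)
  have hA : PolyTime nonZero.oracle invariantBasis.encode fun a => encRAQ a.aut.1 := r.of_fst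
  have hq : PolyTime nonZero.oracle invariantBasis.encode fun a => encFin a.q := r.of_snd.of_fst
  have hp : PolyTime nonZero.oracle invariantBasis.encode fun a => encVec a.p :=
    r.of_snd.of_snd.of_fst
  have hv : PolyTime nonZero.oracle invariantBasis.encode fun a => encFun encVec a.v :=
    r.of_snd.of_snd.of_snd.of_snd.of_fst
  have hm : PolyDim nonZero.oracle invariantBasis.encode fun a => a.m :=
    ⟨PolyTime.encFun_bdd (e := fun _ => encVec) hv, r.of_snd.of_snd.of_snd.of_fst⟩
  refine cookReducible_of_iff_exists _ ?_ invariantBasis_holds_iff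
  refine PolyTime.focused (x := BasisInstance.generators) (hm.add (.const 1)) hA hq ?_
  have h1 : PolyTime nonZero.oracle (fun p : (a : BasisInstance) × Vec a.aut.1.k a.aut.1.l =>
    .pair (invariantBasis.encode p.1) (encVec p.2)) fun p => encVec p.2 := PolyTime.refl.of_snd
  refine (PolyTime.encFun_cons (e := fun _ => encFun encRat) (hp.homog (.const (encRat 1)))
    (PolyTime.encFun_map (e := fun _ => encVec) (e' := fun _ => encFun encRat)
      (g := fun _ u => homog u 0) hv (h1.homog (.const (encRat 0))))).congr fun a => ?_
  congr 1
  funext j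
  refine Fin.cases rfl (fun j => rfl) j

theorem invariantSpan_cookReducible_nonZero : CookReducible invariantSpan nonZero := by
  have r := PolyTime.refl (O := nonZero.oracle) (i := invariantSpan.encode)
  have hA : PolyTime nonZero.oracle invariantSpan.encode fun a => encRAQ a.aut.1 := r.of_fst
  have hq : PolyTime nonZero.oracle invariantSpan.encode fun a => encFin a.q := r.of_snd.of_fst
  have hv : PolyTime nonZero.oracle invariantSpan.encode fun a => encFun encVec a.v :=
    r.of_snd.of_snd.of_snd.of_fst
  have hm : PolyDim nonZero.oracle invariantSpan.encode fun a => a.m :=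
    ⟨(PolyTime.encFun_bdd (e := fun _ => encVec) hv).mono fun a => Nat.le_succ _,
      r.of_snd.of_snd.of_fst⟩
  refine cookReducible_of_iff_exists _ ?_ invariantSpan_holds_iff
  refine PolyTime.focused (x := SpanInstance.generators) (hm.add (.const 1)) hA hq ?_
  have h1 : PolyTime nonZero.oracle (fun p : (a : SpanInstance) × Vec a.aut.1.k a.aut.1.l =>
    .pair (invariantSpan.encode p.1) (encVec p.2)) fun p => encVec p.2 := PolyTime.refl.of_snd
  exact PolyTime.encFun_map (e := fun _ => encVec) (e' := fun _ => encFun encRat)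
    (g := fun _ u => homog u 1) hv (h1.homog (.const (encRat 1)))

end RegAut

/-! ### All reductions by way of non-zero -/

theorem mainTheorem3 :
    ∀ P ∈ [RegAut.equivalence, RegAut.commutativity, RegAut.nonZero,
        RegAut.invariantBasis, RegAut.invariantSpan],
      ∀ Q ∈ [RegAut.equivalence, RegAut.commutativity, RegAut.nonZero,
        RegAut.invariantBasis, RegAut.invariantSpan],
        RegAut.CookReducible P Q := by
  have hto : ∀ P ∈ [RegAut.equivalence, RegAut.commutativity, RegAut.nonZero,
      RegAut.invariantBasis, RegAut.invariantSpan], RegAut.CookReducible P RegAut.nonZero := by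
    simp only [List.forall_mem_cons, List.not_mem_nil, false_imp_iff, implies_true, and_true]
    exact ⟨RegAut.equivalence_cookReducible_nonZero,
      RegAut.commutativity_cookReducible_equivalence.trans
        RegAut.equivalence_cookReducible_nonZero,
      .refl _, RegAut.invariantBasis_cookReducible_nonZero,
      RegAut.invariantSpan_cookReducible_nonZero⟩
  have hfrom : ∀ Q ∈ [RegAut.equivalence, RegAut.commutativity, RegAut.nonZero,
      RegAut.invariantBasis, RegAut.invariantSpan], RegAut.CookReducible RegAut.nonZero Q := by
    simp only [List.forall_mem_cons, List.not_mem_nil, false_imp_iff, implies_true, and_true]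
    exact ⟨RegAut.nonZero_cookReducible_commutativity.trans
        RegAut.commutativity_cookReducible_equivalence,
      RegAut.nonZero_cookReducible_commutativity, .refl _,
      RegAut.nonZero_cookReducible_invariantBasis, RegAut.nonZero_cookReducible_invariantSpan⟩
  exact fun P hP Q hQ => (hto P hP).trans (hfrom Q hQ)
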